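/- **Notation.** Fix $r\in\mathbb N$; $M_n$ denotes the complex $n\times n$ matrices with the operator norm, $\mathbb H:=L_2((0,1),\mathbb C^r)\times L_2((0,1),\mathbb C^r)=L_2((0,1),\mathbb C^{2r})$, and $\mathscr I$ is the identity operator in $\mathbb H$. Let $\mathfrak a=((\lambda_j,\alpha_j))_{j\in\mathbb Z}$, where $(\lambda_j)$ is a strictly increasing sequence of real numbers with $\lambda_0\le 0<\lambda_1$ and the $\alpha_j\in M_r$ are non-zero with $\alpha_j=\alpha_j^*\ge 0$. Put $\Delta_n:=(\pi n-\frac{\pi}{2},\pi n+\frac{\pi}{2}]$, $n\in\mathbb Z$, and consider the conditions * $(A_1)$ $\ \sup_{n}\sum_{\lambda_j\in\Delta_n}1<\infty$, $\ \sum_{n\in\mathbb Z}\sum_{\lambda_j\in\Delta_n}|\lambda_j-\pi n|^2<\infty$, $\ \sum_{n\in\mathbb Z}\|I-\sum_{\lambda_j\in\Delta_n}\alpha_j\|^2<\infty$; * $(A_3)$ the system $\{e^{i\lambda_jt}d \mid j\in\mathbb Z,\ d\in\operatorname{Ran}\alpha_j\}$ is complete in $L_2((-1,1),\mathbb C^r)$.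 *Accelerant.* With $\mu:=\sum_j\alpha_j\delta_{\lambda_j}$ and $\mu_0:=\sum_{n\in\mathbb Z} I\delta_{\pi n}$ let $$H_\mu(x):=\lim_{n\to\infty}\int_{-\pi(n-\frac12)}^{\pi(n+\frac12)}e^{2i\lambda x}\,d(\mu-\mu_0)(\lambda),$$ the limit being taken in $L_2((-1,1),M_r)$ and the integral over the half-open interval $(-\pi(n-\frac12),\pi(n+\frac12)]$. Let $\mathfrak H_2^s$ be the set of $H\in L_2((-1,1),M_r)$ such that $H(x)^*=H(-x)$ a.e. and, for every $b\in[0,1]$, the equation $f(x)+\int_0^bH(x-t)f(t)\,dt=0$ has only the trivial solution in $L_2((0,1),\mathbb C^r)$. *Kernels.* $G_2^+(M_n)$ is the set of measurable $K:[0,1]^2\to M_n$ such that $K(x,\cdot),K(\cdot,t)\in L_2((0,1),M_n)$ for all $x,t\in[0,1]$, these sections depend continuously in $L_2$ on $x$, resp. $t$, and $K(x,t)=0$ a.e. for $x<t$. For $H\in\mathfrak H_2^s$ let $R_H\in G_2^+(M_r)$ be the solution of the Krein equation $$R(x,t)+H(x-t)+\int_0^xR(x,s)H(s-t)\,ds=0,\qquad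 0\le t\le x\le 1,$$ and $\Theta(H):=iR_H(\cdot,0)\in L_2((0,1),M_r)$. *Dirac system.* Put $\vartheta:=\frac1i\begin{pmatrix}I&0\\0&-I\end{pmatrix}$ and $a:=\frac1{\sqrt2}(I,\,-I)$. For $q\in L_2((0,1),M_r)$ and $\lambda\in\mathbb C$ let $u_q(\cdot,\lambda)\in W_2^1((0,1),M_{2r})$ be the solution of $$\vartheta u'+\begin{pmatrix}0&q\\q^*&0\end{pmatrix}u=\lambda u,\qquad u(0,\lambda)=I_{2r},$$ and put $\varphi_q(\cdot,\lambda):=u_q(\cdot,\lambda)\vartheta a^*$. Let $K_q\in G_2^+(M_{2r})$ be the kernel with $$\varphi_q(x,\lambda)=\varphi_0(x,\lambda)+\int_0^xK_q(x,s)\varphi_0(s,\lambda)\,ds,\qquad x\in[0,1],\ \lambda\in\mathbb C,$$ and $\mathscr K_q$ the integral operator in $\mathbb H$ with kernel $K_q$. Finally let $\Phi_q(\lambda):\mathbb C^r\to\mathbb H$, $[\Phi_q(\lambda)c](x):=\varphi_q(x,\lambda)c$, and $$\mathscr U_{\mathfrak a,q}:=\sum_{j\in\mathbb Z}\Phi_q(\lambda_j)\,\alpha_j\,\Phi_q(\lambda_j)^*\quad\text{(strong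 convergence)}.$$ **Theorem.** Let $\mathfrak a$ satisfy $(A_1)$ and $(A_3)$, and set $q:=\Theta(H_\mu)$. Then all the objects involved exist (the limit $H_\mu$ exists and lies in $\mathfrak H_2^s$; $R_{H_\mu}$, $u_0$, $u_q$, $K_q$, the bounded operator $\mathscr K_q$ and the strong sum $\mathscr U_{\mathfrak a,0}$ exist), the operators $\mathscr I+\mathscr K_q$ and $\mathscr I+\mathscr K_q^*$ are boundedly invertible, and $$\mathscr U_{\mathfrak a,0}=(\mathscr I+\mathscr K_q)^{-1}(\mathscr I+\mathscr K_q^*)^{-1}.$$ -/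

import Mathlib

open MeasureTheory Filter Topology Set
open scoped Matrix Matrix.Norms.L2Operator ENNReal ComplexOrder

noncomputable section

namespace DiracInverse

/-- Square complex matrices, with the operator norm of `ℂⁿ → ℂⁿ`. -/
abbrev Mat (n : Type) : Type := Matrix n n ℂ

/-- The index set of the `2r` coordinates of `ℂʳ × ℂʳ`. -/
abbrev Two (r : ℕ) : Type := Fin r ⊕ Fin r

/-- Lebesgue measure on `(0,1)`. -/
abbrev vol01 : Measure ℝ := volume.restrict (Ioo (0 : ℝ) 1)

/-- Lebesgue measure on `(-1,1)`. -/
abbrev volSym : Measure ℝ := volume.restrict (Ioo (-1 : ℝ) 1)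

/-- `L₂((0,1), ℂʳ) × L₂((0,1), ℂʳ)`, realised as `L₂((0,1), ℂ²ʳ)`. -/
abbrev HSpace (r : ℕ) : Type := Lp (EuclideanSpace ℂ (Two r)) 2 vol01

/-- The potentials `L₂((0,1), M_r)`. -/
abbrev Potential (r : ℕ) : Type := Lp (Mat (Fin r)) 2 vol01

/-- `L₂((-1,1), M_r)`. -/
abbrev L2Sym (r : ℕ) : Type := Lp (Mat (Fin r)) 2 volSym

/-- The class in `L₂(μ)` of a square-integrable function (and `0` for other functions). -/
def l2Class {E : Type*} [NormedAddCommGroup E] (μ : Measure ℝ) (f : ℝ → E) : Lp E 2 μ :=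
  open Classical in if h : MemLp f 2 μ then h.toLp f else 0

/-- The action of a square matrix on a vector. -/
def act {n : Type} [Fintype n] [DecidableEq n] (A : Mat n) :
    EuclideanSpace ℂ n →L[ℂ] EuclideanSpace ℂ n :=
  Matrix.toEuclideanCLM (n := n) (𝕜 := ℂ) A

/-! ### Collections `((λ_j, α_j))` and the conditions on them -/

structure SpectralCollection (r : ℕ) where
  lam : ℤ → ℝ
  alpha : ℤ → Mat (Fin r)
  strictMono : StrictMono lam
  lam_zero : lam 0 ≤ 0
  lam_one : 0 < lam 1
  alpha_nonneg : ∀ j, (alpha j).PosSemidef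
  alpha_ne_zero : ∀ j, alpha j ≠ 0

/-- `Δ_n = (πn - π/2, πn + π/2]`. -/
def Delta (n : ℤ) : Set ℝ := Ioc (Real.pi * n - Real.pi / 2) (Real.pi * n + Real.pi / 2)

namespace SpectralCollection

variable {r : ℕ} (a : SpectralCollection r)

/-- Asymptotics of the collection. The inner sums are finite by the first clause. -/
structure A1 : Prop where
  count : ∃ C : ℕ, ∀ n : ℤ, {j : ℤ | a.lam j ∈ Delta n}.encard ≤ (C : ℕ∞)
  lam_asymp : Summable fun n : ℤ =>
    ∑ᶠ (j : ℤ) (_ : a.lam j ∈ Delta n), |a.lam j - Real.pi * n| ^ 2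
  alpha_asymp : Summable fun n : ℤ =>
    ‖(1 : Mat (Fin r)) - ∑ᶠ (j : ℤ) (_ : a.lam j ∈ Delta n), a.alpha j‖ ^ 2

/-- Completeness in `L₂((-1,1), ℂʳ)` of the functions `t ↦ e^{iλ_j t} d`, `d ∈ Ran α_j`. -/
def A3 : Prop :=
  (Submodule.span ℂ {g : Lp (EuclideanSpace ℂ (Fin r)) 2 volSym |
    ∃ (j : ℤ) (c : EuclideanSpace ℂ (Fin r)),
      g =ᵐ[volSym] fun t : ℝ =>
        Complex.exp (Complex.I * a.lam j * t) • act (a.alpha j) c}).topologicalClosure = ⊤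

/-- The function `x ↦ ∫ e^{2iλx} d(μ - μ₀)(λ)`, the integral being over
`(-π(n - 1/2), π(n + 1/2)]`, where `μ = ∑_j α_j δ_{λ_j}` and `μ₀ = ∑_m I δ_{πm}`. -/
def truncatedTransform (n : ℕ) (x : ℝ) : Mat (Fin r) :=
  (∑ᶠ (j : ℤ) (_ : a.lam j ∈ Ioc (-(Real.pi * (n - 1 / 2))) (Real.pi * (n + 1 / 2))),
      Complex.exp (2 * Complex.I * a.lam j * x) • a.alpha j)
  - ∑ᶠ (m : ℤ) (_ : Real.pi * m ∈ Ioc (-(Real.pi * (n - 1 / 2))) (Real.pi * (n + 1 / 2))),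
      Complex.exp (2 * Complex.I * (Real.pi * m : ℝ) * x) • (1 : Mat (Fin r))

/-- `H_μ`, the limit in `L₂((-1,1), M_r)` of the truncated transforms. -/
def Hmu : L2Sym r := limUnder atTop fun n : ℕ => l2Class volSym (a.truncatedTransform n)

end SpectralCollection

/-! ### Accelerants, kernels and the Krein equation -/

/-- `H` is an accelerant. -/
def IsAccelerant {r : ℕ} (H : L2Sym r) : Prop :=
  ∀ b ∈ Icc (0 : ℝ) 1, ∀ f : Lp (EuclideanSpace ℂ (Fin r)) 2 vol01,
    (∀ᵐ x ∂vol01, f x + ∫ t in (0 : ℝ)..b, act (H (x - t)) (f t) = 0) → f = 0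

/-- The accelerants with `H(x)* = H(-x)` a.e. -/
def symAccelerants (r : ℕ) : Set (L2Sym r) :=
  {H | IsAccelerant H ∧ ∀ᵐ x ∂volSym, (H x)ᴴ = H (-x)}

/-- The kernels `K` on `[0,1]²` all of whose sections are in `L₂(0,1)` and depend continuously
on the fixed variable. -/
structure IsG2 {n : Type} [Fintype n] [DecidableEq n] (K : ℝ → ℝ → Mat n) : Prop where
  measurable : AEStronglyMeasurable (fun p : ℝ × ℝ => K p.1 p.2)
    (volume.restrict (Icc (0 : ℝ) 1 ×ˢ Icc (0 : ℝ) 1))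
  memLp_left : ∀ x ∈ Icc (0 : ℝ) 1, MemLp (fun t => K x t) 2 vol01
  memLp_right : ∀ t ∈ Icc (0 : ℝ) 1, MemLp (fun x => K x t) 2 vol01
  continuous_left : ContinuousOn (fun x => l2Class vol01 fun t => K x t) (Icc 0 1)
  continuous_right : ContinuousOn (fun t => l2Class vol01 fun x => K x t) (Icc 0 1)

/-- `Ω⁺`. -/
def OmegaPlus : Set (ℝ × ℝ) := {p | 0 ≤ p.2 ∧ p.2 ≤ p.1 ∧ p.1 ≤ 1}

/-- `Ω⁻`. -/
def OmegaMinus : Set (ℝ × ℝ) := {p | 0 ≤ p.1 ∧ p.1 < p.2 ∧ p.2 ≤ 1}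

/-- The kernels in `G₂` that vanish a.e. above the diagonal. -/
structure IsG2Plus {n : Type} [Fintype n] [DecidableEq n] (K : ℝ → ℝ → Mat n) : Prop
    extends IsG2 K where
  lower : ∀ᵐ p : ℝ × ℝ ∂(volume.restrict OmegaMinus), K p.1 p.2 = 0

/-- `R`, extended by zero to `Ω⁻`, solves the Krein equation
`R(x,t) + H(x-t) + ∫₀ˣ R(x,s) H(s-t) ds = 0` in `Ω⁺`. -/
structure IsKreinSolution {r : ℕ} (H : L2Sym r) (R : ℝ → ℝ → Mat (Fin r)) : Prop where
  isG2Plus : IsG2Plus R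
  equation : ∀ᵐ p : ℝ × ℝ ∂(volume.restrict OmegaPlus),
    R p.1 p.2 + H (p.1 - p.2) + ∫ s in (0 : ℝ)..p.1, R p.1 s * H (s - p.2) = 0

/-- `R_H`. -/
def kreinSolution {r : ℕ} (H : L2Sym r) : ℝ → ℝ → Mat (Fin r) :=
  Classical.epsilon (IsKreinSolution H)

/-- `Θ(H) = i R_H(·, 0)`. -/
def Theta {r : ℕ} (H : L2Sym r) : Potential r :=
  l2Class vol01 fun x => Complex.I • kreinSolution H x 0

/-! ### The Dirac system -/

/-- `ϑ = (1/i) diag(I, -I)`. -/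
def theta (r : ℕ) : Mat (Two r) := (1 / Complex.I) • Matrix.fromBlocks 1 0 0 (-1)

/-- The matrix `(0, q; q*, 0)` at the point `x`. -/
def bigQ {r : ℕ} (q : Potential r) (x : ℝ) : Mat (Two r) :=
  Matrix.fromBlocks 0 (q x) (q x)ᴴ 0

/-- `u ∈ W₂¹(0,1)` with weak derivative `u'`, `u` being the continuous representative. -/
structure IsW12 {n : Type} [Fintype n] [DecidableEq n] (u u' : ℝ → Mat n) : Prop where
  memLp : MemLp u' 2 vol01
  eq_integral : ∀ x ∈ Icc (0 : ℝ) 1, u x = u 0 + ∫ t in (0 : ℝ)..x, u' t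

/-- `u ∈ W₂¹` solves `ϑ u' + (0, q; q*, 0) u = z u`, `u(0) = I`. -/
def IsCauchySolution {r : ℕ} (q : Potential r) (z : ℂ) (u : ℝ → Mat (Two r)) : Prop :=
  u 0 = 1 ∧ ∃ u' : ℝ → Mat (Two r), IsW12 u u' ∧
    ∀ᵐ x ∂vol01, theta r * u' x + bigQ q x * u x = z • u x

/-- `u_q(x, z)`. -/
def cauchyU {r : ℕ} (q : Potential r) (z : ℂ) : ℝ → Mat (Two r) :=
  Classical.epsilon (IsCauchySolution q z)

/-- `a = (1/√2) (I, -I)`. -/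
def bdryA (r : ℕ) : Matrix (Fin r) (Two r) ℂ :=
  (1 / (Real.sqrt 2 : ℂ)) • Matrix.fromCols 1 (-1)

/-- `φ_q(x, z) = u_q(x, z) ϑ a*`. -/
def phi {r : ℕ} (q : Potential r) (z : ℂ) (x : ℝ) : Matrix (Two r) (Fin r) ℂ :=
  cauchyU q z x * theta r * (bdryA r)ᴴ

/-- `K ∈ G₂⁺(M_{2r})` and `φ_q(x,z) = φ_0(x,z) + ∫₀ˣ K(x,s) φ_0(s,z) ds` for all `z` and `x`. -/
structure IsTransformationKernel {r : ℕ} (q : Potential r) (K : ℝ → ℝ → Mat (Two r)) : Prop where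
  isG2Plus : IsG2Plus K
  representation : ∀ z : ℂ, ∀ x ∈ Icc (0 : ℝ) 1,
    phi q z x = phi 0 z x + ∫ s in (0 : ℝ)..x, K x s * phi 0 z s

/-- `K_q`. -/
def transformationKernel {r : ℕ} (q : Potential r) : ℝ → ℝ → Mat (Two r) :=
  Classical.epsilon (IsTransformationKernel q)

/-- `T` is the integral operator with kernel `K`: `(T f)(x) = ∫₀¹ K(x,s) f(s) ds`. -/
def IsIntegralOperator {r : ℕ} (K : ℝ → ℝ → Mat (Two r)) (T : HSpace r →L[ℂ] HSpace r) : Prop :=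
  ∀ f : HSpace r, T f =ᵐ[vol01] fun x => ∫ s in (0 : ℝ)..1, act (K x s) (f s)

/-- The integral operator with kernel `K_q`. -/
def opK {r : ℕ} (q : Potential r) : HSpace r →L[ℂ] HSpace r :=
  Classical.epsilon (IsIntegralOperator (transformationKernel q))

/-! ### The operators `U_{a,q}` -/

/-- `Φ_q(z) : ℂʳ → ℍ`, `(Φ_q(z) c)(x) = φ_q(x, z) c`, written through the columns of `φ_q`. -/
def opPhi {r : ℕ} (q : Potential r) (z : ℂ) : EuclideanSpace ℂ (Fin r) →L[ℂ] HSpace r :=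
  ∑ k : Fin r, (EuclideanSpace.proj k : EuclideanSpace ℂ (Fin r) →L[ℂ] ℂ).smulRight
    (l2Class vol01 fun x => WithLp.toLp 2 fun i : Two r => phi q z x i k)

/-- The series `∑_j Φ_q(λ_j) α_j Φ_q(λ_j)*` converges strongly to `T`. -/
def IsSpectralSum {r : ℕ} (a : SpectralCollection r) (q : Potential r)
    (T : HSpace r →L[ℂ] HSpace r) : Prop :=
  ∀ f : HSpace r, HasSum
    (fun j : ℤ => opPhi q (a.lam j)
      (act (a.alpha j) (ContinuousLinearMap.adjoint (opPhi q (a.lam j)) f))) (T f)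

/-- `U_{a,q}`. -/
def opU {r : ℕ} (a : SpectralCollection r) (q : Potential r) : HSpace r →L[ℂ] HSpace r :=
  Classical.epsilon (IsSpectralSum a q)

end DiracInverse

end

open scoped InnerProductSpace

set_option linter.unusedSectionVars false

noncomputable section

namespace DiracInverse

/-! ### Classes of square-integrable functions -/

section L2Class

variable {E : Type*} [NormedAddCommGroup E] {μ : Measure ℝ} {f g : ℝ → E}

/-! Let T be the convolution with H = H_μ on L₂((0,1),ℂʳ), P_x the restriction to (0,x), and Ψ(λ)c =
e^{2iλx}c. Convolution with e^{2iλx}A is Ψ(λ)AΨ(λ)*, and Fourier expansion says that the sum of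
Ψ(πm)Ψ(πm)* over m is the identity. Hence the sum of Ψ(λ_j)α_jΨ(λ_j)* is 1 + T (`A1.hasSum_terms`),
as soon as H_μ converges; the convergence is a perturbed Parseval estimate (`trig_estimate`). The
sum is nonnegative, it is injective by completeness of the exponentials, and T is compact, so 1 + T
is coercive (`accOp_coercive`). All truncations 1 + P_x T P_x are then invertible, which makes H an
accelerant and solves the Krein equation.

The map f ↦ (f((1+s)/2), f((1-s)/2))/√2 is unitary and carries Ψ(λ) to Φ₀(λ) up to a factor of
modulus one. Therefore U_{a,0} is unitarily equivalent to 1 + T; write it as 1 + F. Since T has a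
difference kernel, the same folding on (0,x) carries P_x T P_x to the truncation of F at x. Folding
the resolvent rows with parameters y = x and y = 0 thus produces a lower triangular kernel K for
which (1+K)(1+F) is upper triangular. Then X = (1+K)(1+F)(1+K*) is upper triangular and
self-adjoint, so it commutes with every P_x; as X - 1 has no diagonal part, X = 1
(`triangular_factorization`, `glm_factorization`).

It remains to recognise K as the transformation kernel of q = iR(·,0). The same triangular argument
applied to L = 1 + R gives (1 + P_x T P_x)⁻¹P_x = L*P_xL (`inverse_truncOp_mul_cut`), in which x
enters only through P_x. From it the Krein system for P(x) = e^{2izx} + ∫₀ˣ R(x,s)e^{2izs} ds and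
its companion P_* can be read off: one equation directly (`kreinPs_eq`), the other by reflecting the
accelerant (`kreinP_eq`). Multiplied by e^{-izx} it is the Dirac system, so φ_q is an explicit
multiple of e^{-izx}(P, P_*), and folding the integrals gives φ_q = φ₀ + ∫Kφ₀
(`phi_eq_add_integral`). Finally, the functions Φ₀(πm)c are complete, so every transformation kernel
of q has the same integral operator (`integralOperator_unique`). -/

theorem l2Class_of_memLp (h : MemLp f 2 μ) : l2Class μ f = h.toLp f := by
  simp [l2Class, h]

theorem coeFn_l2Class (h : MemLp f 2 μ) : l2Class μ f =ᵐ[μ] f := by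
  rw [l2Class_of_memLp h]; exact h.coeFn_toLp

theorem l2Class_congr (h : f =ᵐ[μ] g) : l2Class μ f = l2Class μ g := by
  by_cases hf : MemLp f 2 μ
  · have hg : MemLp g 2 μ := hf.ae_eq h
    rw [l2Class_of_memLp hf, l2Class_of_memLp hg]
    exact (MemLp.toLp_eq_toLp_iff hf hg).2 h
  · have hg : ¬ MemLp g 2 μ := fun hg => hf (hg.ae_eq h.symm)
    simp [l2Class, hf, hg]

theorem l2Class_coe (F : Lp E 2 μ) : l2Class μ F = F := by
  rw [l2Class_of_memLp (Lp.memLp F)]; exact Lp.toLp_coeFn F (Lp.memLp F)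

theorem eq_l2Class {F : Lp E 2 μ} (h : F =ᵐ[μ] f) : F = l2Class μ f := by
  rw [← l2Class_coe F]; exact l2Class_congr h

theorem l2Class_add (hf : MemLp f 2 μ) (hg : MemLp g 2 μ) :
    l2Class μ (fun x => f x + g x) = l2Class μ f + l2Class μ g := by
  symm; apply eq_l2Class
  filter_upwards [Lp.coeFn_add (l2Class μ f) (l2Class μ g), coeFn_l2Class hf, coeFn_l2Class hg]
    with x h1 h2 h3
  rw [h1, Pi.add_apply, h2, h3]

theorem l2Class_sub (hf : MemLp f 2 μ) (hg : MemLp g 2 μ) :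
    l2Class μ (fun x => f x - g x) = l2Class μ f - l2Class μ g := by
  symm; apply eq_l2Class
  filter_upwards [Lp.coeFn_sub (l2Class μ f) (l2Class μ g), coeFn_l2Class hf, coeFn_l2Class hg]
    with x h1 h2 h3
  rw [h1, Pi.sub_apply, h2, h3]

theorem l2Class_neg (hf : MemLp f 2 μ) :
    l2Class μ (fun x => -f x) = -l2Class μ f := by
  symm; apply eq_l2Class
  filter_upwards [Lp.coeFn_neg (l2Class μ f), coeFn_l2Class hf] with x h1 h2
  rw [h1, Pi.neg_apply, h2]

theorem l2Class_smul [NormedSpace ℂ E] (c : ℂ) (hf : MemLp f 2 μ) :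
    l2Class μ (fun x => c • f x) = c • l2Class μ f := by
  symm; apply eq_l2Class
  filter_upwards [Lp.coeFn_smul c (l2Class μ f), coeFn_l2Class hf] with x h1 h2
  rw [h1, Pi.smul_apply, h2]

theorem l2Class_zero : l2Class μ (fun _ => (0 : E)) = 0 :=
  (eq_l2Class (Lp.coeFn_zero E 2 μ)).symm

theorem l2Class_sum {ι : Type*} (s : Finset ι) (F : ι → ℝ → E) (hF : ∀ i ∈ s, MemLp (F i) 2 μ) :
    l2Class μ (fun x => ∑ i ∈ s, F i x) = ∑ i ∈ s, l2Class μ (F i) := by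
  classical
  induction s using Finset.induction_on with
  | empty => simp [l2Class_zero]
  | insert a s ha ih =>
    simp only [Finset.sum_insert ha]
    rw [l2Class_add (hF a (Finset.mem_insert_self a s)), ih fun i hi =>
      hF i (Finset.mem_insert_of_mem hi)]
    exact memLp_finsetSum s fun i hi => hF i (Finset.mem_insert_of_mem hi)

theorem norm_l2Class (hf : MemLp f 2 μ) : ‖l2Class μ f‖ = (eLpNorm f 2 μ).toReal := by
  rw [l2Class_of_memLp hf, Lp.norm_toLp]

theorem norm_l2Class_le_mul {F : Type*} [NormedAddCommGroup F] {g : ℝ → F} {C : ℝ}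
    (hf : MemLp f 2 μ) (hg : MemLp g 2 μ) (h : ∀ᵐ x ∂μ, ‖f x‖ ≤ C * ‖g x‖) :
    ‖l2Class μ f‖ ≤ C * ‖l2Class μ g‖ := by
  apply Lp.norm_le_mul_norm_of_ae_le_mul
  filter_upwards [h, coeFn_l2Class hf, coeFn_l2Class hg] with x h1 h2 h3
  rw [h2, h3]; exact h1

theorem norm_l2Class_sq (hf : MemLp f 2 μ) : ‖l2Class μ f‖ ^ 2 = ∫ x, ‖f x‖ ^ 2 ∂μ := by
  rw [norm_l2Class hf, hf.eLpNorm_eq_integral_rpow_norm (by simp) (by simp),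
    ENNReal.toReal_ofReal (by positivity)]
  simp only [ENNReal.toReal_ofNat, Real.rpow_ofNat]
  rw [← Real.rpow_natCast, ← Real.rpow_mul (by positivity)]
  norm_num

theorem inner_l2Class {E : Type*} [NormedAddCommGroup E] [InnerProductSpace ℂ E]
    {f g : ℝ → E} (hf : MemLp f 2 μ) (hg : MemLp g 2 μ) :
    ⟪l2Class μ f, l2Class μ g⟫_ℂ = ∫ x, ⟪f x, g x⟫_ℂ ∂μ := by
  rw [L2.inner_def]
  apply integral_congr_ae
  filter_upwards [coeFn_l2Class hf, coeFn_l2Class hg] with x h1 h2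
  rw [h1, h2]

end L2Class

instance isProbabilityMeasure_vol01 : IsProbabilityMeasure vol01 := ⟨by simp⟩

theorem ae_vol01_mem : ∀ᵐ x ∂vol01, x ∈ Ioo (0 : ℝ) 1 := ae_restrict_mem measurableSet_Ioo

theorem norm_le_of_ae_bound_vol01 {E : Type*} [NormedAddCommGroup E] {F : Lp E 2 vol01} {C : ℝ}
    (hC : 0 ≤ C) (h : ∀ᵐ x ∂vol01, ‖F x‖ ≤ C) : ‖F‖ ≤ C := by
  have := Lp.norm_le_of_ae_bound (p := 2) hC h
  simpa [measureUnivNNReal] using this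

/-- `L₂((0,1), ℂⁿ)`. -/
abbrev L2v (n : Type) [Fintype n] : Type := Lp (EuclideanSpace ℂ n) 2 vol01

section MulOp

variable {n : Type} [Fintype n]

theorem memLp_smul_of_bounded {m : ℝ → ℂ} (hm : Measurable m) {C : ℝ}
    (hC : ∀ x ∈ Ioo (0 : ℝ) 1, ‖m x‖ ≤ C) {E : Type*} [NormedAddCommGroup E] [NormedSpace ℂ E]
    {f : ℝ → E} (hf : MemLp f 2 vol01) : MemLp (fun x => m x • f x) 2 vol01 := by
  refine MemLp.of_le_mul (c := C) hf (hm.aestronglyMeasurable.smul hf.1) ?_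
  filter_upwards [ae_vol01_mem] with x hx
  rw [norm_smul]
  exact mul_le_mul_of_nonneg_right (hC x hx) (norm_nonneg _)

open Classical in
/-- Multiplication by a bounded measurable function. -/
def mulOp (m : ℝ → ℂ) : L2v n →L[ℂ] L2v n :=
  if h : Measurable m ∧ ∃ C, ∀ x ∈ Ioo (0 : ℝ) 1, ‖m x‖ ≤ C then
    LinearMap.mkContinuousOfExistsBound
      { toFun := fun f => l2Class vol01 fun x => m x • f x
        map_add' := fun f g => by
          obtain ⟨hm, C, hC⟩ := h
          rw [← l2Class_add (memLp_smul_of_bounded hm hC (Lp.memLp f))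
            (memLp_smul_of_bounded hm hC (Lp.memLp g))]
          apply l2Class_congr
          filter_upwards [Lp.coeFn_add f g] with x hx
          rw [hx, Pi.add_apply, smul_add]
        map_smul' := fun c f => by
          obtain ⟨hm, C, hC⟩ := h
          rw [RingHom.id_apply, ← l2Class_smul c (memLp_smul_of_bounded hm hC (Lp.memLp f))]
          apply l2Class_congr
          filter_upwards [Lp.coeFn_smul c f] with x hx
          rw [hx, Pi.smul_apply, smul_comm] }
      (by
        obtain ⟨hm, C, hC⟩ := h
        refine ⟨C, fun f => ?_⟩
        have := norm_l2Class_le_mul (C := C) (memLp_smul_of_bounded hm hC (Lp.memLp f))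
          (Lp.memLp f) (by
            filter_upwards [ae_vol01_mem] with x hx
            rw [norm_smul]
            exact mul_le_mul_of_nonneg_right (hC x hx) (norm_nonneg _))
        rwa [l2Class_coe] at this)
  else 0

variable {m : ℝ → ℂ} {C : ℝ}

theorem mulOp_apply (hm : Measurable m) (hC : ∀ x ∈ Ioo (0 : ℝ) 1, ‖m x‖ ≤ C) (f : L2v n) :
    mulOp m f = l2Class vol01 fun x => m x • f x := by
  have h : Measurable m ∧ ∃ C, ∀ x ∈ Ioo (0 : ℝ) 1, ‖m x‖ ≤ C := ⟨hm, C, hC⟩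
  rw [mulOp, dif_pos h]
  rfl

theorem coeFn_mulOp (hm : Measurable m) (hC : ∀ x ∈ Ioo (0 : ℝ) 1, ‖m x‖ ≤ C) (f : L2v n) :
    mulOp m f =ᵐ[vol01] fun x => m x • f x := by
  rw [mulOp_apply hm hC]
  exact coeFn_l2Class (memLp_smul_of_bounded hm hC (Lp.memLp f))


/-- Multiplication by the indicator function of `(-∞, b]`. -/
def cut (b : ℝ) : L2v n →L[ℂ] L2v n := mulOp ((Iic b).indicator fun _ => 1)

theorem coeFn_cut (b : ℝ) (f : L2v n) : cut b f =ᵐ[vol01] (Iic b).indicator f := by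
  have h := coeFn_mulOp (C := 1) (m := (Iic b).indicator fun _ => (1 : ℂ))
    (measurable_const.indicator measurableSet_Iic) (fun x _ => by
      by_cases hx : x ≤ b <;> simp [indicator, hx]) f
  filter_upwards [h] with x hx
  rw [cut, hx]
  by_cases hx : x ≤ b <;> simp [indicator, hx]

theorem cut_eq (b : ℝ) (f : L2v n) : cut b f = l2Class vol01 ((Iic b).indicator f) :=
  eq_l2Class (coeFn_cut b f)

theorem cut_l2Class (b : ℝ) {f : ℝ → EuclideanSpace ℂ n} (hf : MemLp f 2 vol01) :
    cut b (l2Class vol01 f) = l2Class vol01 ((Iic b).indicator f) := by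
  apply eq_l2Class
  filter_upwards [coeFn_cut b (l2Class vol01 f), coeFn_l2Class hf] with x h1 h2
  rw [h1]
  by_cases hx : x ≤ b <;> simp [indicator, hx, h2]

theorem cut_apply_cut_apply (b c : ℝ) (f : L2v n) : cut b (cut c f) = cut (min b c) f := by
  apply Lp.ext
  filter_upwards [coeFn_cut b (cut c f), coeFn_cut c f, coeFn_cut (min b c) f] with x h1 h2 h3
  rw [h1, h3]
  by_cases hb : x ≤ b <;> by_cases hc : x ≤ c <;> simp [indicator, hb, hc, h2]

theorem cut_mul_cut (b c : ℝ) : (cut b * cut c : L2v n →L[ℂ] L2v n) = cut (min b c) := by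
  ext1 f; exact cut_apply_cut_apply b c f

theorem cut_mul_self (b : ℝ) : (cut b * cut b : L2v n →L[ℂ] L2v n) = cut b := by
  rw [cut_mul_cut, min_self]

theorem cut_of_one_le {b : ℝ} (hb : 1 ≤ b) : (cut b : L2v n →L[ℂ] L2v n) = 1 := by
  ext1 f
  apply Lp.ext
  filter_upwards [coeFn_cut b f, ae_vol01_mem] with x h1 h2
  rw [h1]; simp [indicator, h2.2.le.trans hb]

theorem cut_of_nonpos {b : ℝ} (hb : b ≤ 0) : (cut b : L2v n →L[ℂ] L2v n) = 0 := by
  ext1 f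
  apply Lp.ext
  filter_upwards [coeFn_cut b f, ae_vol01_mem, Lp.coeFn_zero (EuclideanSpace ℂ n) 2 vol01]
    with x h1 h2 h3
  rw [h1, zero_apply, h3]; simp [indicator, hb.trans_lt h2.1]

theorem inner_cut_left (b : ℝ) (f g : L2v n) : ⟪cut b f, g⟫_ℂ = ⟪f, cut b g⟫_ℂ := by
  rw [L2.inner_def, L2.inner_def]
  apply integral_congr_ae
  filter_upwards [coeFn_cut b f, coeFn_cut b g] with x h1 h2
  rw [h1, h2]
  by_cases hx : x ≤ b <;> simp [indicator, hx]

theorem adjoint_cut (b : ℝ) :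
    ContinuousLinearMap.adjoint (cut b : L2v n →L[ℂ] L2v n) = cut b := by
  symm
  rw [ContinuousLinearMap.eq_adjoint_iff]
  exact inner_cut_left b

theorem norm_cut_apply_le (b : ℝ) (f : L2v n) : ‖cut b f‖ ≤ ‖f‖ := by
  apply Lp.norm_le_norm_of_ae_le
  filter_upwards [coeFn_cut b f] with x h
  rw [h]; exact norm_indicator_le_norm_self _ _

/-- If `F` is bounded by `C`, then its restriction to `(b, c]` has norm at most `C √(c - b)`. -/
theorem norm_cut_sub_cut_le {b c C : ℝ} (hbc : b ≤ c) {F : L2v n} (hC : 0 ≤ C)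
    (h : ∀ᵐ x ∂vol01, ‖F x‖ ≤ C) : ‖cut c F - cut b F‖ ≤ C * √(c - b) := by
  have hae : (cut c F - cut b F : L2v n) =ᵐ[vol01] (Ioc b c).indicator F := by
    filter_upwards [Lp.coeFn_sub (cut c F) (cut b F), coeFn_cut b F, coeFn_cut c F]
      with x h1 h2 h3
    rw [h1, Pi.sub_apply, h2, h3]
    by_cases hb : x ≤ b
    · simp [indicator, hb, hb.trans hbc]
    · by_cases hc : x ≤ c <;> simp [indicator, hb, hc, lt_of_not_ge]
  rw [← Real.sqrt_sq hC, ← Real.sqrt_mul (sq_nonneg C)]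
  apply Real.le_sqrt_of_sq_le
  have hF : MemLp ((Ioc b c).indicator F) 2 vol01 := (Lp.memLp F).indicator measurableSet_Ioc
  rw [eq_l2Class hae, norm_l2Class_sq hF]
  calc ∫ x, ‖(Ioc b c).indicator F x‖ ^ 2 ∂vol01
      ≤ ∫ x, (Ioc b c).indicator (fun _ => C ^ 2) x ∂vol01 := by
        apply integral_mono_ae ((memLp_two_iff_integrable_sq_norm hF.1).1 hF)
          ((integrable_const _).indicator measurableSet_Ioc)
        filter_upwards [h] with x hx
        by_cases hm : x ∈ Ioc b c
        · simp only [indicator_of_mem hm]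
          exact pow_le_pow_left₀ (norm_nonneg _) hx 2
        · simp [hm]
    _ = C ^ 2 * (vol01.real (Ioc b c)) := by
        rw [integral_indicator_const _ measurableSet_Ioc, smul_eq_mul, mul_comm]
    _ ≤ C ^ 2 * (c - b) := by
        gcongr
        rw [measureReal_def, Measure.restrict_apply measurableSet_Ioc]
        refine (ENNReal.toReal_mono (by simp) (measure_mono inter_subset_left)).trans ?_
        rw [Real.volume_Ioc, ENNReal.toReal_ofReal (by linarith)]

end MulOp

/-! ### Row operators, triangular operators and factorization -/

section RowOp

variable {n : Type} [Fintype n]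

/-- `x ↦ (⟪κ_k(x), f⟫)_k`. -/
def rowFun (κ : ℝ → n → L2v n) (f : L2v n) (x : ℝ) : EuclideanSpace ℂ n :=
  WithLp.toLp 2 fun k => ⟪κ x k, f⟫_ℂ

@[simp] theorem rowFun_apply (κ : ℝ → n → L2v n) (f : L2v n) (x : ℝ) (k : n) :
    rowFun κ f x k = ⟪κ x k, f⟫_ℂ := rfl

theorem continuous_rowFun {κ : ℝ → n → L2v n} (hκ : Continuous κ) (f : L2v n) :
    Continuous (rowFun κ f) := by
  refine (PiLp.continuous_toLp 2 _).comp (continuous_pi fun k => ?_)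
  exact ((continuous_apply k).comp hκ).inner continuous_const

theorem norm_rowFun_le {κ : ℝ → n → L2v n} {C : ℝ} (hC : 0 ≤ C) {x : ℝ}
    (h : ∀ k, ‖κ x k‖ ≤ C) (f : L2v n) : ‖rowFun κ f x‖ ≤ √(Fintype.card n) * C * ‖f‖ := by
  rw [EuclideanSpace.norm_eq]
  apply Real.sqrt_le_iff.2
  refine ⟨by positivity, ?_⟩
  calc ∑ k, ‖rowFun κ f x k‖ ^ 2 ≤ ∑ _k : n, (C * ‖f‖) ^ 2 := by
        gcongr with k
        exact (norm_inner_le_norm _ _).trans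
          (mul_le_mul_of_nonneg_right (h k) (norm_nonneg f))
    _ = (√(Fintype.card n) * C * ‖f‖) ^ 2 := by
        rw [mul_assoc, mul_pow √_, Real.sq_sqrt (by positivity)]; simp

theorem exists_bound_of_continuous {κ : ℝ → n → L2v n} (hκ : Continuous κ) :
    ∃ C, 0 ≤ C ∧ ∀ x ∈ Icc (0 : ℝ) 1, ∀ k, ‖κ x k‖ ≤ C := by
  obtain ⟨C, hC⟩ := (isCompact_Icc (a := (0 : ℝ)) (b := 1)).exists_bound_of_continuousOn
    hκ.continuousOn
  exact ⟨C, (norm_nonneg _).trans (hC 0 (by simp)), fun x hx k => (norm_le_pi_norm _ k).trans (hC x hx)⟩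

theorem memLp_of_continuous {E : Type*} [NormedAddCommGroup E] {f : ℝ → E} (hf : Continuous f) :
    MemLp f 2 vol01 := by
  obtain ⟨C, hC⟩ := (isCompact_Icc (a := (0 : ℝ)) (b := 1)).exists_bound_of_continuousOn
    hf.continuousOn
  refine MemLp.of_bound hf.aestronglyMeasurable C ?_
  filter_upwards [ae_vol01_mem] with x hx using hC x (Ioo_subset_Icc_self hx)

open Classical in
/-- The integral operator whose kernel has the rows `κ`, that is `(T f)(x)_k = ⟪κ_k(x), f⟫`. -/
def rowOp (κ : ℝ → n → L2v n) : L2v n →L[ℂ] L2v n :=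
  if hκ : Continuous κ then
    LinearMap.mkContinuousOfExistsBound
      { toFun := fun f => l2Class vol01 (rowFun κ f)
        map_add' := fun f g => by
          rw [← l2Class_add (memLp_of_continuous (continuous_rowFun hκ f))
            (memLp_of_continuous (continuous_rowFun hκ g))]
          congr 1; ext x k; simp [inner_add_right]
        map_smul' := fun c f => by
          rw [RingHom.id_apply, ← l2Class_smul c (memLp_of_continuous (continuous_rowFun hκ f))]
          congr 1; ext x k; simp [inner_smul_right] }
      (by
        obtain ⟨C, h0, hC⟩ := exists_bound_of_continuous hκ
        refine ⟨√(Fintype.card n) * C, fun f => norm_le_of_ae_bound_vol01 (by positivity) ?_⟩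
        filter_upwards [ae_vol01_mem, coeFn_l2Class (memLp_of_continuous (continuous_rowFun hκ f))]
          with x hx h
        refine (congrArg norm h).trans_le ?_
        exact norm_rowFun_le h0 (hC x (Ioo_subset_Icc_self hx)) f)
  else 0

theorem rowOp_apply {κ : ℝ → n → L2v n} (hκ : Continuous κ) (f : L2v n) :
    rowOp κ f = l2Class vol01 (rowFun κ f) := by
  rw [rowOp, dif_pos hκ]; rfl

theorem coeFn_rowOp {κ : ℝ → n → L2v n} (hκ : Continuous κ) (f : L2v n) :
    rowOp κ f =ᵐ[vol01] rowFun κ f := by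
  rw [rowOp_apply hκ]; exact coeFn_l2Class (memLp_of_continuous (continuous_rowFun hκ f))

/-- `T` maps `L₂` boundedly into `L_∞`. -/
def RowBdd (T : L2v n →L[ℂ] L2v n) : Prop :=
  ∃ C, 0 ≤ C ∧ ∀ f, ∀ᵐ x ∂vol01, ‖T f x‖ ≤ C * ‖f‖

theorem rowBdd_rowOp {κ : ℝ → n → L2v n} (hκ : Continuous κ) : RowBdd (rowOp κ) := by
  obtain ⟨C, h0, hC⟩ := exists_bound_of_continuous hκ
  refine ⟨√(Fintype.card n) * C, by positivity, fun f => ?_⟩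
  filter_upwards [ae_vol01_mem, coeFn_rowOp hκ f] with x hx h
  rw [h]
  exact norm_rowFun_le h0 (hC x (Ioo_subset_Icc_self hx)) f

theorem norm_rowOp_le {κ : ℝ → n → L2v n} (hκ : Continuous κ) {C : ℝ} (h0 : 0 ≤ C)
    (hC : ∀ x ∈ Icc (0 : ℝ) 1, ∀ k, ‖κ x k‖ ≤ C) : ‖rowOp κ‖ ≤ √(Fintype.card n) * C := by
  refine ContinuousLinearMap.opNorm_le_bound _ (by positivity) fun f =>
    norm_le_of_ae_bound_vol01 (by positivity) ?_
  filter_upwards [ae_vol01_mem, coeFn_rowOp hκ f] with x hx h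
  rw [h]
  exact norm_rowFun_le h0 (hC x (Ioo_subset_Icc_self hx)) f

theorem RowBdd.add {S T : L2v n →L[ℂ] L2v n} (hS : RowBdd S) (hT : RowBdd T) : RowBdd (S + T) := by
  obtain ⟨C, hC0, hC⟩ := hS
  obtain ⟨D, hD0, hD⟩ := hT
  refine ⟨C + D, by positivity, fun f => ?_⟩
  filter_upwards [hC f, hD f, Lp.coeFn_add (S f) (T f)] with x h1 h2 h3
  rw [add_apply, h3, Pi.add_apply, add_mul]
  exact (norm_add_le _ _).trans (add_le_add h1 h2)

theorem RowBdd.mul_right {S : L2v n →L[ℂ] L2v n} (hS : RowBdd S) (T : L2v n →L[ℂ] L2v n) :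
    RowBdd (S * T) := by
  obtain ⟨C, hC0, hC⟩ := hS
  refine ⟨C * ‖T‖, by positivity, fun f => ?_⟩
  filter_upwards [hC (T f)] with x h1
  refine h1.trans ?_
  rw [mul_assoc]
  gcongr
  exact T.le_opNorm f

/-- A function bounded by C has norm at most C√(c-b) on a strip of length c - b. This smallness on
thin strips is what makes Volterra operators quasi-nilpotent, excludes a diagonal part, and gives
norm continuity of truncations. -/
theorem RowBdd.exists_norm_le {T : L2v n →L[ℂ] L2v n} (hT : RowBdd T) :
    ∃ C, 0 ≤ C ∧ ∀ b c, b ≤ c → ‖(cut c - cut b) * T‖ ≤ C * √(c - b) := by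
  obtain ⟨C, hC0, hC⟩ := hT
  refine ⟨C, hC0, fun b c hbc => ContinuousLinearMap.opNorm_le_bound _ (by positivity) fun f => ?_⟩
  have := norm_cut_sub_cut_le hbc (F := T f) (C := C * ‖f‖) (by positivity) (hC f)
  rw [mul_right_comm] at this
  exact this

/-- `(T f)(x)` depends only on the restriction of `f` to `(0, x)`. -/
def IsLower (T : L2v n →L[ℂ] L2v n) : Prop := ∀ b, cut b * T = cut b * T * cut b

theorem isLower_rowOp {κ : ℝ → n → L2v n} (hκ : Continuous κ)
    (h : ∀ x ∈ Ioo (0 : ℝ) 1, ∀ k, cut x (κ x k) = κ x k) : IsLower (rowOp κ) := by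
  intro b
  ext1 f
  apply Lp.ext
  change (cut b (rowOp κ f) : L2v n) =ᵐ[vol01] (cut b (rowOp κ (cut b f)) : L2v n)
  filter_upwards [ae_vol01_mem, coeFn_cut b (rowOp κ f), coeFn_cut b (rowOp κ (cut b f)),
    coeFn_rowOp hκ f, coeFn_rowOp hκ (cut b f)] with x hx h1 h2 h3 h4
  rw [h1, h2]
  by_cases hb : x ≤ b
  · simp only [indicator, mem_Iic, hb, if_true, h3, h4]
    ext k
    simp only [rowFun_apply]
    rw [← h x hx k, inner_cut_left, inner_cut_left, cut_apply_cut_apply, min_eq_left hb]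
  · simp [indicator, hb]

/-- A Volterra operator is quasi-nilpotent. -/
theorem isUnit_one_add_of_isLower {K : L2v n →L[ℂ] L2v n} (hK : IsLower K) (hb : RowBdd K) :
    IsUnit (1 + K) := by
  obtain ⟨C, hC0, hC⟩ := hb.exists_norm_le
  -- With N > C² strips of width 1/N, the restriction of `K` to each strip has norm at most C/√N <
  -- 1.
  obtain ⟨N, hN⟩ := exists_nat_gt (C ^ 2)
  have hN0 : (0 : ℝ) < N := (sq_nonneg C).trans_lt hN
  have key : ∀ i : ℕ, IsUnit (1 + cut (i / N) * K) := by
    intro i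
    induction i with
    | zero => simp [cut_of_nonpos]
    | succ i ih =>
      have hle : (i : ℝ) / N ≤ (i + 1 : ℕ) / N := by gcongr; simp
      have hsmall : ‖(cut ((i + 1 : ℕ) / N) - cut (i / N)) * K‖ < 1 := by
        refine (hC _ _ hle).trans_lt ?_
        rw [← Real.sqrt_sq hC0, ← Real.sqrt_mul (sq_nonneg C), Real.sqrt_lt' one_pos]
        have : ((i + 1 : ℕ) : ℝ) / N - i / N = 1 / N := by push_cast; ring
        rw [this, mul_one_div, one_pow, div_lt_one hN0]
        exact hN
      have hu : IsUnit (1 + (cut ((i + 1 : ℕ) / N) - cut (i / N)) * K) := by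
        have := isUnit_one_sub_of_norm_lt_one (x := -((cut ((i + 1 : ℕ) / N) - cut (i / N)) * K))
          (by rwa [norm_neg])
        rwa [sub_neg_eq_add] at this
      have hprod : 1 + cut ((i + 1 : ℕ) / N) * K =
          (1 + cut (i / N) * K) * (1 + (cut ((i + 1 : ℕ) / N) - cut (i / N)) * K) := by
        -- The cross term of the product vanishes: before i/N the operator sees only the input
        -- before i/N, whereas the second factor contributes only after it. Thus 1 + PK is a product
        -- of finitely many perturbations of 1 of norm less than 1.
        have h0 : cut (i / N) * K * (cut ((i + 1 : ℕ) / N) - cut (i / N)) = 0 := by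
          rw [hK, mul_assoc, mul_sub, cut_mul_cut, cut_mul_self, min_eq_left hle, sub_self,
            mul_zero]
        have : (1 + cut (i / N) * K) * (1 + (cut ((i + 1 : ℕ) / N) - cut (i / N)) * K) =
          1 + cut ((i + 1 : ℕ) / N) * K
            + (cut (i / N) * K * (cut ((i + 1 : ℕ) / N) - cut (i / N))) * K := by noncomm_ring
        rw [this, h0, zero_mul, add_zero]
      rw [hprod]
      exact ih.mul hu
  have := key N
  rwa [div_self hN0.ne', cut_of_one_le le_rfl, one_mul] at this

theorem norm_sq_cut_sub {b c : ℝ} (hbc : b ≤ c) (f : L2v n) :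
    ‖cut c f - cut b f‖ ^ 2 = ‖cut c f‖ ^ 2 - ‖cut b f‖ ^ 2 := by
  have h : ⟪cut c f, cut b f⟫_ℂ = ⟪cut b f, cut b f⟫_ℂ := by
    rw [inner_cut_left, inner_cut_left, cut_apply_cut_apply, cut_apply_cut_apply, min_self,
      min_eq_right hbc]
  rw [@norm_sub_sq ℂ, h, inner_self_eq_norm_sq]
  ring

/-- An operator that commutes with all the cuts and is a sum of an operator mapping `L₂` to
`L_∞` and the adjoint of one vanishes. -/
theorem eq_zero_of_commute_cut {Z S T : L2v n →L[ℂ] L2v n} (hZ : ∀ b, cut b * Z = Z * cut b)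
    (hS : RowBdd S) (hT : RowBdd T) (h : Z = S + ContinuousLinearMap.adjoint T) : Z = 0 := by
  obtain ⟨C, hC0, hC⟩ := hS.exists_norm_le
  obtain ⟨D, hD0, hD⟩ := hT.exists_norm_le
  have hblock : ∀ b c, b ≤ c → ∀ f, ‖cut c (Z f) - cut b (Z f)‖ ^ 2 ≤
      (C + D) ^ 2 * (c - b) * (‖cut c f‖ ^ 2 - ‖cut b f‖ ^ 2) := by
    intro b c hbc f
    set Q : L2v n →L[ℂ] L2v n := cut c - cut b with hQ
    have hQQ : Q * Q = Q := by
      simp only [hQ, mul_sub, sub_mul, cut_mul_cut, min_self, min_eq_left hbc, min_eq_right hbc]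
      abel
    have hQa : ContinuousLinearMap.adjoint Q = Q := by simp [hQ, adjoint_cut]
    have hQZ : Q * Z = Q * Z * Q := by
      have : Q * Z = Z * Q := by simp only [hQ, mul_sub, sub_mul, hZ]
      rw [this, mul_assoc, hQQ]
    have hn : ‖Q * Z * Q‖ ≤ (C + D) * √(c - b) := by
      have hQ1 : ‖Q‖ ≤ 1 := by
        refine ContinuousLinearMap.opNorm_le_bound _ zero_le_one fun g => ?_
        have := norm_sq_cut_sub hbc g
        have h2 : ‖Q g‖ ^ 2 ≤ ‖g‖ ^ 2 := by
          change ‖cut c g - cut b g‖ ^ 2 ≤ _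
          rw [this]
          have := pow_le_pow_left₀ (norm_nonneg _) (norm_cut_apply_le c g) 2
          nlinarith [sq_nonneg ‖cut b g‖]
        rw [one_mul]
        exact (pow_le_pow_iff_left₀ (norm_nonneg _) (norm_nonneg _) two_ne_zero).1 h2
      -- Both summands are small on the strip: `Q` cuts the range of `S`, and after taking the
      -- adjoint it cuts the range of `T`.
      have e : Q * Z * Q = Q * S * Q + ContinuousLinearMap.adjoint (Q * T * Q) := by
        have : ContinuousLinearMap.adjoint (Q * T * Q) =
            Q * ContinuousLinearMap.adjoint T * Q := by
          change ContinuousLinearMap.adjoint ((Q.comp T).comp Q) = _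
          rw [ContinuousLinearMap.adjoint_comp, ContinuousLinearMap.adjoint_comp, hQa]
          rfl
        rw [this, h, mul_add, add_mul]
      rw [e, add_mul]
      refine (norm_add_le _ _).trans (add_le_add ?_ ?_)
      · refine (norm_mul_le _ _).trans ?_
        have := hC b c hbc
        nlinarith [norm_nonneg (Q * S), norm_nonneg Q]
      · rw [LinearIsometryEquiv.norm_map]
        refine (norm_mul_le _ _).trans ?_
        have := hD b c hbc
        nlinarith [norm_nonneg (Q * T), norm_nonneg Q]
    have h1 : cut c (Z f) - cut b (Z f) = (Q * Z * Q) (cut c f - cut b f) := by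
      have e1 : cut c (Z f) - cut b (Z f) = (Q * Z) f := rfl
      have e2 : (Q * Z * Q) (cut c f - cut b f) = (Q * Z * Q * Q) f := rfl
      rw [e1, e2, mul_assoc _ Q Q, hQQ, ← hQZ]
    rw [h1, ← norm_sq_cut_sub hbc]
    calc ‖(Q * Z * Q) (cut c f - cut b f)‖ ^ 2
        ≤ ((C + D) * √(c - b) * ‖cut c f - cut b f‖) ^ 2 := by
          gcongr
          exact ContinuousLinearMap.le_of_opNorm_le _ hn _
      _ = _ := by rw [mul_pow, mul_pow, Real.sq_sqrt (by linarith)]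
  ext1 f
  rw [zero_apply, ← norm_eq_zero, ← sq_eq_zero_iff]
  -- `Z` maps each strip into itself, so the squared norms over N strips of width 1/N add up, and
  -- every strip contributes a factor (C+D)²/N.
  have hlim : ∀ N : ℕ, 0 < N → ‖Z f‖ ^ 2 ≤ (C + D) ^ 2 * ‖f‖ ^ 2 / N := by
    intro N hN
    have hN0 : (0 : ℝ) < N := by exact_mod_cast hN
    have tele : ∀ g : L2v n, ∑ i ∈ Finset.range N,
        (‖cut ((i + 1 : ℕ) / N : ℝ) g‖ ^ 2 - ‖cut ((i : ℕ) / N : ℝ) g‖ ^ 2) = ‖g‖ ^ 2 := by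
      intro g
      rw [Finset.sum_range_sub (fun i : ℕ => ‖cut ((i : ℕ) / N : ℝ) g‖ ^ 2),
        div_self hN0.ne', cut_of_one_le le_rfl]
      simp [cut_of_nonpos]
    rw [← tele (Z f), mul_div_right_comm, ← tele f, Finset.mul_sum]
    refine Finset.sum_le_sum fun i _ => ?_
    have hle : (i : ℝ) / N ≤ (i + 1 : ℕ) / N := by gcongr; simp
    rw [← norm_sq_cut_sub hle]
    refine (hblock _ _ hle f).trans_eq ?_
    have : ((i + 1 : ℕ) : ℝ) / N - i / N = 1 / N := by push_cast; ring
    rw [this, mul_one_div]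
  have ht : Tendsto (fun N : ℕ => (C + D) ^ 2 * ‖f‖ ^ 2 / (N : ℝ)) atTop (𝓝 0) :=
    tendsto_const_div_atTop_nhds_zero_nat _
  refine le_antisymm (ge_of_tendsto ht ?_) (sq_nonneg _)
  filter_upwards [eventually_gt_atTop 0] with N hN using hlim N hN

theorem adjoint_mul_eq (A B : L2v n →L[ℂ] L2v n) : ContinuousLinearMap.adjoint (A * B) =
    ContinuousLinearMap.adjoint B * ContinuousLinearMap.adjoint A :=
  ContinuousLinearMap.adjoint_comp A B

theorem adjoint_one_eq : ContinuousLinearMap.adjoint (1 : L2v n →L[ℂ] L2v n) = 1 :=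
  ContinuousLinearMap.adjoint_id

/-- Uniqueness of the triangular factorization. -/
theorem triangular_factorization {K F : L2v n →L[ℂ] L2v n} (hK : IsLower K) (hKb : RowBdd K)
    (hF : ContinuousLinearMap.adjoint F = F) (hFb : RowBdd F)
    (hup : ∀ b, (1 + K) * (1 + F) * cut b = cut b * ((1 + K) * (1 + F)) * cut b) :
    (1 + K) * (1 + F) * (1 + ContinuousLinearMap.adjoint K) = 1 := by
  set K' := ContinuousLinearMap.adjoint K with hK'
  have hK'up : ∀ b, K' * cut b = cut b * K' * cut b := by
    intro b
    have := congrArg ContinuousLinearMap.adjoint (hK b)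
    rwa [adjoint_mul_eq, adjoint_mul_eq, adjoint_mul_eq, adjoint_cut, ← mul_assoc] at this
  set X := (1 + K) * (1 + F) * (1 + K') with hX
  have hXa : ContinuousLinearMap.adjoint X = X := by
    simp only [hX, adjoint_mul_eq, map_add, adjoint_one_eq, hF, hK', ContinuousLinearMap.adjoint_adjoint, mul_assoc]
  clear_value X
  -- Both (1+K)(1+F) and 1+K* leave the range of `cut b` invariant, hence so does their product.
  have hXup : ∀ b, X * cut b = cut b * X * cut b := by
    intro b
    have h1 : (1 + K') * cut b = cut b * ((1 + K') * cut b) := by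
      rw [add_mul, mul_add, one_mul, cut_mul_self, ← mul_assoc, ← hK'up]
    calc X * cut b = (1 + K) * (1 + F) * cut b * ((1 + K') * cut b) := by
          rw [mul_assoc _ (cut b), ← h1, hX, mul_assoc]
      _ = cut b * ((1 + K) * (1 + F) * cut b * ((1 + K') * cut b)) := by
          rw [hup b]; simp only [← mul_assoc, cut_mul_self]
      _ = cut b * X * cut b := by
          rw [hX, mul_assoc _ (cut b), ← h1]; simp only [mul_assoc]
  -- The adjoint of an upper triangular operator is lower triangular, and `X` is its own adjoint.
  have hcomm : ∀ b, cut b * (X - 1) = (X - 1) * cut b := by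
    intro b
    have := congrArg ContinuousLinearMap.adjoint (hXup b)
    rw [adjoint_mul_eq, adjoint_mul_eq, adjoint_mul_eq, adjoint_cut, hXa, ← mul_assoc, ← hXup] at this
    rw [mul_sub, sub_mul, this, mul_one, one_mul]
  -- Here X - 1 = (K(1+F)(1+K*) + F(1+K*)) + K*: the bracket maps into L∞, since its left factors
  -- do, and the rest is the adjoint of such an operator.
  have hz := eq_zero_of_commute_cut hcomm
    (S := K * (1 + F) * (1 + K') + F * (1 + K')) (T := K)
    (((hKb.mul_right _).mul_right _).add (hFb.mul_right _)) hKb (by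
      rw [hX, ← hK']; noncomm_ring)
  exact sub_eq_zero.1 hz

end RowOp

/-! ### Matrix-valued functions and their rows -/

section Rows

variable {n : Type} [Fintype n] [DecidableEq n]

@[simp] theorem act_apply (A : Mat n) (v : EuclideanSpace ℂ n) (k : n) :
    act A v k = ∑ i, A k i * v i := by
  rw [act, Matrix.ofLp_toEuclideanCLM]; rfl

theorem norm_act_le (A : Mat n) (v : EuclideanSpace ℂ n) : ‖act A v‖ ≤ ‖A‖ * ‖v‖ :=
  (act A).le_opNorm v

/-- The complex conjugate of the `k`-th row of a matrix. -/
def conjRow (A : Mat n) (k : n) : EuclideanSpace ℂ n := WithLp.toLp 2 fun i => star (A k i)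

@[simp] theorem conjRow_apply (A : Mat n) (k i : n) : conjRow A k i = star (A k i) := rfl

theorem conjRow_eq_act (A : Mat n) (k : n) :
    conjRow A k = act Aᴴ (EuclideanSpace.single k 1) := by
  ext i; simp

theorem norm_conjRow_le (A : Mat n) (k : n) : ‖conjRow A k‖ ≤ ‖A‖ := by
  rw [conjRow_eq_act]
  refine (norm_act_le _ _).trans ?_
  rw [Matrix.l2_opNorm_conjTranspose]; simp

theorem norm_entry_le (A : Mat n) (k i : n) : ‖A k i‖ ≤ ‖A‖ := by
  have := (PiLp.norm_apply_le (conjRow A k) i).trans (norm_conjRow_le A k)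
  simpa using this

theorem norm_le_sum_entries (A : Mat n) : ‖A‖ ≤ ∑ k, ∑ i, ‖A k i‖ := by
  have h : ‖act A‖ ≤ ∑ k, ∑ i, ‖A k i‖ := by
    refine ContinuousLinearMap.opNorm_le_bound _ (by positivity) fun v => ?_
    calc ‖act A v‖ ≤ ∑ k, ‖act A v k‖ := by
          rw [EuclideanSpace.norm_eq]
          apply Real.sqrt_le_iff.2
          exact ⟨by positivity, Finset.sum_sq_le_sq_sum_of_nonneg fun _ _ => norm_nonneg _⟩
      _ ≤ ∑ k, ∑ i, ‖A k i‖ * ‖v‖ := by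
          gcongr with k
          rw [act_apply]
          refine (norm_sum_le _ _).trans ?_
          gcongr with i
          rw [norm_mul]
          gcongr
          exact PiLp.norm_apply_le v i
      _ = _ := by simp only [Finset.sum_mul]
  exact h

theorem continuous_conjRow (k : n) : Continuous fun A : Mat n => conjRow A k :=
  (PiLp.continuous_toLp 2 _).comp
    (continuous_pi fun i => continuous_star.comp (continuous_apply_apply k i))

theorem conjRow_sub (A B : Mat n) (k : n) : conjRow (A - B) k = conjRow A k - conjRow B k := by
  ext i; simp

theorem conjRow_injective {A B : Mat n} (h : ∀ k, conjRow A k = conjRow B k) : A = B := by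
  ext k i
  have := congrArg (fun v : EuclideanSpace ℂ n => v i) (h k)
  exact star_injective this

/-- A matrix entry as a continuous linear functional. -/
def entryCLM (k i : n) : Mat n →L[ℂ] ℂ :=
  ⟨Matrix.entryLinearMap ℂ ℂ k i, continuous_apply_apply k i⟩

variable {μ : Measure ℝ} {M N : ℝ → Mat n}

theorem memLp_conjRow (h : MemLp M 2 μ) (k : n) : MemLp (fun t => conjRow (M t) k) 2 μ :=
  h.of_le ((continuous_conjRow k).comp_aestronglyMeasurable h.1)
    (Eventually.of_forall fun t => norm_conjRow_le (M t) k)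

theorem memLp_entry (h : MemLp M 2 μ) (k i : n) : MemLp (fun t => M t k i) 2 μ :=
  h.of_le ((continuous_apply_apply k i).comp_aestronglyMeasurable h.1)
    (Eventually.of_forall fun t => norm_entry_le (M t) k i)

theorem memLp_of_entries (h : ∀ k i, MemLp (fun t => M t k i) 2 μ) : MemLp M 2 μ := by
  have : M = fun t => ∑ k, ∑ i, (M t k i) • Matrix.single k i (1 : ℂ) := by
    funext t
    conv_lhs => rw [Matrix.matrix_eq_sum_single (M t)]
    simp [Matrix.smul_single]
  rw [this]
  refine memLp_finsetSum _ fun k _ => memLp_finsetSum _ fun i _ => ?_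
  refine MemLp.of_le_mul (c := ‖(Matrix.single k i (1 : ℂ) : Mat n)‖) (h k i)
    ((h k i).1.smul aestronglyMeasurable_const) (Eventually.of_forall fun t => ?_)
  rw [norm_smul, mul_comm]

theorem memLp_conjTranspose (h : MemLp M 2 μ) : MemLp (fun t => (M t)ᴴ) 2 μ :=
  h.of_le (continuous_id.matrix_conjTranspose.comp_aestronglyMeasurable h.1)
    (Eventually.of_forall fun t => (Matrix.l2_opNorm_conjTranspose (M t)).le)

theorem integrable_mul_of_memLp (hM : MemLp M 2 μ) (hN : MemLp N 2 μ) :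
    Integrable (fun t => M t * N t) μ := hM.integrable_mul hN

theorem integral_entry {F : ℝ → Mat n} (hF : Integrable F μ) (k i : n) :
    (∫ t, F t ∂μ) k i = ∫ t, F t k i ∂μ :=
  ((entryCLM k i).integral_comp_comm hF).symm

theorem integral_act_apply {f : ℝ → EuclideanSpace ℂ n}
    (hF : Integrable f μ) (k : n) : (∫ t, f t ∂μ) k = ∫ t, f t k ∂μ :=
  ((EuclideanSpace.proj k : EuclideanSpace ℂ n →L[ℂ] ℂ).integral_comp_comm hF).symm

theorem continuous_act : Continuous fun p : Mat n × EuclideanSpace ℂ n => act p.1 p.2 := by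
    have e : (fun p : Mat n × EuclideanSpace ℂ n => act p.1 p.2) =
        fun p => WithLp.toLp 2 fun k => ∑ i, p.1 k i * p.2 i := by
      funext p; ext k; simp
    rw [e]
    refine (PiLp.continuous_toLp 2 _).comp (continuous_pi fun k => continuous_finsetSum _ fun i _ =>
      Continuous.mul (f := fun p : Mat n × EuclideanSpace ℂ n => p.1 k i) ?_ ?_)
    · exact (continuous_apply_apply k i).comp continuous_fst
    · exact (EuclideanSpace.proj i : EuclideanSpace ℂ n →L[ℂ] ℂ).continuous.comp continuous_snd

theorem integrable_act (hM : MemLp M 2 μ) {f : ℝ → EuclideanSpace ℂ n} (hf : MemLp f 2 μ) :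
    Integrable (fun t => act (M t) (f t)) μ := by
  have hi : Integrable (fun t => ‖M t‖ * ‖f t‖) μ := hM.norm.integrable_mul hf.norm
  refine Integrable.mono' hi ?_ (Eventually.of_forall fun t => norm_act_le _ _)
  have := continuous_act.comp_aestronglyMeasurable (hM.1.prodMk hf.1)
  exact this

/-- The class of the conjugate of the `k`-th row of a matrix function. -/
def rowClass (M : ℝ → Mat n) (k : n) : L2v n := l2Class vol01 fun t => conjRow (M t) k

theorem rowClass_congr (h : M =ᵐ[vol01] N) (k : n) : rowClass M k = rowClass N k := by
  apply l2Class_congr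
  filter_upwards [h] with t ht
  rw [ht]

theorem coeFn_rowClass (h : MemLp M 2 vol01) (k : n) :
    rowClass M k =ᵐ[vol01] fun t => conjRow (M t) k := coeFn_l2Class (memLp_conjRow h k)

theorem norm_rowClass_le (h : MemLp M 2 vol01) (k : n) : ‖rowClass M k‖ ≤ ‖l2Class vol01 M‖ := by
  have := norm_l2Class_le_mul (C := 1) (memLp_conjRow h k) h
    (Eventually.of_forall fun t => by rw [one_mul]; exact norm_conjRow_le _ _)
  rwa [one_mul] at this

theorem rowClass_sub (hM : MemLp M 2 vol01) (hN : MemLp N 2 vol01) (k : n) :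
    rowClass (fun t => M t - N t) k = rowClass M k - rowClass N k := by
  rw [rowClass, rowClass, rowClass, ← l2Class_sub (memLp_conjRow hM k) (memLp_conjRow hN k)]
  simp only [conjRow_sub]

theorem ae_eq_of_rowClass_eq (hM : MemLp M 2 vol01) (hN : MemLp N 2 vol01)
    (h : ∀ k, rowClass M k = rowClass N k) : M =ᵐ[vol01] N := by
  have : ∀ k, ∀ᵐ t ∂vol01, conjRow (M t) k = conjRow (N t) k := by
    intro k
    filter_upwards [coeFn_rowClass hM k, coeFn_rowClass hN k] with t h1 h2
    rw [← h1, ← h2, h k]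
  filter_upwards [ae_all_iff.2 this] with t ht using conjRow_injective ht

theorem inner_conjRow (A : Mat n) (k : n) (v : EuclideanSpace ℂ n) :
    ⟪conjRow A k, v⟫_ℂ = act A v k := by
  rw [act_apply, PiLp.inner_apply]
  simp [mul_comm]

theorem inner_rowClass_left (hM : MemLp M 2 vol01) (k : n) (f : L2v n) :
    ⟪rowClass M k, f⟫_ℂ = (∫ t, act (M t) (f t) ∂vol01) k := by
  rw [integral_act_apply (integrable_act hM (Lp.memLp f)), L2.inner_def]
  apply integral_congr_ae
  filter_upwards [coeFn_rowClass hM k] with t ht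
  rw [ht, inner_conjRow]

theorem inner_rowClass (hM : MemLp M 2 vol01) (hN : MemLp N 2 vol01) (k i : n) :
    ⟪rowClass M k, rowClass N i⟫_ℂ = (∫ t, M t * (N t)ᴴ ∂vol01) k i := by
  rw [integral_entry (integrable_mul_of_memLp hM (memLp_conjTranspose hN)), rowClass, rowClass,
    inner_l2Class (memLp_conjRow hM k) (memLp_conjRow hN i)]
  apply integral_congr_ae
  filter_upwards with t
  rw [inner_conjRow, act_apply, Matrix.mul_apply]
  rfl

theorem cut_rowClass (hM : MemLp M 2 vol01) (b : ℝ) (k : n) :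
    cut b (rowClass M k) = rowClass ((Iic b).indicator M) k := by
  rw [rowClass, cut_l2Class b (memLp_conjRow hM k), rowClass]
  congr 1
  ext t i
  by_cases h : t ≤ b <;> simp [indicator, h]

theorem continuous_rowClass_of_continuous {X : Type*} [TopologicalSpace X] {K : X → ℝ → Mat n}
    (hK : ∀ x, MemLp (K x) 2 vol01) (h : Continuous fun x => l2Class vol01 (K x)) :
    Continuous fun x => rowClass (K x) := by
  refine continuous_pi fun k => ?_
  rw [continuous_iff_continuousAt]
  intro x
  have h0 := (tendsto_iff_norm_sub_tendsto_zero.1 (h.tendsto x))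
  refine tendsto_iff_norm_sub_tendsto_zero.2 (squeeze_zero (fun _ => norm_nonneg _) (fun y => ?_) h0)
  rw [← rowClass_sub (hK y) (hK x), ← l2Class_sub (hK y) (hK x)]
  exact norm_rowClass_le ((hK y).sub (hK x)) k

theorem integral_vol01_eq {E : Type*} [NormedAddCommGroup E] [NormedSpace ℝ E] (f : ℝ → E) :
    ∫ t, f t ∂vol01 = ∫ t in (0 : ℝ)..1, f t := by
  rw [intervalIntegral.integral_of_le zero_le_one, integral_Ioc_eq_integral_Ioo]

theorem integral_vol01_indicator {E : Type*} [NormedAddCommGroup E] [NormedSpace ℝ E] (f : ℝ → E)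
    {x : ℝ} (hx : x ∈ Icc (0 : ℝ) 1) :
    ∫ t, (Iic x).indicator f t ∂vol01 = ∫ t in (0 : ℝ)..x, f t := by
  rw [integral_indicator measurableSet_Iic, Measure.restrict_restrict measurableSet_Iic,
    intervalIntegral.integral_of_le hx.1]
  apply setIntegral_congr_set
  have h : (Iic x ∩ Ioo (0 : ℝ) 1 : Set ℝ) =ᵐ[volume] (Iic x ∩ Ioc (0 : ℝ) 1 : Set ℝ) :=
    (ae_eq_refl _).inter Ioo_ae_eq_Ioc
  have e : Iic x ∩ Ioc (0 : ℝ) 1 = Ioc 0 x := by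
    ext t
    exact ⟨fun ht => ⟨ht.2.1, ht.1⟩, fun ht => ⟨ht.2, ht.1, ht.2.trans hx.2⟩⟩
  rwa [e] at h

end Rows

/-! ### Affine changes of variables and translations in `L₂` -/

section Affine

variable {E : Type*} [NormedAddCommGroup E]

theorem quasiMeasurePreserving_affine (a : ℝ) {b : ℝ} (hb : b ≠ 0) :
    Measure.QuasiMeasurePreserving (fun s : ℝ => a + b * s) volume volume := by
  refine (measurePreserving_add_left volume a).quasiMeasurePreserving.comp
    (g := fun x => a + x) (f := fun x => b * x) ⟨by fun_prop, ?_⟩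
  rw [Real.map_volume_mul_left hb]
  exact Measure.smul_absolutelyContinuous

theorem memLp_comp_affine {f : ℝ → E} (hf : MemLp f 2 volume) (a : ℝ) {b : ℝ} (hb : b ≠ 0) :
    MemLp (fun s => f (a + b * s)) 2 volume := by
  have h1 : MemLp (fun x => f (a + x)) 2 volume :=
    hf.comp_measurePreserving (measurePreserving_add_left volume a)
  have h2 : MemLp (fun x => f (a + x)) 2 (Measure.map (fun x => b * x) volume) := by
    rw [Real.map_volume_mul_left hb]
    exact h1.smul_measure ENNReal.ofReal_ne_top
  exact (memLp_map_measure_iff h2.1 (by fun_prop)).1 h2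

/-- After the dilation f(b·), the section is a translate by ax/b, and translations act continuously
on L₂(ℝ); restriction to (0,1) is bounded. -/
theorem continuous_l2Class_affine {f : ℝ → E} [NormedSpace ℂ E] (hf : MemLp f 2 volume)
    (a : ℝ) {b : ℝ} (hb : b ≠ 0) :
    Continuous fun x : ℝ => l2Class vol01 fun s => f (a * x + b * s) := by
  have : Fact ((2 : ℝ≥0∞) ≠ ∞) := ⟨by simp⟩
  have hg : MemLp (fun s => f (0 + b * s)) 2 volume := memLp_comp_affine hf 0 hb
  have hc : Continuous fun y : ℝ => (DomAddAct.mk y +ᵥ hg.toLp _ : Lp E 2 volume) :=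
    continuous_vadd.comp ((DomAddAct.continuous_mk).prodMk continuous_const)
  have hc2 := (LpToLpRestrictCLM ℝ E ℂ volume 2 (Ioo (0 : ℝ) 1)).continuous.comp
    (hc.comp (show Continuous fun x : ℝ => a * x / b by fun_prop))
  convert hc2 using 2 with x
  symm
  apply eq_l2Class
  refine (LpToLpRestrictCLM_coeFn ℂ (Ioo (0 : ℝ) 1) _).trans (ae_restrict_of_ae ?_)
  simp only [Function.comp]
  rw [DomAddAct.mk_vadd_toLp]
  refine (MemLp.coeFn_toLp _).trans (Eventually.of_forall fun s => ?_)
  simp only [vadd_eq_add]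
  congr 1
  field_simp
  ring

end Affine

/-! ### Factorization for operators with continuous rows -/

section Factor

variable {n : Type} [Fintype n]

/-- Changing g under a fixed cut costs at most the norm of the change. Moving the cut under a fixed
g is handled by dominated convergence, the only exceptional point being the end point b(x₀). -/
theorem continuous_l2Class_indicator {E : Type*} [NormedAddCommGroup E]
    {X : Type*} [TopologicalSpace X] [FirstCountableTopology X]
    {b : X → ℝ} (hb : Continuous b) {g : X → Lp E 2 vol01} (hg : Continuous g) :
    Continuous fun x => l2Class vol01 ((Iic (b x)).indicator (g x)) := by
  rw [continuous_iff_continuousAt]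
  intro x₀
  have hm : ∀ x y, MemLp ((Iic (b x)).indicator (g y)) 2 vol01 :=
    fun x y => (Lp.memLp (g y)).indicator measurableSet_Iic
  have h1 : ∀ x, ‖l2Class vol01 ((Iic (b x)).indicator (g x)) -
      l2Class vol01 ((Iic (b x)).indicator (g x₀))‖ ≤ ‖g x - g x₀‖ := by
    intro x
    rw [← l2Class_sub (hm x x) (hm x x₀)]
    have := norm_l2Class_le_mul (C := 1) ((hm x x).sub (hm x x₀)) (Lp.memLp (g x - g x₀)) (by
      filter_upwards [Lp.coeFn_sub (g x) (g x₀)] with t ht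
      rw [ht, one_mul]
      by_cases h : t ≤ b x <;> simp [indicator, h])
    rwa [l2Class_coe, one_mul] at this
  have h2 : Tendsto (fun x => ‖l2Class vol01 ((Iic (b x)).indicator (g x₀)) -
      l2Class vol01 ((Iic (b x₀)).indicator (g x₀))‖ ^ 2) (𝓝 x₀) (𝓝 0) := by
    have e : ∀ x, ‖l2Class vol01 ((Iic (b x)).indicator (g x₀)) -
        l2Class vol01 ((Iic (b x₀)).indicator (g x₀))‖ ^ 2 =
        ∫ t, ‖(Iic (b x)).indicator (g x₀) t - (Iic (b x₀)).indicator (g x₀) t‖ ^ 2 ∂vol01 := by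
      intro x
      rw [← l2Class_sub (hm x x₀) (hm x₀ x₀)]
      exact norm_l2Class_sq ((hm x x₀).sub (hm x₀ x₀))
    simp only [e]
    have h0 : (0 : ℝ) = ∫ t, (0 : ℝ) ∂vol01 := by simp
    rw [h0]
    refine tendsto_integral_filter_of_dominated_convergence (fun t => ‖g x₀ t‖ ^ 2)
      (Eventually.of_forall fun x => (((hm x x₀).sub (hm x₀ x₀)).1.norm.pow 2))
      (Eventually.of_forall fun x => Eventually.of_forall fun t => ?_)
      ((memLp_two_iff_integrable_sq_norm (Lp.memLp (g x₀)).1).1 (Lp.memLp (g x₀))) ?_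
    · by_cases h : t ≤ b x <;> by_cases h' : t ≤ b x₀ <;> simp [indicator, h, h']
    · have hne : ∀ᵐ t ∂vol01, t ≠ b x₀ := by
        refine ae_restrict_of_ae ?_
        simp [ae_iff]
      filter_upwards [hne] with t ht
      refine tendsto_const_nhds.congr' ?_
      rcases lt_or_gt_of_ne ht with ht | ht
      · filter_upwards [hb.continuousAt.eventually (lt_mem_nhds ht)] with x hx
        simp [indicator, hx.le, ht.le]
      · filter_upwards [hb.continuousAt.eventually (gt_mem_nhds ht)] with x hx
        simp [indicator, hx.not_ge, ht.not_ge]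
  have h3 : Tendsto (fun x => ‖l2Class vol01 ((Iic (b x)).indicator (g x₀)) -
      l2Class vol01 ((Iic (b x₀)).indicator (g x₀))‖) (𝓝 x₀) (𝓝 0) := by
    have := (Real.continuous_sqrt.tendsto 0).comp h2
    simpa [Function.comp_def, Real.sqrt_sq] using this
  refine tendsto_iff_norm_sub_tendsto_zero.2 (squeeze_zero (fun _ => norm_nonneg _) (fun x =>
    (norm_sub_le_norm_sub_add_norm_sub _ (l2Class vol01 ((Iic (b x)).indicator (g x₀))) _).trans
      (add_le_add_left (h1 x) _)) ?_)
  have h4 := (tendsto_iff_norm_sub_tendsto_zero.1 (hg.tendsto x₀)).add h3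
  simpa using h4

theorem continuous_cut_apply {X : Type*} [TopologicalSpace X] [FirstCountableTopology X]
    {b : X → ℝ} (hb : Continuous b) {g : X → L2v n} (hg : Continuous g) :
    Continuous fun x => cut (b x) (g x) := by
  simp only [cut_eq]
  exact continuous_l2Class_indicator hb hg

/-- If the rows `κ` of `K` cancel those of `F` on `(0, x)`, then `(1 + K) (1 + F)` is upper
triangular. -/
theorem upper_of_rows {κ η : ℝ → n → L2v n} (hκ : Continuous κ) (hη : Continuous η)
    (hF : ContinuousLinearMap.adjoint (rowOp η) = rowOp η)
    (heq : ∀ x ∈ Ioo (0 : ℝ) 1, ∀ k, κ x k + cut x (η x k) + cut x (rowOp η (κ x k)) = 0) (b : ℝ) :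
    (1 + rowOp κ) * (1 + rowOp η) * cut b = cut b * ((1 + rowOp κ) * (1 + rowOp η)) * cut b := by
  ext1 f
  set g := cut b f with hg
  have hgg : cut b g = g := by rw [hg, cut_apply_cut_apply, min_self]
  have e : (1 + rowOp κ) * (1 + rowOp η) * cut b =
      cut b + rowOp η * cut b + rowOp κ * cut b + rowOp κ * rowOp η * cut b := by noncomm_ring
  set w := ((1 + rowOp κ) * (1 + rowOp η) * cut b : L2v n →L[ℂ] L2v n) f with hw
  change w = cut b w
  have hw' : w = g + rowOp η g + rowOp κ g + rowOp κ (rowOp η g) := by rw [hw, e]; rfl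
  apply Lp.ext
  filter_upwards [ae_vol01_mem, coeFn_cut b w, coeFn_cut b g, coeFn_rowOp hη g, coeFn_rowOp hκ g,
    coeFn_rowOp hκ (rowOp η g), Lp.coeFn_add (g + rowOp η g + rowOp κ g) (rowOp κ (rowOp η g)),
    Lp.coeFn_add (g + rowOp η g) (rowOp κ g), Lp.coeFn_add g (rowOp η g)]
    with x hx h1 h2 h3 h4 h5 h6 h7 h8
  rw [h1]
  by_cases hb : x ≤ b
  · simp [indicator, hb]
  -- At a point x > b the function g, supported before b, vanishes, and pairing with g does not
  -- notice a cut at x. The value is therefore the pairing of g with the left side of `heq`.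
  · simp only [indicator, mem_Iic, hb, if_false]
    rw [hgg] at h2
    rw [hw', h6, Pi.add_apply, h7, Pi.add_apply, h8, Pi.add_apply, h2, h3, h4, h5]
    ext k
    simp only [indicator, mem_Iic, hb, if_false, zero_add, PiLp.add_apply, rowFun_apply,
      PiLp.zero_apply]
    have hs : ⟪κ x k, rowOp η g⟫_ℂ = ⟪rowOp η (κ x k), g⟫_ℂ := by
      rw [← ContinuousLinearMap.adjoint_inner_left, hF]
    have hc : ∀ v : L2v n, ⟪v, g⟫_ℂ = ⟪cut x v, g⟫_ℂ := by
      intro v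
      rw [inner_cut_left, hg, cut_apply_cut_apply, min_eq_right (not_le.1 hb).le]
    rw [hs, hc (η x k), hc (rowOp η (κ x k)), ← inner_add_left, ← inner_add_left,
      add_comm (cut x (η x k)), heq x hx k, inner_zero_left]

/-- If the rows `κ` are supported in `(0, x)` and cancel the rows of `F` there, then they define
the triangular factor of `(1 + F)⁻¹`. -/
theorem factorization_of_rows {κ η : ℝ → n → L2v n} (hκ : Continuous κ) (hη : Continuous η)
    (hF : ContinuousLinearMap.adjoint (rowOp η) = rowOp η)
    (hsupp : ∀ x ∈ Ioo (0 : ℝ) 1, ∀ k, cut x (κ x k) = κ x k)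
    (heq : ∀ x ∈ Ioo (0 : ℝ) 1, ∀ k, κ x k + cut x (η x k) + cut x (rowOp η (κ x k)) = 0) :
    (1 + rowOp κ) * (1 + rowOp η) * (1 + ContinuousLinearMap.adjoint (rowOp κ)) = 1 :=
  triangular_factorization (isLower_rowOp hκ hsupp) (rowBdd_rowOp hκ) hF (rowBdd_rowOp hη)
    (upper_of_rows hκ hη hF heq)

end Factor

/-! ### Convolution operators and the resolvent of their truncations -/

section Krein

variable {n : Type} [Fintype n] [DecidableEq n]

/-- The rows of the kernel `h(x - t)`. -/
def convRows (h : ℝ → Mat n) (x : ℝ) (k : n) : L2v n := rowClass (fun t => h (x - t)) k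

/-- `f ↦ ∫₀¹ h(· - t) f(t) dt`. -/
def convOp (h : ℝ → Mat n) : L2v n →L[ℂ] L2v n := rowOp (convRows h)

variable {h : ℝ → Mat n}

theorem memLp_conv (hh : MemLp h 2 volume) (x : ℝ) : MemLp (fun t => h (x - t)) 2 vol01 := by
  have := (memLp_comp_affine hh x (b := -1) (by norm_num)).restrict (Ioo (0 : ℝ) 1)
  simpa [← sub_eq_add_neg] using this

theorem continuous_convRows (hh : MemLp h 2 volume) : Continuous (convRows h) := by
  have := continuous_l2Class_affine hh 1 (b := -1) (by norm_num)
  simp only [one_mul, neg_one_mul, ← sub_eq_add_neg] at this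
  exact continuous_rowClass_of_continuous (memLp_conv hh) this

/-- A square-integrable matrix function whose convolution operator `T` is self-adjoint and
such that `1 + T` is bounded below by a positive constant. -/
structure IsKreinKernel (h : ℝ → Mat n) : Prop where
  stronglyMeasurable : StronglyMeasurable h
  memLp : MemLp h 2 volume
  symm : ∀ x, (h x)ᴴ = h (-x)
  adjoint_eq : ContinuousLinearMap.adjoint (convOp h) = convOp h
  coercive : ∃ c : ℝ, 0 < c ∧ ∀ f : L2v n, c * ‖f‖ ^ 2 ≤ (⟪f + convOp h f, f⟫_ℂ).re

/-- `1 + P_b T P_b`, where `T` is the convolution operator. -/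
def truncOp (h : ℝ → Mat n) (b : ℝ) : L2v n →L[ℂ] L2v n := 1 + cut b * convOp h * cut b

/-- The rows of the resolvent of the convolution operator on `(0, x)`. -/
def resRow (h : ℝ → Mat n) (x y : ℝ) (k : n) : L2v n :=
  -(Ring.inverse (truncOp h x) (cut x (convRows h y k)))

/-- The function `t ↦ -h(y - t) - ∫ Γ(s) h(s - t) ds` for the resolvent row `Γ`. -/
def resFun (h : ℝ → Mat n) (x y t : ℝ) : Mat n :=
  -(h (y - t) + Matrix.of fun k i => ⟪resRow h x y k, convRows h t i⟫_ℂ)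

/-- The solution of `Γ(t) + h(y - t) + ∫₀ˣ Γ(s) h(s - t) ds = 0` on `(0, x)`, extended by zero. -/
def resKer (h : ℝ → Mat n) (x y t : ℝ) : Mat n := (Iic x).indicator (resFun h x y) t

theorem truncOp_mul_cut (h : ℝ → Mat n) (b : ℝ) : truncOp h b * cut b = cut b * truncOp h b := by
  simp only [truncOp, add_mul, mul_add, one_mul, mul_one]
  rw [mul_assoc _ (cut b) (cut b), cut_mul_self, ← mul_assoc (cut b), ← mul_assoc (cut b),
    cut_mul_self]

/-! ### Invertibility of the truncations and the resolvent kernel on (0, x) -/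

namespace IsKreinKernel

variable (hh : IsKreinKernel h)
include hh

/-- The form of 1 + PTP splits into that of 1 on the range of 1 - P and that of 1 + T on the range
of P, so it is bounded below by min(c,1), and Lax–Milgram applies. -/
theorem isUnit_truncOp (b : ℝ) : IsUnit (truncOp h b) := by
  obtain ⟨c, hc, hcf⟩ := hh.coercive
  refine ContinuousLinearMap.isUnit_of_forall_le_norm_inner_map _
    (c := ⟨min c 1, (lt_min hc one_pos).le⟩) (by exact_mod_cast lt_min hc one_pos) fun f => ?_
  refine le_trans ?_ (Complex.re_le_norm _)
  change ‖f‖ ^ 2 * min c 1 ≤ _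
  have h1 := hcf (cut b f)
  have e : ⟪truncOp h b f, f⟫_ℂ =
      ⟪f, f⟫_ℂ - ⟪cut b f, cut b f⟫_ℂ + ⟪cut b f + convOp h (cut b f), cut b f⟫_ℂ := by
    have e1 : truncOp h b f = f + cut b (convOp h (cut b f)) := rfl
    rw [e1, inner_add_left, inner_add_left, inner_cut_left]
    ring
  have e2 : ‖f‖ ^ 2 - ‖cut b f‖ ^ 2 = (⟪f, f⟫_ℂ - ⟪cut b f, cut b f⟫_ℂ).re := by
    rw [Complex.sub_re]
    congr 1 <;> exact (inner_self_eq_norm_sq (𝕜 := ℂ) _).symm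
  rw [e, Complex.add_re, ← e2]
  have h3 : ‖cut b f‖ ^ 2 ≤ ‖f‖ ^ 2 := pow_le_pow_left₀ (norm_nonneg _) (norm_cut_apply_le b f) 2
  nlinarith [min_le_left c 1, min_le_right c 1, sq_nonneg ‖cut b f‖]

/-- The difference of two truncations is (P_c - P_b)TP_c + P_bT(P_c - P_b). The first term is of
order √|c-b| because T maps into L∞; the second is estimated through its adjoint, T being
self-adjoint. -/
theorem continuous_truncOp : Continuous (truncOp h) := by
  obtain ⟨C, hC0, hC⟩ := (rowBdd_rowOp (continuous_convRows hh.memLp)).exists_norm_le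
  have hC' : ∀ b c, ‖(cut c - cut b) * convOp h‖ ≤ C * √|c - b| := by
    intro b c
    rcases le_total b c with hbc | hbc
    · rw [abs_of_nonneg (by linarith)]; exact hC b c hbc
    · rw [abs_sub_comm, abs_of_nonneg (by linarith), ← norm_neg, ← neg_mul, neg_sub]
      exact hC c b hbc
  have hcut : ∀ b, ‖(cut b : L2v n →L[ℂ] L2v n)‖ ≤ 1 := fun b =>
    ContinuousLinearMap.opNorm_le_bound _ zero_le_one fun f => by
      rw [one_mul]; exact norm_cut_apply_le b f
  have hadj : ∀ b c, ‖convOp h * (cut c - cut b)‖ ≤ C * √|c - b| := by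
    intro b c
    have e : convOp h * (cut c - cut b) =
        ContinuousLinearMap.adjoint ((cut c - cut b) * convOp h) := by
      rw [adjoint_mul_eq, hh.adjoint_eq, map_sub, adjoint_cut, adjoint_cut]
    rw [e, LinearIsometryEquiv.norm_map]
    exact hC' b c
  have key : ∀ b c, ‖truncOp h c - truncOp h b‖ ≤ 2 * C * √|c - b| := by
    intro b c
    have e : truncOp h c - truncOp h b =
        (cut c - cut b) * convOp h * cut c + cut b * (convOp h * (cut c - cut b)) := by
      simp only [truncOp]; noncomm_ring
    rw [e]
    refine (norm_add_le _ _).trans ?_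
    have h1 := norm_mul_le ((cut c - cut b) * convOp h) (cut c)
    have h2 := norm_mul_le (cut b) (convOp h * (cut c - cut b))
    have := hC' b c; have := hadj b c; have := hcut b; have := hcut c
    have h3 : ‖(cut c - cut b) * convOp h‖ * ‖(cut c : L2v n →L[ℂ] L2v n)‖ ≤ C * √|c - b| * 1 := by
      gcongr
    have h4 : ‖(cut b : L2v n →L[ℂ] L2v n)‖ * ‖convOp h * (cut c - cut b)‖ ≤ 1 * (C * √|c - b|) := by
      gcongr
    linarith
  rw [continuous_iff_continuousAt]
  intro b
  refine tendsto_iff_norm_sub_tendsto_zero.2 (squeeze_zero (fun _ => norm_nonneg _)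
    (fun c => key b c) ?_)
  have : Continuous fun c : ℝ => 2 * C * √|c - b| := by fun_prop
  simpa using this.tendsto b

theorem continuous_inverse_truncOp : Continuous fun b => Ring.inverse (truncOp h b) := by
  rw [continuous_iff_continuousAt]
  intro b
  obtain ⟨u, hu⟩ := hh.isUnit_truncOp b
  have := NormedRing.inverse_continuousAt u
  rw [hu] at this
  exact ContinuousAt.comp (f := truncOp h) this hh.continuous_truncOp.continuousAt

theorem continuous_resRow (k : n) : Continuous fun p : ℝ × ℝ => resRow h p.1 p.2 k :=
  ((hh.continuous_inverse_truncOp.comp continuous_fst).clm_apply (continuous_cut_apply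
    continuous_fst ((continuous_pi_iff.1 (continuous_convRows hh.memLp) k).comp
      continuous_snd))).neg

theorem inverse_mul_cut (b : ℝ) :
    Ring.inverse (truncOp h b) * cut b = cut b * Ring.inverse (truncOp h b) := by
  have h1 := Ring.inverse_mul_cancel _ (hh.isUnit_truncOp b)
  have h2 := Ring.mul_inverse_cancel _ (hh.isUnit_truncOp b)
  calc Ring.inverse (truncOp h b) * cut b
      = Ring.inverse (truncOp h b) * (cut b * truncOp h b) * Ring.inverse (truncOp h b) := by
        rw [mul_assoc, mul_assoc, h2, mul_one]
    _ = _ := by rw [← truncOp_mul_cut, ← mul_assoc, h1, one_mul]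

theorem cut_resRow (x y : ℝ) (k : n) : cut x (resRow h x y k) = resRow h x y k := by
  have := congrArg (fun T : L2v n →L[ℂ] L2v n => T (cut x (convRows h y k))) (hh.inverse_mul_cut x)
  simp only [mul_apply_eq_comp, cut_apply_cut_apply, min_self] at this
  rw [resRow, map_neg, ← this]

theorem resRow_equation (x y : ℝ) (k : n) :
    resRow h x y k + cut x (convRows h y k) + cut x (convOp h (resRow h x y k)) = 0 := by
  have h2 := Ring.mul_inverse_cancel _ (hh.isUnit_truncOp x)
  have h3 : truncOp h x (resRow h x y k) = -cut x (convRows h y k) := by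
    rw [resRow, map_neg, ← mul_apply_eq_comp, h2]; rfl
  have h4 : truncOp h x (resRow h x y k) =
      resRow h x y k + cut x (convOp h (cut x (resRow h x y k))) := rfl
  rw [hh.cut_resRow] at h4
  rw [add_right_comm, ← h4, h3, neg_add_cancel]

theorem eq_resRow {x y : ℝ} {k : n} {m : L2v n} (hm : cut x m = m)
    (he : m + cut x (convRows h y k) + cut x (convOp h m) = 0) : m = resRow h x y k := by
  have h1 := Ring.inverse_mul_cancel _ (hh.isUnit_truncOp x)
  have h4 : truncOp h x m = -cut x (convRows h y k) := by
    have : truncOp h x m = m + cut x (convOp h (cut x m)) := rfl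
    rw [this, hm, eq_neg_iff_add_eq_zero, add_right_comm]; exact he
  rw [resRow, ← map_neg, ← h4, ← mul_apply_eq_comp, h1]; rfl

theorem continuous_resRow_inner (k i : n) :
    Continuous fun p : (ℝ × ℝ) × ℝ => ⟪resRow h p.1.1 p.1.2 k, convRows h p.2 i⟫_ℂ :=
  ((hh.continuous_resRow k).comp continuous_fst).inner
    ((continuous_pi_iff.1 (continuous_convRows hh.memLp) i).comp continuous_snd)

theorem memLp_resFun (x y : ℝ) : MemLp (resFun h x y) 2 vol01 := by
  have hc : ∀ k i, Continuous fun t => ⟪resRow h x y k, convRows h t i⟫_ℂ := fun k i =>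
    continuous_const.inner (continuous_pi_iff.1 (continuous_convRows hh.memLp) i)
  set B : ℝ → Mat n := fun t => Matrix.of fun k i => ⟪resRow h x y k, convRows h t i⟫_ℂ with hB
  have h2 : MemLp B 2 vol01 := memLp_of_entries fun k i => by
    simp only [hB, Matrix.of_apply]
    exact memLp_of_continuous (hc k i)
  have e : resFun h x y = fun t => -(h (y - t) + B t) := rfl
  rw [e]
  exact MemLp.neg (MemLp.add (memLp_conv hh.memLp y) h2)

theorem memLp_resKer (x y : ℝ) : MemLp (resKer h x y) 2 vol01 :=
  (hh.memLp_resFun x y).indicator measurableSet_Iic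

/-- Solving the resolvent equation for the unknown gives a formula that makes sense at every point,
and this formula represents the abstract class `resRow`. Point values such as those at t = 0 thereby
become meaningful. -/
theorem rowClass_resKer (x y : ℝ) (k : n) : rowClass (resKer h x y) k = resRow h x y k := by
  symm
  apply eq_l2Class
  have he : resRow h x y k = -(cut x (convRows h y k + convOp h (resRow h x y k))) := by
    rw [map_add, eq_neg_iff_add_eq_zero, ← add_assoc]; exact hh.resRow_equation x y k
  filter_upwards [Lp.coeFn_neg (cut x (convRows h y k + convOp h (resRow h x y k))),
    coeFn_cut x (convRows h y k + convOp h (resRow h x y k)),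
    Lp.coeFn_add (convRows h y k) (convOp h (resRow h x y k)),
    coeFn_rowClass (memLp_conv hh.memLp y) k,
    coeFn_rowOp (continuous_convRows hh.memLp) (resRow h x y k)] with t h1 h2 h3 h4 h5
  rw [← he] at h1
  rw [h1, Pi.neg_apply, h2, resKer]
  by_cases ht : t ≤ x
  · simp only [indicator, mem_Iic, ht, if_true, h3, Pi.add_apply]
    rw [convRows, h4, convOp, h5]
    ext i
    simp only [resFun, conjRow_apply, PiLp.neg_apply, PiLp.add_apply, rowFun_apply, Matrix.neg_apply,
      Matrix.add_apply, Matrix.of_apply, star_neg, star_add]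
    congr 2
    exact (inner_conj_symm _ _).symm
  · simp only [indicator, mem_Iic, ht, if_false, neg_zero]
    ext i; simp

theorem inner_resRow_convRows (x y t : ℝ) (hx : x ∈ Icc (0 : ℝ) 1) (k i : n) :
    ⟪resRow h x y k, convRows h t i⟫_ℂ =
      (∫ s in (0 : ℝ)..x, resKer h x y s * h (s - t)) k i := by
  have e : ∫ s, resKer h x y s * (h (t - s))ᴴ ∂vol01 =
      ∫ s in (0 : ℝ)..x, resKer h x y s * h (s - t) := by
    rw [← integral_vol01_indicator (fun s => resKer h x y s * h (s - t)) hx]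
    refine integral_congr_ae (Eventually.of_forall fun s => ?_)
    simp only [hh.symm, neg_sub]
    by_cases hs : s ≤ x <;> simp [indicator, hs, resKer]
  rw [← hh.rowClass_resKer, convRows, inner_rowClass (hh.memLp_resKer x y) (memLp_conv hh.memLp t),
    e]

/-- The equation holds at every t ≤ x and not only almost everywhere, because `resFun` is by
definition the negative of the other two terms. -/
theorem resKer_equation {x y t : ℝ} (hx : x ∈ Icc (0 : ℝ) 1) (ht : t ≤ x) :
    resKer h x y t + h (y - t) + ∫ s in (0 : ℝ)..x, resKer h x y s * h (s - t) = 0 := by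
  have e : (∫ s in (0 : ℝ)..x, resKer h x y s * h (s - t)) =
      Matrix.of fun k i => ⟪resRow h x y k, convRows h t i⟫_ℂ := by
    ext k i; rw [Matrix.of_apply, hh.inner_resRow_convRows x y t hx]
  rw [e, resKer, indicator_of_mem (by exact ht), resFun]
  abel

/-- Uniqueness for the resolvent equation on `(0, x)`. -/
theorem ae_eq_resKer {x y : ℝ} (hx : x ∈ Icc (0 : ℝ) 1) {M : ℝ → Mat n} (hM : MemLp M 2 vol01)
    (h0 : ∀ᵐ t ∂vol01, x < t → M t = 0)
    (he : ∀ᵐ t ∂vol01, t < x → M t + h (y - t) + ∫ s in (0 : ℝ)..x, M s * h (s - t) = 0) :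
    M =ᵐ[vol01] resKer h x y := by
  have hne : ∀ᵐ t ∂vol01, t ≠ x := by
    refine ae_restrict_of_ae ?_
    simp [ae_iff]
  refine ae_eq_of_rowClass_eq hM (hh.memLp_resKer x y) fun k => ?_
  rw [hh.rowClass_resKer]
  have hMi : (Iic x).indicator M =ᵐ[vol01] M := by
    filter_upwards [h0] with t ht
    by_cases h : t ≤ x
    · simp [indicator, h]
    · simp [indicator, h, ht (not_le.1 h)]
  have hcut : cut x (rowClass M k) = rowClass M k := by
    rw [cut_rowClass hM]; exact rowClass_congr hMi k
  refine hh.eq_resRow hcut ?_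
  have hin : ∀ t i, ⟪convRows h t i, rowClass M k⟫_ℂ =
      star ((∫ s in (0 : ℝ)..x, M s * h (s - t)) k i) := by
    intro t i
    have e : ∫ s, M s * (h (t - s))ᴴ ∂vol01 = ∫ s in (0 : ℝ)..x, M s * h (s - t) := by
      rw [← integral_vol01_indicator (fun s => M s * h (s - t)) hx]
      refine integral_congr_ae ?_
      filter_upwards [hMi] with s hs
      simp only [hh.symm, neg_sub]
      by_cases hsx : s ≤ x
      · simp [indicator, hsx]
      · simp only [indicator, mem_Iic, hsx, if_false] at hs ⊢
        rw [← hs, zero_mul]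
    rw [← inner_conj_symm, convRows, inner_rowClass hM (memLp_conv hh.memLp t), e]
    rfl
  apply Lp.ext
  filter_upwards [Lp.coeFn_add (rowClass M k + cut x (convRows h y k))
    (cut x (convOp h (rowClass M k))), Lp.coeFn_add (rowClass M k) (cut x (convRows h y k)),
    coeFn_cut x (convRows h y k), coeFn_cut x (convOp h (rowClass M k)),
    coeFn_rowClass (memLp_conv hh.memLp y) k, coeFn_rowClass hM k,
    coeFn_rowOp (continuous_convRows hh.memLp) (rowClass M k),
    Lp.coeFn_zero (EuclideanSpace ℂ n) 2 vol01, he, h0, hne] with t h1 h2 h3 h4 h5 h6 h7 h8 h9 h10 h11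
  rw [h1, Pi.add_apply, h2, Pi.add_apply, h3, h4, h6, h8]
  rcases lt_or_gt_of_ne h11 with ht | ht
  · simp only [indicator, mem_Iic, ht.le, if_true]
    rw [convRows, h5, convOp, h7]
    ext i
    simp only [PiLp.add_apply, conjRow_apply, rowFun_apply, hin, ← star_add]
    have := congrArg (fun A : Mat n => star (A k i)) (h9 ht)
    simpa using this
  · simp only [indicator, mem_Iic, ht.not_ge, if_false, h10 ht]
    ext i; simp

end IsKreinKernel

end Krein

/-! ### Reflection and the Krein system -/

section KreinSystem

variable {n : Type} [Fintype n] [DecidableEq n] {h : ℝ → Mat n}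

theorem measurePreserving_one_sub : MeasurePreserving (fun t : ℝ => 1 - t) vol01 vol01 := by
  have := (Measure.measurePreserving_sub_left (volume : Measure ℝ) 1).restrict_preimage
    (measurableSet_Ioo (a := (0 : ℝ)) (b := 1))
  simpa using this

/-- The reflection `f ↦ f(1 - ·)`. -/
def reflectOp : L2v n →ₗᵢ[ℂ] L2v n :=
  Lp.compMeasurePreservingₗᵢ ℂ (fun t : ℝ => 1 - t) measurePreserving_one_sub

theorem coeFn_reflectOp (f : L2v n) : reflectOp f =ᵐ[vol01] fun t => f (1 - t) :=
  Lp.coeFn_compMeasurePreserving f measurePreserving_one_sub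

theorem reflectOp_reflectOp (f : L2v n) : reflectOp (reflectOp f) = f := by
  apply Lp.ext
  filter_upwards [coeFn_reflectOp (reflectOp f),
    measurePreserving_one_sub.quasiMeasurePreserving.ae (coeFn_reflectOp f)] with t h1 h2
  rw [h1, h2, sub_sub_cancel]

theorem memLp_reflect (hh : MemLp h 2 volume) : MemLp (fun x => h (-x)) 2 volume :=
  hh.comp_measurePreserving (Measure.measurePreserving_neg volume)

/-- Reflecting both variables about 1/2 changes the sign of x - t. -/
theorem convOp_reflect (hh : MemLp h 2 volume) (f : L2v n) :
    convOp (fun x => h (-x)) (reflectOp f) = reflectOp (convOp h f) := by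
  have hrow : ∀ x k, convRows (fun x => h (-x)) x k = reflectOp (convRows h (1 - x) k) := by
    intro x k
    symm
    apply eq_l2Class
    filter_upwards [coeFn_reflectOp (convRows h (1 - x) k),
      measurePreserving_one_sub.quasiMeasurePreserving.ae
        (coeFn_rowClass (memLp_conv hh (1 - x)) k)] with t h1 h2
    rw [h1, convRows, h2]
    congr 2
    ring
  apply Lp.ext
  filter_upwards [coeFn_reflectOp (convOp h f),
    measurePreserving_one_sub.quasiMeasurePreserving.ae (coeFn_rowOp (continuous_convRows hh) f),
    coeFn_rowOp (continuous_convRows (memLp_reflect hh)) (reflectOp f)] with t h1 h2 h3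
  rw [h1, convOp, convOp, h2, h3]
  ext k
  rw [rowFun_apply, rowFun_apply, hrow, LinearIsometry.inner_map_map]

/-! ### Reflected kernels, the triangular factor `1 + R` and the differentiation of resolvents in
`x` -/

namespace IsKreinKernel

theorem reflect (hh : IsKreinKernel h) : IsKreinKernel fun x => h (-x) where
  stronglyMeasurable := hh.stronglyMeasurable.comp_measurable measurable_neg
  memLp := memLp_reflect hh.memLp
  symm x := hh.symm (-x)
  adjoint_eq := by
    symm
    rw [ContinuousLinearMap.eq_adjoint_iff]
    intro f g
    rw [← reflectOp_reflectOp f, ← reflectOp_reflectOp g, convOp_reflect hh.memLp,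
      convOp_reflect hh.memLp, LinearIsometry.inner_map_map, LinearIsometry.inner_map_map,
      ← ContinuousLinearMap.adjoint_inner_right, hh.adjoint_eq]
  coercive := by
    obtain ⟨c, hc, hcf⟩ := hh.coercive
    refine ⟨c, hc, fun f => ?_⟩
    have := hcf (reflectOp f)
    rw [LinearIsometry.norm_map] at this
    refine this.trans_eq ?_
    conv_rhs => rw [← reflectOp_reflectOp f, convOp_reflect hh.memLp, ← map_add,
      LinearIsometry.inner_map_map]

/-- The substitution s ↦ x - s turns the resolvent equation of h with parameter x - y into that of
h(-·) with parameter y, and the solution is unique. -/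
theorem resKer_reflect (hh : IsKreinKernel h) {x : ℝ} (hx : x ∈ Icc (0 : ℝ) 1) (y : ℝ) :
    ∀ᵐ t ∂vol01, t < x → resKer (fun x => h (-x)) x y t = resKer h x (x - y) (x - t) := by
  -- Extending by zero before reflecting makes `M` square-integrable on the line and zero for t > x,
  -- where x - t is negative.
  set M : ℝ → Mat n := fun t => (Ioo (0 : ℝ) 1).indicator (resKer h x (x - y)) (x - t) with hM
  have hM2 : MemLp M 2 vol01 := by
    have h1 : MemLp ((Ioo (0 : ℝ) 1).indicator (resKer h x (x - y))) 2 volume :=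
      (memLp_indicator_iff_restrict measurableSet_Ioo).2 (hh.memLp_resKer x (x - y))
    exact (h1.comp_measurePreserving (Measure.measurePreserving_sub_left volume x)).restrict _
  have hMe : ∀ t ∈ Ioo 0 x, M t = resKer h x (x - y) (x - t) := by
    intro t ht
    exact indicator_of_mem (show x - t ∈ Ioo (0 : ℝ) 1 from
      ⟨by linarith [ht.2], by linarith [ht.1, hx.2]⟩) _
  have key := hh.reflect.ae_eq_resKer (y := y) hx hM2
    (Eventually.of_forall fun t ht => indicator_of_notMem (fun hm => by
      have := hm.1; linarith) _) (by
      filter_upwards [ae_vol01_mem] with t ht htx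
      have e : ∫ s in (0 : ℝ)..x, M s * h (-(s - t)) =
          ∫ u in (0 : ℝ)..x, resKer h x (x - y) u * h (u - (x - t)) := by
        have := intervalIntegral.integral_comp_sub_left (a := 0) (b := x)
          (fun u => resKer h x (x - y) u * h (u - (x - t))) x
        rw [sub_self, sub_zero] at this
        rw [← this]
        apply intervalIntegral.integral_congr_ae
        have hne : ∀ᵐ s ∂(volume : Measure ℝ), s ≠ x := by simp [ae_iff]
        filter_upwards [hne] with s hs hs'
        rw [uIoc_of_le hx.1] at hs'
        rw [hMe s ⟨hs'.1, lt_of_le_of_ne hs'.2 hs⟩]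
        congr 2
        ring
      rw [e, hMe t ⟨ht.1, htx⟩]
      have := hh.resKer_equation (y := x - y) (t := x - t) hx (by linarith [ht.1])
      rw [← this]
      congr 3
      ring)
  filter_upwards [key, ae_vol01_mem] with t ht h0 htx
  rw [← ht, hMe t ⟨h0.1, htx⟩]

theorem continuous_diag (hh : IsKreinKernel h) : Continuous fun x => resRow h x x := by
  refine continuous_pi fun k => ?_
  have h2 : Continuous fun x : ℝ => (x, x) := by fun_prop
  have h3 := (hh.continuous_resRow k).comp h2
  simp only [Function.comp_def] at h3
  exact h3

/-- `1 + R`, where `R` is the operator whose kernel solves the Krein equation. -/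
def _root_.DiracInverse.kreinFactor (h : ℝ → Mat n) : L2v n →L[ℂ] L2v n :=
  1 + rowOp fun x => resRow h x x

theorem isLower_diag (hh : IsKreinKernel h) : IsLower (rowOp fun x => resRow h x x) :=
  isLower_rowOp hh.continuous_diag fun x _ k => hh.cut_resRow x x k

theorem isUnit_kreinFactor (hh : IsKreinKernel h) : IsUnit (kreinFactor h) :=
  isUnit_one_add_of_isLower hh.isLower_diag (rowBdd_rowOp hh.continuous_diag)

theorem kreinFactor_factorization (hh : IsKreinKernel h) :
    kreinFactor h * (1 + convOp h) * ContinuousLinearMap.adjoint (kreinFactor h) = 1 := by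
  rw [kreinFactor, map_add, adjoint_one_eq]
  exact factorization_of_rows hh.continuous_diag
    (continuous_convRows hh.memLp) hh.adjoint_eq (fun x _ k => hh.cut_resRow x x k)
    (fun x _ k => hh.resRow_equation x x k)

/-- Lower triangularity of L gives P L P = P L, and upper triangularity of L(1+T) gives P L(1+T) P =
L(1+T) P; with L*L(1+T) = 1 this yields L*PL·(1 + PTP)P = P. The formula isolates the dependence of
the resolvent on x in the projection, so that resolvents can be differentiated in x without
smoothness of h. -/
theorem inverse_truncOp_mul_cut (hh : IsKreinKernel h) (x : ℝ) :
    Ring.inverse (truncOp h x) * cut x =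
      ContinuousLinearMap.adjoint (kreinFactor h) * cut x * kreinFactor h := by
  have hLu := hh.isUnit_kreinFactor
  have hfac := hh.kreinFactor_factorization
  have hup : kreinFactor h * (1 + convOp h) * cut x =
      cut x * (kreinFactor h * (1 + convOp h)) * cut x :=
    upper_of_rows hh.continuous_diag (continuous_convRows hh.memLp) hh.adjoint_eq
      (fun x _ k => hh.resRow_equation x x k) x
  have hLc : cut x * kreinFactor h * cut x = cut x * kreinFactor h := by
    rw [kreinFactor, mul_add, mul_one, add_mul, ← hh.isLower_diag x, cut_mul_self]
  generalize kreinFactor h = L at *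
  set L' := ContinuousLinearMap.adjoint L
  have hL'u : IsUnit L' := hLu.star
  have hfac' : L' * (L * (1 + convOp h)) = 1 := by
    have : L' * (L * (1 + convOp h)) * L' = 1 * L' := by rw [mul_assoc, hfac, mul_one, one_mul]
    exact hL'u.mul_right_cancel this
  have hA : truncOp h x * cut x = cut x * ((1 + convOp h) * cut x) := by
    simp only [truncOp, add_mul, mul_add, one_mul]
    rw [mul_assoc _ (cut x) (cut x), cut_mul_self, mul_assoc]
  have hY : L' * cut x * L * (truncOp h x * cut x) = cut x := by
    calc L' * cut x * L * (truncOp h x * cut x)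
        = L' * (cut x * L * cut x) * ((1 + convOp h) * cut x) := by
          rw [hA]; simp only [mul_assoc]
      _ = L' * (cut x * (L * (1 + convOp h)) * cut x) := by rw [hLc]; simp only [mul_assoc]
      _ = cut x := by rw [← hup, ← mul_assoc, hfac', one_mul]
  calc Ring.inverse (truncOp h x) * cut x
      = L' * cut x * L * (truncOp h x * cut x) * Ring.inverse (truncOp h x) := by
        rw [hY, hh.inverse_mul_cut]
    _ = L' * (cut x * L * cut x) := by
        rw [truncOp_mul_cut, mul_assoc _ (cut x * _), mul_assoc (cut x),
          Ring.mul_inverse_cancel _ (hh.isUnit_truncOp x), mul_one]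
        simp only [mul_assoc]
    _ = _ := by rw [hLc, mul_assoc]

/-- The `k`-th column of `y ↦ R(y, 0)`. -/
def _root_.DiracInverse.boundaryCol (h : ℝ → Mat n) (k : n) : L2v n :=
  -(kreinFactor h (convRows h 0 k))

/-- This is the resolvent equation at t = 0, where the symmetry h(-y)* = h(y) turns the row of h(-·)
into a column of h. -/
theorem coeFn_boundaryCol (hh : IsKreinKernel h) (k : n) :
    boundaryCol h k =ᵐ[vol01] fun y => WithLp.toLp 2 fun i => resKer h y y 0 i k := by
  have e : boundaryCol h k =
      -(convRows h 0 k + rowOp (fun x => resRow h x x) (convRows h 0 k)) := rfl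
  filter_upwards [ae_vol01_mem,
    Lp.coeFn_neg (convRows h 0 k + rowOp (fun x => resRow h x x) (convRows h 0 k)),
    Lp.coeFn_add (convRows h 0 k) (rowOp (fun x => resRow h x x) (convRows h 0 k)),
    coeFn_rowClass (memLp_conv hh.memLp 0) k,
    coeFn_rowOp hh.continuous_diag (convRows h 0 k)] with y hy h1 h2 h3 h4
  rw [e, h1, Pi.neg_apply, h2, Pi.add_apply, h4, convRows, h3]
  ext i
  rw [resKer, indicator_of_mem (show (0 : ℝ) ∈ Iic y from hy.1.le), resFun]
  simp only [PiLp.neg_apply, PiLp.add_apply, conjRow_apply, rowFun_apply, Matrix.neg_apply,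
    Matrix.add_apply, Matrix.of_apply, sub_zero, zero_sub]
  rw [← Matrix.conjTranspose_apply, hh.symm, neg_neg]
  simp only [convRows, zero_sub]

theorem resRow_zero (hh : IsKreinKernel h) (x : ℝ) (k : n) :
    resRow h x 0 k = ContinuousLinearMap.adjoint (kreinFactor h) (cut x (boundaryCol h k)) := by
  have := congrArg (fun T : L2v n →L[ℂ] L2v n => T (convRows h 0 k)) (hh.inverse_truncOp_mul_cut x)
  simp only [mul_apply_eq_comp] at this
  rw [resRow, this, boundaryCol, map_neg, map_neg]

theorem coeFn_kreinFactor (hh : IsKreinKernel h) (g : L2v n) :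
    kreinFactor h g =ᵐ[vol01] fun y => g y + rowFun (fun x => resRow h x x) g y := by
  have e : kreinFactor h g = g + rowOp (fun x => resRow h x x) g := rfl
  filter_upwards [Lp.coeFn_add g (rowOp (fun x => resRow h x x) g),
    coeFn_rowOp hh.continuous_diag g] with y h1 h2
  rw [e, h1, Pi.add_apply, h2]

/-- Krein's differential equation for the row with parameter 0, integrated in x and tested against
g. It follows by moving L* to the other side: P_x produces the integral over (0,x), and L g is the
bracket. -/
theorem inner_resRow_zero (hh : IsKreinKernel h) {x : ℝ} (hx : x ∈ Icc (0 : ℝ) 1) (k : n)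
    (g : L2v n) : ⟪resRow h x 0 k, g⟫_ℂ = ∫ y in (0 : ℝ)..x,
      ∑ j, star (resKer h y y 0 j k) * (g y j + ⟪resRow h y y j, g⟫_ℂ) := by
  rw [hh.resRow_zero, ContinuousLinearMap.adjoint_inner_left, L2.inner_def,
    ← integral_vol01_indicator _ hx]
  apply integral_congr_ae
  filter_upwards [coeFn_cut x (boundaryCol h k), hh.coeFn_boundaryCol k, hh.coeFn_kreinFactor g]
    with y h1 h2 h3
  rw [h1, h3]
  by_cases hy : y ≤ x
  · simp only [indicator, mem_Iic, hy, if_true, h2, PiLp.inner_apply]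
    refine Finset.sum_congr rfl fun j _ => ?_
    simp [mul_comm]
  · simp [indicator, hy]

/-- Both sides are matrix elements of the same operator L*P_xL, which is self-adjoint. -/
theorem inner_convRows_resRow_zero (hh : IsKreinKernel h) (x : ℝ) (k i : n) :
    ⟪convRows h x k, resRow h x 0 i⟫_ℂ = ⟪resRow h x x k, convRows h 0 i⟫_ℂ := by
  have h1 : ∀ y l, resRow h x y l = -(ContinuousLinearMap.adjoint (kreinFactor h)
      (cut x (kreinFactor h (convRows h y l)))) := by
    intro y l
    have := congrArg (fun T : L2v n →L[ℂ] L2v n => T (convRows h y l))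
      (hh.inverse_truncOp_mul_cut x)
    simp only [mul_apply_eq_comp] at this
    rw [resRow, this]
  rw [h1, h1, inner_neg_left, inner_neg_right, ContinuousLinearMap.adjoint_inner_left,
    ContinuousLinearMap.adjoint_inner_right, inner_cut_left]

theorem intervalIntegral_resKer_reflect (hh : IsKreinKernel h) {x : ℝ} (hx : x ∈ Icc (0 : ℝ) 1)
    (y : ℝ) {E : Type*} [NormedAddCommGroup E] [NormedSpace ℝ E] (Φ : Mat n → ℝ → E) :
    ∫ s in (0 : ℝ)..x, Φ (resKer (fun x => h (-x)) x y s) s =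
      ∫ s in (0 : ℝ)..x, Φ (resKer h x (x - y) s) (x - s) := by
  have := intervalIntegral.integral_comp_sub_left (a := 0) (b := x)
    (fun u => Φ (resKer h x (x - y) u) (x - u)) x
  rw [sub_self, sub_zero] at this
  rw [← this, ← integral_vol01_indicator _ hx, ← integral_vol01_indicator _ hx]
  have hne : ∀ᵐ s ∂vol01, s ≠ x := by
    refine ae_restrict_of_ae ?_
    simp [ae_iff]
  apply integral_congr_ae
  filter_upwards [hh.resKer_reflect hx y, hne] with s hs hsx
  by_cases h1 : s ≤ x
  · simp only [indicator, mem_Iic, h1, if_true, sub_sub_cancel]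
    rw [hs (lt_of_le_of_ne h1 hsx)]
  · simp [indicator, h1]

/-- The resolvent equation at t = 0 and the substitution s ↦ x - s express the reflected value by
-h(-x) and an integral of the row with parameter 0. Its adjoint involves h(x) and, by
self-adjointness of the resolvent, the row with parameter x; that is the equation for R(x,0). -/
theorem conjTranspose_resKer_reflect (hh : IsKreinKernel h) {x : ℝ} (hx : x ∈ Icc (0 : ℝ) 1) :
    (resKer (fun x => h (-x)) x x 0)ᴴ = resKer h x x 0 := by
  have h1 := hh.reflect.resKer_equation (y := x) (t := 0) hx hx.1
  have h2 := hh.intervalIntegral_resKer_reflect hx x fun A s => A * h (-(s - 0))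
  rw [h2, sub_self, add_assoc, add_eq_zero_iff_eq_neg] at h1
  rw [h1]
  have h3 : (∫ s in (0 : ℝ)..x, resKer h x 0 s * h (-(x - s - 0))) =
      ∫ s in (0 : ℝ)..x, resKer h x 0 s * h (s - x) := by
    refine intervalIntegral.integral_congr fun s _ => ?_
    congr 2; ring
  rw [h3, resKer, indicator_of_mem (show (0 : ℝ) ∈ Iic x from hx.1), resFun]
  ext k i
  simp only [Matrix.conjTranspose_apply, Matrix.neg_apply, Matrix.add_apply, Matrix.of_apply,
    star_neg, star_add, sub_zero]
  rw [← hh.inner_resRow_convRows x 0 x hx, ← hh.inner_convRows_resRow_zero]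
  congr 2
  · rw [← Matrix.conjTranspose_apply, hh.symm, neg_neg]
  · exact inner_conj_symm _ _

end IsKreinKernel

end KreinSystem

/-! ### The Krein system for the exponential transforms of the resolvent kernel -/

section KreinSystem

variable {n : Type} [Fintype n] [DecidableEq n] {h : ℝ → Mat n}

theorem intervalIntegrable_of_integrable_vol01 {E : Type*} [NormedAddCommGroup E] {f : ℝ → E}
    (hf : Integrable f vol01) {a b : ℝ} (ha : a ∈ Icc (0 : ℝ) 1) (hb : b ∈ Icc (0 : ℝ) 1) :
    IntervalIntegrable f volume a b := by
  have h1 : IntegrableOn f (Icc (0 : ℝ) 1) volume := by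
    rw [integrableOn_Icc_iff_integrableOn_Ioo]; exact hf
  exact (intervalIntegrable_iff_integrableOn_Icc_of_le zero_le_one).2 h1 |>.mono_set (by
    rw [uIcc_of_le zero_le_one]; exact uIcc_subset_Icc ha hb)

theorem intervalIntegral_entry {F : ℝ → Mat n} {a b : ℝ} (hF : IntervalIntegrable F volume a b)
    (k i : n) : (∫ t in a..b, F t) k i = ∫ t in a..b, F t k i :=
  ((entryCLM k i).intervalIntegral_comp_comm hF).symm

/-- The vector function `t ↦ e^{2izt} e_i`. -/
def expVec (z : ℂ) (i : n) : L2v n :=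
  l2Class vol01 fun t : ℝ => Complex.exp (2 * Complex.I * z * t) • EuclideanSpace.single i (1 : ℂ)

theorem memLp_expVec (z : ℂ) (i : n) : MemLp (fun t : ℝ =>
    Complex.exp (2 * Complex.I * z * t) • (EuclideanSpace.single i (1 : ℂ) : EuclideanSpace ℂ n))
    2 vol01 :=
  memLp_of_continuous (by fun_prop)

/-- `e^{2izx} + ∫₀ˣ R(x,s) e^{2izs} ds`. -/
def kreinP (h : ℝ → Mat n) (z : ℂ) (x : ℝ) : Mat n :=
  Complex.exp (2 * Complex.I * z * x) • 1 +
    ∫ s in (0 : ℝ)..x, Complex.exp (2 * Complex.I * z * s) • resKer h x x s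

/-- `1 + ∫₀ˣ S(x,s) e^{2izs} ds`. -/
def kreinPs (h : ℝ → Mat n) (z : ℂ) (x : ℝ) : Mat n :=
  1 + ∫ s in (0 : ℝ)..x, Complex.exp (2 * Complex.I * z * s) • resKer h x 0 s

namespace IsKreinKernel

theorem integrable_exp_smul_resKer (hh : IsKreinKernel h) (x y : ℝ) (z : ℂ) :
    Integrable (fun s : ℝ => Complex.exp (2 * Complex.I * z * s) • resKer h x y s) vol01 := by
  have h1 : Measurable fun s : ℝ => Complex.exp (2 * Complex.I * z * s) := by fun_prop
  obtain ⟨C, hC⟩ := (isCompact_Icc (a := (0 : ℝ)) (b := 1)).exists_bound_of_continuousOn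
    (f := fun s : ℝ => Complex.exp (2 * Complex.I * z * s)) (by fun_prop)
  exact (memLp_smul_of_bounded h1 (fun s hs => hC s (Ioo_subset_Icc_self hs))
    (hh.memLp_resKer x y)).integrable one_le_two

theorem inner_resRow_expVec (hh : IsKreinKernel h) {x : ℝ} (hx : x ∈ Icc (0 : ℝ) 1) (y : ℝ) (z : ℂ)
    (k i : n) : ⟪resRow h x y k, expVec z i⟫_ℂ =
      (∫ s in (0 : ℝ)..x, Complex.exp (2 * Complex.I * z * s) • resKer h x y s) k i := by
  rw [intervalIntegral_entry (intervalIntegrable_of_integrable_vol01 (hh.integrable_exp_smul_resKer x y z)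
    (by simp) hx), ← hh.rowClass_resKer, rowClass, expVec,
    inner_l2Class (memLp_conjRow (hh.memLp_resKer x y) k) (memLp_expVec z i),
    ← integral_vol01_indicator _ hx]
  refine integral_congr_ae (Eventually.of_forall fun s => ?_)
  simp only [inner_smul_right, inner_conjRow, act_apply]
  by_cases hs : s ≤ x <;> simp [indicator, hs, resKer]

theorem kreinP_apply (hh : IsKreinKernel h) {x : ℝ} (hx : x ∈ Icc (0 : ℝ) 1) (z : ℂ) (k i : n) :
    kreinP h z x k i = Complex.exp (2 * Complex.I * z * x) * (1 : Mat n) k i +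
      ⟪resRow h x x k, expVec z i⟫_ℂ := by
  rw [hh.inner_resRow_expVec hx]; rfl

theorem kreinPs_apply (hh : IsKreinKernel h) {x : ℝ} (hx : x ∈ Icc (0 : ℝ) 1) (z : ℂ) (k i : n) :
    kreinPs h z x k i = (1 : Mat n) k i + ⟪resRow h x 0 k, expVec z i⟫_ℂ := by
  rw [hh.inner_resRow_expVec hx]; rfl

theorem continuousOn_kreinP (hh : IsKreinKernel h) (z : ℂ) :
    ContinuousOn (kreinP h z) (Icc 0 1) := by
  refine continuousOn_pi.2 fun k => continuousOn_pi.2 fun i => ?_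
  refine ContinuousOn.congr (f := fun x : ℝ => Complex.exp (2 * Complex.I * z * x) *
    (1 : Mat n) k i + ⟪resRow h x x k, expVec z i⟫_ℂ) ?_ fun x hx => hh.kreinP_apply hx z k i
  have := (continuous_pi_iff.1 hh.continuous_diag k).inner (𝕜 := ℂ)
    (continuous_const (y := expVec z i))
  refine Continuous.continuousOn (Continuous.add (by fun_prop) this)

theorem continuousOn_kreinPs (hh : IsKreinKernel h) (z : ℂ) :
    ContinuousOn (kreinPs h z) (Icc 0 1) := by
  refine continuousOn_pi.2 fun k => continuousOn_pi.2 fun i => ?_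
  refine ContinuousOn.congr (f := fun x : ℝ =>
    (1 : Mat n) k i + ⟪resRow h x 0 k, expVec z i⟫_ℂ) ?_ fun x hx => hh.kreinPs_apply hx z k i
  have h2 : Continuous fun x : ℝ => (x, (0 : ℝ)) := by fun_prop
  have h3 := (hh.continuous_resRow k).comp h2
  simp only [Function.comp_def] at h3
  have := h3.inner (𝕜 := ℂ) (continuous_const (y := expVec z i))
  refine Continuous.continuousOn (Continuous.add (by fun_prop) this)

theorem memLp_boundary (hh : IsKreinKernel h) : MemLp (fun y => resKer h y y 0) 2 vol01 := by
  refine memLp_of_entries fun i k => ?_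
  have h1 : MemLp (fun y => boundaryCol h k y i) 2 vol01 :=
    (Lp.memLp (boundaryCol h k)).of_le
      ((EuclideanSpace.proj i : EuclideanSpace ℂ n →L[ℂ] ℂ).continuous.comp_aestronglyMeasurable
        (Lp.memLp (boundaryCol h k)).1)
      (Eventually.of_forall fun y => PiLp.norm_apply_le _ _)
  refine h1.ae_eq ?_
  filter_upwards [hh.coeFn_boundaryCol k] with y hy
  rw [hy]

theorem _root_.DiracInverse.memLp_of_continuousOn {E : Type*} [NormedAddCommGroup E] {f : ℝ → E}
    (hf : ContinuousOn f (Icc 0 1)) : MemLp f 2 vol01 := by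
  obtain ⟨C, hC⟩ := (isCompact_Icc (a := (0 : ℝ)) (b := 1)).exists_bound_of_continuousOn hf
  refine MemLp.of_bound ((hf.mono Ioo_subset_Icc_self).aestronglyMeasurable measurableSet_Ioo) C ?_
  filter_upwards [ae_vol01_mem] with x hx using hC x (Ioo_subset_Icc_self hx)

/-- For g(t) = e^{2izt}e_i the bracket in `inner_resRow_zero` is a column of P(y). -/
theorem kreinPs_eq (hh : IsKreinKernel h) {x : ℝ} (hx : x ∈ Icc (0 : ℝ) 1) (z : ℂ) :
    kreinPs h z x = 1 + ∫ y in (0 : ℝ)..x, (resKer h y y 0)ᴴ * kreinP h z y := by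
  have hi : Integrable (fun y => (resKer h y y 0)ᴴ * kreinP h z y) vol01 :=
    integrable_mul_of_memLp (memLp_conjTranspose hh.memLp_boundary)
      (memLp_of_continuousOn (hh.continuousOn_kreinP z))
  ext k i
  rw [hh.kreinPs_apply hx, hh.inner_resRow_zero hx, Matrix.add_apply, intervalIntegral_entry
    (intervalIntegrable_of_integrable_vol01 hi (by simp) hx)]
  congr 1
  rw [← integral_vol01_indicator _ hx, ← integral_vol01_indicator _ hx]
  apply integral_congr_ae
  filter_upwards [ae_vol01_mem, coeFn_l2Class (memLp_expVec (n := n) z i)] with y hy h1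
  by_cases hyx : y ≤ x
  · simp only [indicator, mem_Iic, hyx, if_true, Matrix.mul_apply]
    refine Finset.sum_congr rfl fun j _ => ?_
    rw [hh.kreinP_apply (Ioo_subset_Icc_self hy), expVec, h1]
    simp [Matrix.one_apply]
  · simp [indicator, hyx]

/-- Under s ↦ x - s the parameters y = 0 and y = x are exchanged and a factor e^{-2izx} comes out.
Passing to the reflected kernel and to -z therefore exchanges P and P_*. -/
theorem kreinPs_reflect (hh : IsKreinKernel h) {x : ℝ} (hx : x ∈ Icc (0 : ℝ) 1) (z : ℂ) :
    kreinPs (fun x => h (-x)) (-z) x = Complex.exp (-(2 * Complex.I * z * x)) • kreinP h z x := by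
  rw [kreinPs, kreinP, smul_add, smul_smul, ← Complex.exp_add, neg_add_cancel, Complex.exp_zero,
    one_smul, hh.intervalIntegral_resKer_reflect hx 0
      fun A s => Complex.exp (2 * Complex.I * (-z) * s) • A,
    ← intervalIntegral.integral_smul]
  congr 1
  refine intervalIntegral.integral_congr fun s _ => ?_
  simp only [smul_smul, ← Complex.exp_add, sub_zero]
  congr 2
  push_cast
  ring

theorem kreinP_reflect (hh : IsKreinKernel h) {x : ℝ} (hx : x ∈ Icc (0 : ℝ) 1) (z : ℂ) :
    kreinP (fun x => h (-x)) (-z) x = Complex.exp (-(2 * Complex.I * z * x)) • kreinPs h z x := by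
  rw [kreinPs, kreinP, smul_add, hh.intervalIntegral_resKer_reflect hx x
      fun A s => Complex.exp (2 * Complex.I * (-z) * s) • A,
    ← intervalIntegral.integral_smul]
  congr 1
  · congr 2; ring
  refine intervalIntegral.integral_congr fun s _ => ?_
  simp only [smul_smul, ← Complex.exp_add, sub_self]
  congr 2
  push_cast
  ring

/-- This is the equation for P_* written for the reflected kernel at -z; the coefficient R(y,0)*
becomes R(y,0) by `conjTranspose_resKer_reflect`. -/
theorem kreinP_eq (hh : IsKreinKernel h) {x : ℝ} (hx : x ∈ Icc (0 : ℝ) 1) (z : ℂ) :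
    Complex.exp (-(2 * Complex.I * z * x)) • kreinP h z x =
      1 + ∫ y in (0 : ℝ)..x,
        resKer h y y 0 * (Complex.exp (-(2 * Complex.I * z * y)) • kreinPs h z y) := by
  rw [← hh.kreinPs_reflect hx, hh.reflect.kreinPs_eq hx]
  congr 1
  refine intervalIntegral.integral_congr fun y hy => ?_
  rw [uIcc_of_le hx.1] at hy
  have hy' : y ∈ Icc (0 : ℝ) 1 := ⟨hy.1, hy.2.trans hx.2⟩
  simp only [hh.conjTranspose_resKer_reflect hy', hh.kreinP_reflect hy']

end IsKreinKernel

end KreinSystem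

/-! ### Linear Volterra equations -/

section Volterra

variable {n : Type} [Fintype n] [DecidableEq n]

/-- The rows of the kernel `-1_{t ≤ x} A(t)`. -/
def volRows (A : ℝ → Mat n) (x : ℝ) (k : n) : L2v n := -(cut x (rowClass A k))

theorem continuous_volRows (A : ℝ → Mat n) : Continuous (volRows A) :=
  continuous_pi fun _ => (continuous_cut_apply continuous_id continuous_const).neg

variable {A : ℝ → Mat n}

theorem rowFun_volRows (hA : MemLp A 2 vol01) {x : ℝ} (hx : x ∈ Icc (0 : ℝ) 1) (f : L2v n) :
    rowFun (volRows A) f x = -∫ t in (0 : ℝ)..x, act (A t) (f t) := by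
  ext k
  have hA' : MemLp ((Iic x).indicator A) 2 vol01 := hA.indicator measurableSet_Iic
  have e : ∫ t, act ((Iic x).indicator A t) (f t) ∂vol01 = ∫ t in (0 : ℝ)..x, act (A t) (f t) := by
    rw [← integral_vol01_indicator (fun t => act (A t) (f t)) hx]
    refine integral_congr_ae (Eventually.of_forall fun t => ?_)
    by_cases ht : t ≤ x
    · simp [indicator, ht]
    · simp only [indicator, mem_Iic, ht, if_false]
      ext k; simp
  rw [rowFun_apply, volRows, inner_neg_left, cut_rowClass hA, inner_rowClass_left hA', e]
  rfl

theorem isUnit_one_add_volRows (A : ℝ → Mat n) : IsUnit (1 + rowOp (volRows A)) :=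
  isUnit_one_add_of_isLower (isLower_rowOp (continuous_volRows A) fun x _ k => by
    rw [volRows, map_neg, cut_apply_cut_apply, min_self]) (rowBdd_rowOp (continuous_volRows A))

theorem intervalIntegral_congr_vol01 {E : Type*} [NormedAddCommGroup E] [NormedSpace ℝ E]
    {f g : ℝ → E} (h : f =ᵐ[vol01] g) {x : ℝ} (hx : x ∈ Icc (0 : ℝ) 1) :
    ∫ t in (0 : ℝ)..x, f t = ∫ t in (0 : ℝ)..x, g t := by
  rw [← integral_vol01_indicator _ hx, ← integral_vol01_indicator _ hx]
  apply integral_congr_ae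
  filter_upwards [h] with t ht
  by_cases h1 : t ≤ x <;> simp [indicator, h1, ht]

/-- Invertibility of a Volterra perturbation of 1 gives a solution in L₂. Substituting that class
into the integral produces a continuous function which agrees with it almost everywhere and
satisfies the equation at every point. -/
theorem exists_volterra_solution (hA : MemLp A 2 vol01) (c : EuclideanSpace ℂ n) :
    ∃ u : ℝ → EuclideanSpace ℂ n, Continuous u ∧ ∀ x ∈ Icc (0 : ℝ) 1,
      u x = c + ∫ t in (0 : ℝ)..x, act (A t) (u t) := by
  obtain ⟨f, hf⟩ : ∃ f : L2v n, (1 + rowOp (volRows A)) f = l2Class vol01 fun _ => c := by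
    refine ⟨Ring.inverse (1 + rowOp (volRows A)) (l2Class vol01 fun _ => c), ?_⟩
    rw [← mul_apply_eq_comp, Ring.mul_inverse_cancel _ (isUnit_one_add_volRows A)]
    rfl
  refine ⟨fun x => c - rowFun (volRows A) f x,
    continuous_const.sub (continuous_rowFun (continuous_volRows A) f), fun x hx => ?_⟩
  have hfe : f =ᵐ[vol01] fun x => c - rowFun (volRows A) f x := by
    have e : f + rowOp (volRows A) f = l2Class vol01 fun _ => c := hf
    filter_upwards [Lp.coeFn_add f (rowOp (volRows A) f),
      coeFn_l2Class (memLp_const (μ := vol01) (p := 2) c),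
      coeFn_rowOp (continuous_volRows A) f] with t h1 h2 h3
    rw [e, h2, Pi.add_apply, h3] at h1
    rw [h1]; abel
  beta_reduce
  rw [rowFun_volRows hA hx, sub_neg_eq_add]
  congr 1
  apply intervalIntegral_congr_vol01 _ hx
  filter_upwards [hfe] with t ht
  rw [ht]

theorem volterra_unique (hA : MemLp A 2 vol01) {w : ℝ → EuclideanSpace ℂ n} (hw : MemLp w 2 vol01)
    (he : ∀ x ∈ Icc (0 : ℝ) 1, w x = ∫ t in (0 : ℝ)..x, act (A t) (w t)) :
    ∀ x ∈ Icc (0 : ℝ) 1, w x = 0 := by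
  have h0 : l2Class vol01 w = 0 := by
    have h1 : (1 + rowOp (volRows A)) (l2Class vol01 w) = 0 := by
      change l2Class vol01 w + rowOp (volRows A) (l2Class vol01 w) = 0
      apply Lp.ext
      filter_upwards [ae_vol01_mem, coeFn_l2Class hw, Lp.coeFn_zero (EuclideanSpace ℂ n) 2 vol01,
        Lp.coeFn_add (l2Class vol01 w) (rowOp (volRows A) (l2Class vol01 w)),
        coeFn_rowOp (continuous_volRows A) (l2Class vol01 w)] with x hx h1 h2 h3 h4
      have hx' := Ioo_subset_Icc_self hx
      rw [h3, Pi.add_apply, h1, h4, rowFun_volRows hA hx', he x hx', h2,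
        intervalIntegral_congr_vol01 (f := fun t => act (A t) (l2Class vol01 w t))
          (g := fun t => act (A t) (w t)) _ hx', add_neg_cancel]
      · rfl
      · filter_upwards [coeFn_l2Class hw] with t ht
        rw [ht]
    have h2 := congrArg (Ring.inverse (1 + rowOp (volRows A)) : L2v n →L[ℂ] L2v n) h1
    rw [← mul_apply_eq_comp, Ring.inverse_mul_cancel _ (isUnit_one_add_volRows A), map_zero] at h2
    exact h2
  have hw0 : w =ᵐ[vol01] fun _ => 0 := by
    filter_upwards [coeFn_l2Class hw, Lp.coeFn_zero (EuclideanSpace ℂ n) 2 vol01] with x h1 h2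
    rw [← h1, h0, h2]; rfl
  intro x hx
  rw [he x hx, intervalIntegral_congr_vol01 (g := fun _ => 0) _ hx]
  · simp
  · filter_upwards [hw0] with t ht
    rw [ht, map_zero]

end Volterra

/-! ### The product rule for integrals -/

/-- This is the product rule for e^{cx} times a primitive. As γ is only integrable, the primitive
need not be differentiable everywhere, and the rule is obtained in integrated form from Fubini. -/
theorem exp_smul_primitive {E : Type*} [NormedAddCommGroup E] [NormedSpace ℂ E] [CompleteSpace E]
    {γ : ℝ → E} (hγ : Integrable γ vol01) (g₀ : E) (c : ℂ) {x : ℝ} (hx : x ∈ Icc (0 : ℝ) 1) :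
    Complex.exp (c * x) • (g₀ + ∫ t in (0 : ℝ)..x, γ t) = g₀ + ∫ y in (0 : ℝ)..x,
      (c • (Complex.exp (c * y) • (g₀ + ∫ t in (0 : ℝ)..y, γ t)) + Complex.exp (c * y) • γ y) := by
  have hii : ∀ a ∈ Icc (0 : ℝ) 1, ∀ b ∈ Icc (0 : ℝ) 1, IntervalIntegrable γ volume a b :=
    fun a ha b hb => intervalIntegrable_of_integrable_vol01 hγ ha hb
  have h01 : (0 : ℝ) ∈ Icc (0 : ℝ) 1 := by simp
  have hsub : uIcc 0 x ⊆ Icc (0 : ℝ) 1 := by rw [uIcc_of_le hx.1]; exact Icc_subset_Icc_right hx.2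
  have hexp : ∀ a b : ℝ, ∫ y in a..b, c * Complex.exp (c * y) =
      Complex.exp (c * b) - Complex.exp (c * a) := by
    intro a b
    refine intervalIntegral.integral_eq_sub_of_hasDerivAt (f := fun y : ℝ => Complex.exp (c * y))
      (fun y _ => ?_) (Continuous.intervalIntegrable (by fun_prop) _ _)
    have h1 : HasDerivAt (fun y : ℝ => c * (y : ℂ)) (c * 1) y :=
      (Complex.ofRealCLM.hasDerivAt (x := y)).const_mul c
    have := h1.cexp
    rwa [mul_one, mul_comm] at this
  have hprim : ContinuousOn (fun y => ∫ t in (0 : ℝ)..y, γ t) (Icc 0 1) := by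
    have := intervalIntegral.continuousOn_primitive_interval (f := γ) (a := (0 : ℝ)) (b := 1)
      (μ := volume) (by rw [uIcc_of_le zero_le_one,
        ← intervalIntegrable_iff_integrableOn_Icc_of_le zero_le_one]; exact hii 0 h01 1 (by simp))
    rwa [uIcc_of_le zero_le_one] at this
  have hA : IntervalIntegrable (fun y : ℝ => (c * Complex.exp (c * y)) • g₀) volume 0 x :=
    Continuous.intervalIntegrable (by fun_prop) _ _
  have hB : IntervalIntegrable (fun y : ℝ => (c * Complex.exp (c * y)) • ∫ t in (0 : ℝ)..y, γ t)
      volume 0 x := by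
    refine ContinuousOn.intervalIntegrable (ContinuousOn.smul (by fun_prop) (hprim.mono hsub))
  have hC : IntervalIntegrable (fun y : ℝ => Complex.exp (c * y) • γ y) volume 0 x :=
    (hii 0 h01 x hx).continuousOn_smul (by fun_prop)
  -- Exchange of the order of integration over the triangle t ≤ y ≤ x; the inner integral of c
  -- e^{cy} over (t,x) is elementary.
  have hswap : ∫ y in (0 : ℝ)..x, (c * Complex.exp (c * y)) • ∫ t in (0 : ℝ)..y, γ t =
      ∫ t in (0 : ℝ)..x, (Complex.exp (c * x) - Complex.exp (c * t)) • γ t := by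
    set S : Set (ℝ × ℝ) := {p | p.2 ≤ p.1 ∧ p.1 ≤ x} with hS
    have hSm : MeasurableSet S :=
      (measurableSet_le measurable_snd measurable_fst).inter
        (measurableSet_le measurable_fst measurable_const)
    have hφ : Integrable (fun y : ℝ => c * Complex.exp (c * y)) vol01 :=
      (memLp_of_continuous (by fun_prop)).integrable one_le_two
    have hprod : Integrable (Function.uncurry fun y t : ℝ =>
        S.indicator (fun p : ℝ × ℝ => (c * Complex.exp (c * p.1)) • γ p.2) (y, t))
        (vol01.prod vol01) := (hφ.smul_prod hγ).indicator hSm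
    have hsw := integral_integral_swap hprod
    have hl : ∫ y in (0 : ℝ)..x, (c * Complex.exp (c * y)) • ∫ t in (0 : ℝ)..y, γ t =
        ∫ y, ∫ t, S.indicator (fun p : ℝ × ℝ => (c * Complex.exp (c * p.1)) • γ p.2) (y, t)
          ∂vol01 ∂vol01 := by
      rw [← integral_vol01_indicator _ hx]
      apply integral_congr_ae
      filter_upwards [ae_vol01_mem] with y hy
      by_cases hyx : y ≤ x
      · rw [indicator_of_mem (show y ∈ Iic x from hyx),
          ← integral_vol01_indicator _ (Ioo_subset_Icc_self hy), ← integral_smul]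
        refine integral_congr_ae (Eventually.of_forall fun t => ?_)
        by_cases hty : t ≤ y <;> simp [indicator, hS, hyx, hty]
      · simp [indicator, hS, hyx]
    have hr : ∫ t in (0 : ℝ)..x, (Complex.exp (c * x) - Complex.exp (c * t)) • γ t =
        ∫ t, ∫ y, S.indicator (fun p : ℝ × ℝ => (c * Complex.exp (c * p.1)) • γ p.2) (y, t)
          ∂vol01 ∂vol01 := by
      rw [← integral_vol01_indicator _ hx]
      apply integral_congr_ae
      filter_upwards [ae_vol01_mem] with t ht
      by_cases htx : t ≤ x
      · have e : ∀ᵐ y ∂vol01, S.indicator (fun p : ℝ × ℝ => (c * Complex.exp (c * p.1)) • γ p.2)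
            (y, t) = (Iic x).indicator (fun y : ℝ => (c * Complex.exp (c * y)) • γ t) y -
              (Iic t).indicator (fun y : ℝ => (c * Complex.exp (c * y)) • γ t) y := by
          have hne : ∀ᵐ y ∂vol01, y ≠ t := by
            refine ae_restrict_of_ae ?_
            simp [ae_iff]
          filter_upwards [hne] with y hy
          rcases lt_or_gt_of_ne hy with h | h
          · simp [indicator, hS, h.le, h.not_ge, h.le.trans htx]
          · by_cases hyx : y ≤ x <;> simp [indicator, hS, h.le, h.not_ge, hyx]
        have hi : Integrable (fun y : ℝ => (c * Complex.exp (c * y)) • γ t) vol01 :=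
          hφ.smul_const _
        rw [indicator_of_mem (show t ∈ Iic x from htx), integral_congr_ae e,
          integral_sub (hi.indicator measurableSet_Iic) (hi.indicator measurableSet_Iic),
          integral_vol01_indicator _ hx, integral_vol01_indicator _ (Ioo_subset_Icc_self ht),
          intervalIntegral.integral_smul_const, intervalIntegral.integral_smul_const, hexp, hexp,
          ← sub_smul]
        congr 1
        ring
      · have e : ∀ y, S.indicator (fun p : ℝ × ℝ => (c * Complex.exp (c * p.1)) • γ p.2)
            (y, t) = 0 := fun y => indicator_of_notMem (fun hm => htx (hm.1.trans hm.2)) _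
        simp only [e, integral_zero]
        simp [indicator, htx]
    rw [hl, hr, hsw]
  have e1 : ∀ y : ℝ, c • (Complex.exp (c * y) • (g₀ + ∫ t in (0 : ℝ)..y, γ t)) +
      Complex.exp (c * y) • γ y = (c * Complex.exp (c * y)) • g₀ +
        (c * Complex.exp (c * y)) • (∫ t in (0 : ℝ)..y, γ t) + Complex.exp (c * y) • γ y := by
    intro y; rw [smul_add, smul_add, smul_smul, smul_smul]
  simp only [e1]
  rw [intervalIntegral.integral_add (hA.add hB) hC, intervalIntegral.integral_add hA hB, hswap,
    intervalIntegral.integral_smul_const, hexp]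
  have e2 : ∫ t in (0 : ℝ)..x, (Complex.exp (c * x) - Complex.exp (c * t)) • γ t =
      Complex.exp (c * x) • (∫ t in (0 : ℝ)..x, γ t) -
        ∫ t in (0 : ℝ)..x, Complex.exp (c * t) • γ t := by
    simp only [sub_smul]
    have hD : IntervalIntegrable (fun t => Complex.exp (c * x) • γ t) volume 0 x :=
      (hii 0 h01 x hx).continuousOn_smul (by fun_prop)
    rw [intervalIntegral.integral_sub hD hC, intervalIntegral.integral_smul]
  rw [e2]
  simp only [Complex.ofReal_zero, mul_zero, Complex.exp_zero, smul_add, sub_smul, one_smul]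
  abel

/-! ### The Cauchy problem for the Dirac system -/

section Cauchy

variable {r : ℕ}

/-- A column of a matrix. -/
def mcol {m l : Type} (B : Matrix m l ℂ) (k : l) : EuclideanSpace ℂ m :=
  WithLp.toLp 2 fun i => B i k

@[simp] theorem mcol_apply {m l : Type} (B : Matrix m l ℂ) (k : l) (i : m) :
    mcol B k i = B i k := rfl

variable {m l : Type} [Fintype m] [Fintype l] [DecidableEq m] [DecidableEq l]

theorem act_mcol (A : Mat m) (B : Matrix m l ℂ) (k : l) : act A (mcol B k) = mcol (A * B) k := by
  ext i; simp [Matrix.mul_apply]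

theorem mcol_injective {B C : Matrix m l ℂ} (h : ∀ k, mcol B k = mcol C k) : B = C := by
  ext i k
  exact congrArg (fun v : EuclideanSpace ℂ m => v i) (h k)

/-- A column as a continuous linear map. -/
def mcolCLM (k : l) : Matrix m l ℂ →L[ℂ] EuclideanSpace ℂ m where
  toFun B := mcol B k
  map_add' B C := by ext i; simp
  map_smul' c B := by ext i; simp
  cont := (PiLp.continuous_toLp 2 _).comp (continuous_pi fun i => continuous_apply_apply i k)

theorem mcol_intervalIntegral {F : ℝ → Matrix m l ℂ} {a b : ℝ}
    (hF : IntervalIntegrable F volume a b) (k : l) :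
    mcol (∫ t in a..b, F t) k = ∫ t in a..b, mcol (F t) k :=
  ((mcolCLM k).intervalIntegral_comp_comm hF).symm

theorem memLp_mul_continuousOn {A : ℝ → Mat m} (hA : MemLp A 2 vol01) {B : ℝ → Matrix m l ℂ}
    (hB : ContinuousOn B (Icc 0 1)) : MemLp (fun t => A t * B t) 2 vol01 := by
  obtain ⟨C, hC⟩ := (isCompact_Icc (a := (0 : ℝ)) (b := 1)).exists_bound_of_continuousOn hB
  have hc : Continuous fun p : Mat m × Matrix m l ℂ => p.1 * p.2 :=
    continuous_fst.matrix_mul continuous_snd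
  have hBm : AEStronglyMeasurable B vol01 :=
    (hB.mono Ioo_subset_Icc_self).aestronglyMeasurable measurableSet_Ioo
  refine MemLp.of_le_mul (c := C) hA (hc.comp_aestronglyMeasurable (hA.1.prodMk hBm)) ?_
  filter_upwards [ae_vol01_mem] with x hx
  rw [mul_comm]
  refine (Matrix.l2_opNorm_mul _ _).trans ?_
  gcongr
  exact hC x (Ioo_subset_Icc_self hx)

/-- The coefficient `A` of the Dirac system written as `u' = A u`. -/
def diracCoeff (q : Potential r) (z : ℂ) (t : ℝ) : Mat (Two r) :=
  -theta r * (z • 1 - bigQ q t)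

theorem theta_mul_theta (r : ℕ) : theta r * theta r = -1 := by
  rw [theta, smul_mul_smul_comm, Matrix.fromBlocks_multiply]
  simp only [mul_one, mul_zero, add_zero, zero_add, mul_neg, neg_neg, neg_zero,
    Matrix.fromBlocks_one]
  have : (1 / Complex.I * (1 / Complex.I) : ℂ) = -1 := by
    field_simp; simp
  rw [this, neg_one_smul]

theorem memLp_bigQ (q : Potential r) : MemLp (bigQ q) 2 vol01 := by
  refine memLp_of_entries fun k i => ?_
  rcases k with k | k <;> rcases i with i | i
  · simp [bigQ]
  · simpa [bigQ] using memLp_entry (Lp.memLp q) k i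
  · exact (memLp_entry (Lp.memLp q) i k).star
  · simp [bigQ]

theorem memLp_diracCoeff (q : Potential r) (z : ℂ) : MemLp (diracCoeff q z) 2 vol01 := by
  have h1 : MemLp (fun t => z • 1 - bigQ q t) 2 vol01 := (memLp_const _).sub (memLp_bigQ q)
  refine MemLp.of_le_mul (c := ‖-theta r‖) h1
    ((continuous_const.matrix_mul continuous_id).comp_aestronglyMeasurable h1.1)
    (Eventually.of_forall fun t => norm_mul_le _ _)

theorem theta_mul_diracCoeff (q : Potential r) (z : ℂ) (t : ℝ) :
    theta r * diracCoeff q z t = z • 1 - bigQ q t := by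
  rw [diracCoeff, ← mul_assoc, mul_neg, theta_mul_theta, neg_neg, one_mul]

theorem exists_cauchySolution (q : Potential r) (z : ℂ) : ∃ u, IsCauchySolution q z u := by
  have hA := memLp_diracCoeff q z
  choose v hvc hv using fun k : Two r => exists_volterra_solution hA (mcol (1 : Mat (Two r)) k)
  set u : ℝ → Mat (Two r) := fun x => Matrix.of fun i k => v k x i with hu
  have huv : ∀ x k, mcol (u x) k = v k x := fun x k => rfl
  have huc : Continuous u := continuous_pi fun i => continuous_pi fun k =>
    (EuclideanSpace.proj i : EuclideanSpace ℂ (Two r) →L[ℂ] ℂ).continuous.comp (hvc k)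
  have hAu : MemLp (fun t => diracCoeff q z t * u t) 2 vol01 :=
    memLp_mul_continuousOn hA huc.continuousOn
  have hui : ∀ x ∈ Icc (0 : ℝ) 1, u x = 1 + ∫ t in (0 : ℝ)..x, diracCoeff q z t * u t := by
    intro x hx
    refine mcol_injective fun k => ?_
    have e : mcol (1 + ∫ t in (0 : ℝ)..x, diracCoeff q z t * u t) k =
        mcol (1 : Mat (Two r)) k + mcol (∫ t in (0 : ℝ)..x, diracCoeff q z t * u t) k :=
      (mcolCLM k).map_add _ _
    rw [e, mcol_intervalIntegral (intervalIntegrable_of_integrable_vol01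
      (hAu.integrable one_le_two) (by simp) hx), huv, hv k x hx]
    simp only [← huv, act_mcol]
  have hu0 : u 0 = 1 := by simpa using hui 0 (by simp)
  refine ⟨u, hu0, fun t => diracCoeff q z t * u t, ⟨hAu, fun x hx => ?_⟩,
    Eventually.of_forall fun x => ?_⟩
  · rw [hu0]; exact hui x hx
  · rw [← mul_assoc, theta_mul_diracCoeff, sub_mul, sub_add_cancel, smul_mul_assoc, one_mul]

theorem isCauchySolution_cauchyU (q : Potential r) (z : ℂ) :
    IsCauchySolution q z (cauchyU q z) :=
  Classical.epsilon_spec (exists_cauchySolution q z)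

theorem continuousOn_primitive_vol01 {E : Type*} [NormedAddCommGroup E] [NormedSpace ℝ E]
    {γ : ℝ → E} (hγ : Integrable γ vol01) :
    ContinuousOn (fun y => ∫ t in (0 : ℝ)..y, γ t) (Icc 0 1) := by
  have := intervalIntegral.continuousOn_primitive_interval (f := γ) (a := (0 : ℝ)) (b := 1)
    (μ := volume) (by
      rw [uIcc_of_le zero_le_one, integrableOn_Icc_iff_integrableOn_Ioo]; exact hγ)
  rwa [uIcc_of_le zero_le_one] at this

theorem continuousOn_cauchyU (q : Potential r) (z : ℂ) :
    ContinuousOn (cauchyU q z) (Icc 0 1) := by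
  obtain ⟨-, u', ⟨hm, hi⟩, -⟩ := isCauchySolution_cauchyU q z
  exact (continuousOn_const.add (continuousOn_primitive_vol01 (hm.integrable one_le_two))).congr hi

theorem cauchyU_eq (q : Potential r) (z : ℂ) {x : ℝ} (hx : x ∈ Icc (0 : ℝ) 1) :
    cauchyU q z x = 1 + ∫ t in (0 : ℝ)..x, diracCoeff q z t * cauchyU q z t := by
  obtain ⟨h0, u', ⟨hm, hi⟩, he⟩ := isCauchySolution_cauchyU q z
  rw [hi x hx, h0]
  congr 1
  refine intervalIntegral_congr_vol01 ?_ hx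
  filter_upwards [he] with t ht
  rw [diracCoeff, mul_assoc, sub_mul, smul_mul_assoc, one_mul, ← ht, add_sub_cancel_right,
    ← mul_assoc, neg_mul, theta_mul_theta, neg_neg, one_mul]

theorem theta_mul_bdryA (r : ℕ) : theta r * (bdryA r)ᴴ =
    (-Complex.I / (Real.sqrt 2 : ℂ)) • Matrix.fromRows (1 : Mat (Fin r)) 1 := by
  rw [theta, bdryA, Matrix.conjTranspose_smul, 
    Matrix.conjTranspose_fromCols_eq_fromRows_conjTranspose, Matrix.smul_mul, Matrix.mul_smul,
    smul_smul, Matrix.fromBlocks_mul_fromRows]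
  simp only [Matrix.conjTranspose_one, Matrix.conjTranspose_neg, one_mul, zero_mul, neg_zero,
    add_zero, zero_add, neg_mul, mul_neg, neg_neg]
  congr 1
  simp [div_eq_mul_inv]

theorem continuousOn_phi (q : Potential r) (z : ℂ) : ContinuousOn (phi q z) (Icc 0 1) := by
  have hc : Continuous fun B : Mat (Two r) => B * theta r * (bdryA r)ᴴ :=
    (continuous_id.matrix_mul continuous_const).matrix_mul continuous_const
  exact hc.comp_continuousOn (continuousOn_cauchyU q z)

/-- The evaluation of matrices at a vector. -/
def actCLM (v : EuclideanSpace ℂ m) : Mat m →L[ℂ] EuclideanSpace ℂ m :=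
  (ContinuousLinearMap.apply ℂ (EuclideanSpace ℂ m) v).comp
    (LinearMap.toContinuousLinearMap
      (Matrix.toEuclideanCLM (n := m) (𝕜 := ℂ)).toAlgEquiv.toLinearMap)

theorem actCLM_apply (v : EuclideanSpace ℂ m) (B : Mat m) : actCLM v B = act B v := rfl

theorem phi_eq (q : Potential r) (z : ℂ) {x : ℝ} (hx : x ∈ Icc (0 : ℝ) 1) (k : Fin r) :
    mcol (phi q z x) k = mcol (theta r * (bdryA r)ᴴ) k +
      ∫ t in (0 : ℝ)..x, act (diracCoeff q z t) (mcol (phi q z t) k) := by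
  set c := mcol (theta r * (bdryA r)ᴴ) k with hc
  set L := actCLM c with hL
  have hLp : ∀ t, L (cauchyU q z t) = mcol (phi q z t) k := by
    intro t
    rw [hL, actCLM_apply, hc, act_mcol, phi, Matrix.mul_assoc]
  have hi : IntervalIntegrable (fun t => diracCoeff q z t * cauchyU q z t) volume 0 x :=
    intervalIntegrable_of_integrable_vol01 ((memLp_mul_continuousOn (memLp_diracCoeff q z)
      (continuousOn_cauchyU q z)).integrable one_le_two) (by simp) hx
  rw [← hLp, cauchyU_eq q z hx, map_add, ← L.intervalIntegral_comp_comm hi]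
  congr 1
  · rw [hL, actCLM_apply, act, map_one]; rfl
  · refine intervalIntegral.integral_congr fun t _ => ?_
    simp only [← hLp, hL, actCLM_apply]
    rw [act, map_mul]; rfl

theorem phi_unique (q : Potential r) (z : ℂ) {ψ : ℝ → Matrix (Two r) (Fin r) ℂ}
    (hψ : ContinuousOn ψ (Icc 0 1))
    (he : ∀ x ∈ Icc (0 : ℝ) 1, ψ x = theta r * (bdryA r)ᴴ +
      ∫ t in (0 : ℝ)..x, diracCoeff q z t * ψ t) :
    ∀ x ∈ Icc (0 : ℝ) 1, phi q z x = ψ x := by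
  intro x hx
  refine mcol_injective fun k => ?_
  have hc1 : ContinuousOn (fun x => mcol (phi q z x) k) (Icc 0 1) :=
    (mcolCLM k).continuous.comp_continuousOn (continuousOn_phi q z)
  have hc2 : ContinuousOn (fun x => mcol (ψ x) k) (Icc 0 1) :=
    (mcolCLM k).continuous.comp_continuousOn hψ
  have hA := memLp_diracCoeff q z
  rw [← sub_eq_zero]
  refine volterra_unique hA (w := fun x => mcol (phi q z x) k - mcol (ψ x) k)
    (memLp_of_continuousOn (hc1.sub hc2)) (fun y hy => ?_) x hx
  have hi : IntervalIntegrable (fun t => diracCoeff q z t * ψ t) volume 0 y :=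
    intervalIntegrable_of_integrable_vol01 ((memLp_mul_continuousOn hA hψ).integrable one_le_two)
      (by simp) hy
  have e2 : mcol (ψ y) k = mcol (theta r * (bdryA r)ᴴ) k +
      ∫ t in (0 : ℝ)..y, act (diracCoeff q z t) (mcol (ψ t) k) := by
    rw [he y hy]
    simp only [act_mcol, ← mcol_intervalIntegral hi]
    exact (mcolCLM k).map_add _ _
  rw [phi_eq q z hy, e2, add_sub_add_left_eq_sub, ← intervalIntegral.integral_sub]
  · simp only [map_sub]
  · exact intervalIntegrable_of_integrable_vol01 (integrable_act hA (memLp_of_continuousOn hc1))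
      (by simp) hy
  · exact intervalIntegrable_of_integrable_vol01 (integrable_act hA (memLp_of_continuousOn hc2))
      (by simp) hy

theorem diracCoeff_mul_fromRows (q : Potential r) (z : ℂ) (t : ℝ) (A B : Mat (Fin r)) :
    diracCoeff q z t * Matrix.fromRows A B =
      Matrix.fromRows ((Complex.I * z) • A - Complex.I • (q t * B))
        (Complex.I • ((q t)ᴴ * A) - (Complex.I * z) • B) := by
  have h1 : z • (1 : Mat (Two r)) - bigQ q t =
      Matrix.fromBlocks (z • 1) (-(q t)) (-(q t)ᴴ) (z • 1) := by
    rw [← Matrix.fromBlocks_one, Matrix.fromBlocks_smul, bigQ, sub_eq_add_neg,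
      Matrix.fromBlocks_neg, Matrix.fromBlocks_add]
    simp
  have hI : (1 / Complex.I : ℂ) = -Complex.I := by simp
  rw [diracCoeff, h1, theta, hI, Matrix.mul_assoc, Matrix.fromBlocks_mul_fromRows, Matrix.neg_mul,
    Matrix.smul_mul, Matrix.fromBlocks_mul_fromRows, neg_smul, neg_neg]
  ext i k
  rcases i with i | i <;> simp <;> ring

/-- A pair of solutions of the two block equations gives `φ_q`. -/
theorem phi_eq_of_system (q : Potential r) (z : ℂ) {ρ ψ₁ ψ₂ : ℝ → Mat (Fin r)}
    (hq : q =ᵐ[vol01] fun t => Complex.I • ρ t) (hρ : MemLp ρ 2 vol01)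
    (h₁ : ContinuousOn ψ₁ (Icc 0 1)) (h₂ : ContinuousOn ψ₂ (Icc 0 1))
    (e₁ : ∀ x ∈ Icc (0 : ℝ) 1, ψ₁ x = 1 + ∫ t in (0 : ℝ)..x,
      ((Complex.I * z) • ψ₁ t + ρ t * ψ₂ t))
    (e₂ : ∀ x ∈ Icc (0 : ℝ) 1, ψ₂ x = 1 + ∫ t in (0 : ℝ)..x,
      (-(Complex.I * z) • ψ₂ t + (ρ t)ᴴ * ψ₁ t)) :
    ∀ x ∈ Icc (0 : ℝ) 1, phi q z x =
      (-Complex.I / (Real.sqrt 2 : ℂ)) • Matrix.fromRows (ψ₁ x) (ψ₂ x) := by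
  set c : ℂ := -Complex.I / (Real.sqrt 2 : ℂ) with hc
  let J : (Mat (Fin r) × Mat (Fin r)) →L[ℂ] Matrix (Two r) (Fin r) ℂ :=
    LinearMap.toContinuousLinearMap
      { toFun := fun p => c • Matrix.fromRows p.1 p.2
        map_add' := fun p p' => by
          ext i k; rcases i with i | i <;> simp [mul_add]
        map_smul' := fun d p => by
          ext i k; rcases i with i | i <;> simp <;> ring }
  have hJ : ∀ A B, c • Matrix.fromRows A B = J (A, B) := fun A B => rfl
  have hc1 : ContinuousOn (fun x => c • Matrix.fromRows (ψ₁ x) (ψ₂ x)) (Icc 0 1) :=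
    J.continuous.comp_continuousOn (h₁.prodMk h₂)
  refine phi_unique q z hc1 fun x hx => ?_
  have i1 : IntervalIntegrable (fun t => (Complex.I * z) • ψ₁ t + ρ t * ψ₂ t) volume 0 x :=
    intervalIntegrable_of_integrable_vol01
      ((((memLp_of_continuousOn h₁).const_smul (Complex.I * z)).add
        (memLp_mul_continuousOn hρ h₂)).integrable one_le_two) (by simp) hx
  have i2 : IntervalIntegrable (fun t => -(Complex.I * z) • ψ₂ t + (ρ t)ᴴ * ψ₁ t) volume 0 x :=
    intervalIntegrable_of_integrable_vol01
      ((((memLp_of_continuousOn h₂).const_smul (-(Complex.I * z))).add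
        (memLp_mul_continuousOn (memLp_conjTranspose hρ) h₁)).integrable one_le_two) (by simp) hx
  have e : ∫ t in (0 : ℝ)..x, diracCoeff q z t * (c • Matrix.fromRows (ψ₁ t) (ψ₂ t)) =
      J (∫ t in (0 : ℝ)..x, ((Complex.I * z) • ψ₁ t + ρ t * ψ₂ t),
        ∫ t in (0 : ℝ)..x, (-(Complex.I * z) • ψ₂ t + (ρ t)ᴴ * ψ₁ t)) := by
    have : ∀ A B, J (A, B) = (J.comp (ContinuousLinearMap.inl ℂ _ _)) A +
        (J.comp (ContinuousLinearMap.inr ℂ _ _)) B := by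
      intro A B
      simp [← map_add]
    rw [this, ← ContinuousLinearMap.intervalIntegral_comp_comm _ i1,
      ← ContinuousLinearMap.intervalIntegral_comp_comm _ i2, ← intervalIntegral.integral_add]
    · simp only [← this]
      refine intervalIntegral_congr_vol01 ?_ hx
      filter_upwards [hq] with t ht
      -- With q = iρ the off-diagonal coefficients become -iq = ρ and iq* = ρ*.
      rw [Matrix.mul_smul, diracCoeff_mul_fromRows, ht, hJ]
      congr 2
      · rw [smul_mul_assoc, smul_smul, Complex.I_mul_I, neg_one_smul, sub_neg_eq_add]
      · rw [Matrix.conjTranspose_smul, smul_mul_assoc, smul_smul, sub_eq_add_neg, add_comm,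
          neg_smul]
        simp
    · exact ⟨ContinuousLinearMap.integrable_comp _ i1.1, ContinuousLinearMap.integrable_comp _ i1.2⟩
    · exact ⟨ContinuousLinearMap.integrable_comp _ i2.1, ContinuousLinearMap.integrable_comp _ i2.2⟩
  rw [e, theta_mul_bdryA, ← hc, hJ, hJ, ← map_add, Prod.mk_add_mk, ← e₁ x hx, ← e₂ x hx]

theorem phi_zero_eq (z : ℂ) {x : ℝ} (hx : x ∈ Icc (0 : ℝ) 1) :
    phi (0 : Potential r) z x = (-Complex.I / (Real.sqrt 2 : ℂ)) •
      Matrix.fromRows (Complex.exp (Complex.I * z * x) • (1 : Mat (Fin r)))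
        (Complex.exp (-(Complex.I * z) * x) • 1) := by
  refine phi_eq_of_system 0 z (ρ := fun _ => 0)
    (ψ₁ := fun x : ℝ => Complex.exp (Complex.I * z * x) • (1 : Mat (Fin r)))
    (ψ₂ := fun x : ℝ => Complex.exp (-(Complex.I * z) * x) • (1 : Mat (Fin r)))
    ?_ (memLp_const 0) (by fun_prop) (by fun_prop) (fun x hx => ?_) (fun x hx => ?_) x hx
  · filter_upwards [Lp.coeFn_zero (Mat (Fin r)) 2 vol01] with t ht
    rw [ht, Pi.zero_apply, smul_zero]
  · have := exp_smul_primitive (integrable_zero ℝ (Mat (Fin r)) vol01) 1 (Complex.I * z) hx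
    simpa using this
  · have := exp_smul_primitive (integrable_zero ℝ (Mat (Fin r)) vol01) 1 (-(Complex.I * z)) hx
    simpa using this

end Cauchy

/-! ### Kernels with square-integrable sections -/

section Sections

theorem measurableSet_omegaMinus : MeasurableSet OmegaMinus := by
  have : OmegaMinus = {p : ℝ × ℝ | 0 ≤ p.1} ∩ ({p | p.1 < p.2} ∩ {p | p.2 ≤ 1}) := rfl
  rw [this]
  exact (measurableSet_le measurable_const measurable_fst).inter
    ((measurableSet_lt measurable_fst measurable_snd).inter
      (measurableSet_le measurable_snd measurable_const))

variable {E F : Type*} [NormedAddCommGroup E] [NormedAddCommGroup F]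

/-- A measurable kernel whose sections are in `L₂(0,1)` and depend continuously on the fixed
variable. -/
structure HasL2Sections (g : ℝ → ℝ → E) : Prop where
  stronglyMeasurable : StronglyMeasurable fun p : ℝ × ℝ => g p.1 p.2
  memLp_left : ∀ x, MemLp (fun t => g x t) 2 vol01
  memLp_right : ∀ t, MemLp (fun x => g x t) 2 vol01
  continuous_left : Continuous fun x => l2Class vol01 fun t => g x t
  continuous_right : Continuous fun t => l2Class vol01 fun x => g x t

namespace HasL2Sections

theorem add {g g' : ℝ → ℝ → E} (hg : HasL2Sections g) (hg' : HasL2Sections g') :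
    HasL2Sections fun x t => g x t + g' x t where
  stronglyMeasurable := hg.stronglyMeasurable.add hg'.stronglyMeasurable
  memLp_left x := (hg.memLp_left x).add (hg'.memLp_left x)
  memLp_right t := (hg.memLp_right t).add (hg'.memLp_right t)
  continuous_left := by
    simp only [l2Class_add (hg.memLp_left _) (hg'.memLp_left _)]
    exact hg.continuous_left.add hg'.continuous_left
  continuous_right := by
    simp only [l2Class_add (hg.memLp_right _) (hg'.memLp_right _)]
    exact hg.continuous_right.add hg'.continuous_right

theorem neg {g : ℝ → ℝ → E} (hg : HasL2Sections g) : HasL2Sections fun x t => -g x t where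
  stronglyMeasurable := hg.stronglyMeasurable.neg
  memLp_left x := (hg.memLp_left x).neg
  memLp_right t := (hg.memLp_right t).neg
  continuous_left := by
    simp only [l2Class_neg (hg.memLp_left _)]
    exact hg.continuous_left.neg
  continuous_right := by
    simp only [l2Class_neg (hg.memLp_right _)]
    exact hg.continuous_right.neg

theorem _root_.DiracInverse.l2Class_compCLM [NormedSpace ℂ E] [NormedSpace ℂ F] (L : E →L[ℂ] F)
    {f : ℝ → E} (hf : MemLp f 2 vol01) :
    l2Class vol01 (fun t => L (f t)) = L.compLp (l2Class vol01 f) := by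
  symm
  apply eq_l2Class
  filter_upwards [L.coeFn_compLp (l2Class vol01 f), coeFn_l2Class hf] with t h1 h2
  rw [h1, h2]

theorem clm [NormedSpace ℂ E] [NormedSpace ℂ F] (L : E →L[ℂ] F) {g : ℝ → ℝ → E}
    (hg : HasL2Sections g) : HasL2Sections fun x t => L (g x t) where
  stronglyMeasurable := L.continuous.comp_stronglyMeasurable hg.stronglyMeasurable
  memLp_left x := L.comp_memLp' (hg.memLp_left x)
  memLp_right t := L.comp_memLp' (hg.memLp_right t)
  continuous_left := by
    simp only [l2Class_compCLM L (hg.memLp_left _)]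
    exact (L.compLpL 2 vol01).continuous.comp hg.continuous_left
  continuous_right := by
    simp only [l2Class_compCLM L (hg.memLp_right _)]
    exact (L.compLpL 2 vol01).continuous.comp hg.continuous_right

/-- On the compact interval the sections depend continuously on x in the supremum norm, which
dominates the L₂ norm because (0,1) has measure 1. -/
theorem _root_.DiracInverse.continuous_l2Class_of_continuous {g : ℝ → ℝ → E}
    (hg : Continuous fun p : ℝ × ℝ => g p.1 p.2) :
    Continuous fun x => l2Class vol01 fun t => g x t := by
  have hs : ∀ x, Continuous fun t => g x t := fun x =>
    hg.comp (by fun_prop : Continuous fun t => (x, t))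
  let G : C(ℝ × Icc (0 : ℝ) 1, E) := ⟨fun p => g p.1 p.2,
    hg.comp (continuous_fst.prodMk (continuous_subtype_val.comp continuous_snd))⟩
  have hG : Continuous fun x => G.curry x := G.curry.continuous
  rw [Metric.continuous_iff'] at hG ⊢
  intro x ε hε
  filter_upwards [hG x ε hε] with y hy
  refine lt_of_le_of_lt ?_ hy
  rw [dist_eq_norm, dist_eq_norm, ← l2Class_sub (memLp_of_continuous (hs y))
    (memLp_of_continuous (hs x))]
  refine norm_le_of_ae_bound_vol01 (norm_nonneg _) ?_
  filter_upwards [ae_vol01_mem, coeFn_l2Class ((memLp_of_continuous (hs y)).sub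
    (memLp_of_continuous (hs x)))] with t ht h1
  have h1' : (l2Class vol01 fun t => g y t - g x t) t = g y t - g x t := h1
  rw [h1']
  exact (G.curry y - G.curry x).norm_coe_le_norm ⟨t, Ioo_subset_Icc_self ht⟩

theorem of_continuous {g : ℝ → ℝ → E} (hg : Continuous fun p : ℝ × ℝ => g p.1 p.2) :
    HasL2Sections g where
  stronglyMeasurable := hg.stronglyMeasurable
  memLp_left x := memLp_of_continuous (hg.comp (by fun_prop : Continuous fun t => (x, t)))
  memLp_right t := memLp_of_continuous (hg.comp (by fun_prop : Continuous fun x => (x, t)))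
  continuous_left := continuous_l2Class_of_continuous hg
  continuous_right := continuous_l2Class_of_continuous (g := fun t x => g x t)
    (hg.comp continuous_swap)

theorem affine [NormedSpace ℂ E] {f : ℝ → E} (hm : StronglyMeasurable f) (hf : MemLp f 2 volume)
    {a b : ℝ} (ha : a ≠ 0) (hb : b ≠ 0) : HasL2Sections fun x t => f (a * x + b * t) where
  stronglyMeasurable := hm.comp_measurable (by fun_prop)
  memLp_left x := (memLp_comp_affine hf (a * x) hb).restrict _
  memLp_right t := by
    have := (memLp_comp_affine hf (b * t) ha).restrict (Ioo 0 1)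
    simpa only [add_comm] using this
  continuous_left := continuous_l2Class_affine hf a hb
  continuous_right := by
    have := continuous_l2Class_affine hf b ha
    simpa only [add_comm] using this

theorem continuous_left_indicator {g : ℝ → ℝ → E} (hg : HasL2Sections g) :
    Continuous fun x => l2Class vol01 fun t => (Iic x).indicator (g x) t := by
  have h1 := continuous_l2Class_indicator continuous_id hg.continuous_left
  convert h1 using 2 with x
  refine l2Class_congr ?_
  filter_upwards [coeFn_l2Class (hg.memLp_left x)] with t ht
  by_cases h : t ≤ x <;> simp [indicator, h, ht]

theorem isG2Plus {n : Type} [Fintype n] [DecidableEq n] {g : ℝ → ℝ → Mat n}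
    (hg : HasL2Sections g) : IsG2Plus fun x t => (Iic x).indicator (g x) t where
  measurable := by
    have h1 := hg.stronglyMeasurable.indicator (s := {p : ℝ × ℝ | p.2 ≤ p.1})
      (measurableSet_le measurable_snd measurable_fst)
    exact h1.aestronglyMeasurable
  memLp_left x _ := (hg.memLp_left x).indicator measurableSet_Iic
  memLp_right t _ := by
    have := (hg.memLp_right t).indicator (s := Ici t) measurableSet_Ici
    exact this
  continuous_left := hg.continuous_left_indicator.continuousOn
  -- For fixed t the cut kernel lives on x ≥ t. Up to the null set x = t it is the whole section
  -- minus its restriction to x ≤ t, and continuity is known for restrictions of the latter form.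
  continuous_right := by
    refine Continuous.continuousOn ?_
    have h1 := hg.continuous_right.sub
      (continuous_l2Class_indicator continuous_id hg.continuous_right)
    convert h1 using 2 with t
    have h2 : (l2Class vol01 fun x => (Iic x).indicator (g x) t) =
        l2Class vol01 fun x => g x t - (Iic t).indicator (fun x => g x t) x := by
      refine l2Class_congr ?_
      have hne : ∀ᵐ x ∂vol01, x ≠ t := by
        refine ae_restrict_of_ae ?_
        simp [ae_iff]
      filter_upwards [hne] with x hx
      rcases lt_or_gt_of_ne hx with h | h
      · simp [indicator, h.not_ge, h.le]
      · simp [indicator, h.not_ge, h.le]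
    rw [h2, l2Class_sub (hg.memLp_right t) ((hg.memLp_right t).indicator measurableSet_Iic)]
    congr 1
    refine l2Class_congr ?_
    filter_upwards [coeFn_l2Class (hg.memLp_right t)] with x hx
    by_cases h : x ≤ t <;> simp [indicator, h, hx]
  lower := by
    filter_upwards [ae_restrict_mem measurableSet_omegaMinus] with p hp
    exact indicator_of_notMem (s := Iic p.1) (f := g p.1) (not_le.2 hp.2.1)

end HasL2Sections

end Sections

/-! ### The Krein equation -/

section KreinEquation

variable {r : ℕ} {h : ℝ → Mat (Fin r)} {H : L2Sym r}

theorem measurableSet_omegaPlus : MeasurableSet OmegaPlus := by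
  have : OmegaPlus = {p : ℝ × ℝ | 0 ≤ p.2} ∩ ({p | p.2 ≤ p.1} ∩ {p | p.1 ≤ 1}) := rfl
  rw [this]
  exact (measurableSet_le measurable_const measurable_snd).inter
    ((measurableSet_le measurable_snd measurable_fst).inter
      (measurableSet_le measurable_fst measurable_const))

theorem ae_eq_on_Icc (hH : H =ᵐ[volSym] h) :
    ∀ᵐ x : ℝ, x ∈ Icc (-1 : ℝ) 1 → H x = h x := by
  have h1 : ∀ᵐ x : ℝ, x ∈ Ioo (-1 : ℝ) 1 → H x = h x := (ae_restrict_iff' measurableSet_Ioo).1 hH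
  have h2 : ∀ᵐ x : ℝ, x ≠ -1 ∧ x ≠ 1 := by
    have a1 : ∀ᵐ x : ℝ, x ≠ -1 := by simp [ae_iff]
    have a2 : ∀ᵐ x : ℝ, x ≠ 1 := by simp [ae_iff]
    exact a1.and a2
  filter_upwards [h1, h2] with x hx hne hm
  exact hx ⟨lt_of_le_of_ne hm.1 hne.1.symm, lt_of_le_of_ne hm.2 hne.2⟩

theorem ae_translate_eq (hH : H =ᵐ[volSym] h) {t : ℝ} (ht : t ∈ Icc (0 : ℝ) 1) :
    ∀ᵐ s ∂vol01, H (s - t) = h (s - t) := by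
  have h1 := (quasiMeasurePreserving_affine (-t) (b := 1) one_ne_zero).ae (ae_eq_on_Icc hH)
  filter_upwards [ae_restrict_of_ae h1, ae_vol01_mem] with s hs hm
  have e : -t + 1 * s = s - t := by ring
  rw [e] at hs
  exact hs ⟨by linarith [hm.1, ht.2], by linarith [hm.2, ht.1]⟩

theorem ae_translate_eq' (hH : H =ᵐ[volSym] h) {x : ℝ} (hx : x ∈ Icc (0 : ℝ) 1) :
    ∀ᵐ t ∂vol01, H (x - t) = h (x - t) := by
  have h1 := (quasiMeasurePreserving_affine x (b := -1) (by norm_num)).ae (ae_eq_on_Icc hH)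
  filter_upwards [ae_restrict_of_ae h1, ae_vol01_mem] with s hs hm
  have e : x + -1 * s = x - s := by ring
  rw [e] at hs
  exact hs ⟨by linarith [hm.2, hx.1], by linarith [hm.1, hx.2]⟩

theorem integral_translate_eq (hH : H =ᵐ[volSym] h) {x t : ℝ} (hx : x ∈ Icc (0 : ℝ) 1)
    (ht : t ∈ Icc (0 : ℝ) 1) (M : ℝ → Mat (Fin r)) :
    ∫ s in (0 : ℝ)..x, M s * H (s - t) = ∫ s in (0 : ℝ)..x, M s * h (s - t) := by
  refine intervalIntegral_congr_vol01 ?_ hx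
  filter_upwards [ae_translate_eq hH ht] with s hs
  rw [hs]

namespace IsKreinKernel

/-- The continuous part of the resolvent kernel. -/
def _root_.DiracInverse.resCorr {n : Type} [Fintype n] [DecidableEq n] (h : ℝ → Mat n)
    (x y t : ℝ) : Mat n := Matrix.of fun k i => ⟪resRow h x y k, convRows h t i⟫_ℂ

theorem continuous_resCorr {n : Type} [Fintype n] [DecidableEq n] {h : ℝ → Mat n}
    (hh : IsKreinKernel h) :
    Continuous fun p : (ℝ × ℝ) × ℝ => resCorr h p.1.1 p.1.2 p.2 :=
  continuous_pi fun k => continuous_pi fun i => hh.continuous_resRow_inner k i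

/-- The resolvent formula is h at an affine argument plus a jointly continuous term. The free
coefficients serve both the Krein kernel (e, c, d) = (1, 0, 1) and the four blocks of the
transformation kernel, where c = 1/2, d = ±1/2 and e is 1 or 0. -/
theorem hasL2Sections_resFun (hh : IsKreinKernel h) {e c d : ℝ} (hc : e - c ≠ 0) (hd : d ≠ 0) :
    HasL2Sections fun x t => resFun h x (e * x) (c * x + d * t) := by
  have h1 := HasL2Sections.affine hh.stronglyMeasurable hh.memLp (a := e - c) (b := -d)
    hc (neg_ne_zero.2 hd)
  have h2 : HasL2Sections fun x t => resCorr h x (e * x) (c * x + d * t) := by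
    refine HasL2Sections.of_continuous ?_
    have := hh.continuous_resCorr.comp
      (by fun_prop : Continuous fun p : ℝ × ℝ => ((p.1, e * p.1), c * p.1 + d * p.2))
    simpa only [Function.comp_def] using this
  have e1 : ∀ x t, resFun h x (e * x) (c * x + d * t) =
      -(h ((e - c) * x + -d * t) + resCorr h x (e * x) (c * x + d * t)) := by
    intro x t
    have : (e - c) * x + -d * t = e * x - (c * x + d * t) := by ring
    rw [this]; rfl
  simp only [e1]
  exact (h1.add h2).neg

theorem isKreinSolution (hh : IsKreinKernel h) (hH : H =ᵐ[volSym] h) :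
    IsKreinSolution H fun x t => resKer h x x t where
  isG2Plus := by
    have h1 := hh.hasL2Sections_resFun (e := 1) (c := 0) (d := 1) (by norm_num) (by norm_num)
    simp only [one_mul, zero_mul, zero_add] at h1
    exact h1.isG2Plus
  equation := by
    have h1 := (quasiMeasurePreserving_sub_of_right_invariant (volume : Measure ℝ) volume).ae (ae_eq_on_Icc hH)
    filter_upwards [ae_restrict_of_ae h1, ae_restrict_mem measurableSet_omegaPlus] with p hp hm
    have hx : p.1 ∈ Icc (0 : ℝ) 1 := ⟨hm.1.trans hm.2.1, hm.2.2⟩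
    have ht : p.2 ∈ Icc (0 : ℝ) 1 := ⟨hm.1, hm.2.1.trans hm.2.2⟩
    rw [integral_translate_eq hH hx ht, hp ⟨by linarith [hx.1, ht.2], by linarith [hx.2, ht.1]⟩]
    exact hh.resKer_equation hx hm.2.1

/-- The solution of the Krein equation is unique, in the strong sense needed for `Θ`. -/
theorem l2Class_boundary_eq (hh : IsKreinKernel h) (hH : H =ᵐ[volSym] h)
    {R : ℝ → ℝ → Mat (Fin r)} (hR : IsKreinSolution H R) :
    (l2Class vol01 fun x => R x 0) = l2Class vol01 fun x => resKer h x x 0 := by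
  have hS := (hh.isKreinSolution hH).isG2Plus
  have hac : vol01.prod vol01 ≪ (volume.restrict (Icc (0 : ℝ) 1 ×ˢ Icc (0 : ℝ) 1)) := by
    rw [Measure.prod_restrict]
    exact Measure.absolutelyContinuous_of_le (Measure.restrict_mono
      (Set.prod_mono Ioo_subset_Icc_self Ioo_subset_Icc_self) le_rfl)
  have hle : vol01.prod vol01 ≤ (volume : Measure (ℝ × ℝ)) := by
    rw [Measure.prod_restrict]; exact Measure.restrict_le_self
  have hmem : ∀ᵐ p : ℝ × ℝ ∂(vol01.prod vol01), p ∈ Ioo (0 : ℝ) 1 ×ˢ Ioo (0 : ℝ) 1 := by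
    rw [Measure.prod_restrict]
    exact ae_restrict_mem (measurableSet_Ioo.prod measurableSet_Ioo)
  have a1 : ∀ᵐ p : ℝ × ℝ ∂(vol01.prod vol01), p ∈ OmegaPlus →
      R p.1 p.2 + H (p.1 - p.2) + ∫ s in (0 : ℝ)..p.1, R p.1 s * H (s - p.2) = 0 :=
    ae_mono hle ((ae_restrict_iff' measurableSet_omegaPlus).1 hR.equation)
  have a2 : ∀ᵐ p : ℝ × ℝ ∂(vol01.prod vol01), p ∈ OmegaMinus → R p.1 p.2 = 0 :=
    ae_mono hle ((ae_restrict_iff' measurableSet_omegaMinus).1 hR.isG2Plus.lower)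
  have b : ∀ᵐ x ∂vol01, ∀ᵐ t ∂vol01, R x t = resKer h x x t := by
    filter_upwards [Measure.ae_ae_of_ae_prod a1, Measure.ae_ae_of_ae_prod a2, ae_vol01_mem]
      with x h1 h2 hx
    have hx' := Ioo_subset_Icc_self hx
    refine hh.ae_eq_resKer hx' (hR.isG2Plus.memLp_left x hx') ?_ ?_
    · filter_upwards [h2, ae_vol01_mem] with t ht htm hxt
      exact ht ⟨hx.1.le, hxt, htm.2.le⟩
    · filter_upwards [h1, ae_vol01_mem, ae_translate_eq' hH hx'] with t ht htm he htx
      have := ht ⟨htm.1.le, htx.le, hx.2.le⟩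
      rw [← integral_translate_eq hH hx' (Ioo_subset_Icc_self htm), ← he]
      exact this
  have m1 := hR.isG2Plus.measurable.mono_ac hac
  have m2 := hS.measurable.mono_ac hac
  -- Exchanging the two almost-everywhere quantifiers requires a measurable set, hence the strongly
  -- measurable modifications.
  have c : ∀ᵐ x ∂vol01, ∀ᵐ t ∂vol01, m1.mk _ (x, t) = m2.mk _ (x, t) := by
    filter_upwards [b, Measure.ae_ae_of_ae_prod m1.ae_eq_mk, Measure.ae_ae_of_ae_prod m2.ae_eq_mk]
      with x hx e1 e2
    filter_upwards [hx, e1, e2] with t ht e1 e2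
    rw [← e1, ← e2]; exact ht
  have d : ∀ᵐ t ∂vol01, ∀ᵐ x ∂vol01, m1.mk _ (x, t) = m2.mk _ (x, t) :=
    (Measure.ae_ae_comm (μ := vol01) (ν := vol01) (m1.stronglyMeasurable_mk.measurableSet_eq_fun
      m2.stronglyMeasurable_mk)).1 c
  have sw : ∀ {P : ℝ × ℝ → Prop}, (∀ᵐ p ∂(vol01.prod vol01), P p) →
      ∀ᵐ t ∂vol01, ∀ᵐ x ∂vol01, P (x, t) := fun hP =>
    Measure.ae_ae_of_ae_prod (Measure.measurePreserving_swap.quasiMeasurePreserving.ae hP)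
  have e : ∀ᵐ t ∂vol01, (l2Class vol01 fun x => R x t) = l2Class vol01 fun x => resKer h x x t := by
    filter_upwards [d, sw m1.ae_eq_mk, sw m2.ae_eq_mk] with t ht e1 e2
    refine l2Class_congr ?_
    filter_upwards [ht, e1, e2] with x hx e1 e2
    exact e1.trans (hx.trans e2.symm)
  have e' : (fun t => l2Class vol01 fun x => R x t) =ᵐ[volume.restrict (Icc (0 : ℝ) 1)]
      fun t => l2Class vol01 fun x => resKer h x x t := by
    rw [← restrict_Ioo_eq_restrict_Icc]; exact e
  -- The section t = 0 is invisible to almost-everywhere statements; it is reached through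
  -- continuity of t ↦ R(·,t) in L₂.
  exact Measure.eqOn_Icc_of_ae_eq volume zero_ne_one e' hR.isG2Plus.continuous_right
    hS.continuous_right (left_mem_Icc.2 zero_le_one)

theorem isKreinSolution_kreinSolution (hh : IsKreinKernel h) (hH : H =ᵐ[volSym] h) :
    IsKreinSolution H (kreinSolution H) :=
  Classical.epsilon_spec ⟨_, hh.isKreinSolution hH⟩

theorem coeFn_Theta (hh : IsKreinKernel h) (hH : H =ᵐ[volSym] h) :
    Theta H =ᵐ[vol01] fun x => Complex.I • resKer h x x 0 := by
  have hR := hh.isKreinSolution_kreinSolution hH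
  have h1 : Theta H = l2Class vol01 fun x => Complex.I • resKer h x x 0 := by
    rw [Theta, l2Class_smul _ hh.memLp_boundary,
      l2Class_smul _ (hR.isG2Plus.memLp_right 0 (by simp)), hh.l2Class_boundary_eq hH hR]
  rw [h1]
  exact coeFn_l2Class (hh.memLp_boundary.const_smul Complex.I)

/-- Applying P_b to f + TP_bf = 0 gives (1 + P_bTP_b)P_bf = 0. Hence P_bf = 0, and then f = -TP_bf =
0 on all of (0,1). -/
theorem isAccelerant (hh : IsKreinKernel h) (hH : H =ᵐ[volSym] h) : IsAccelerant H := by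
  intro b hb f hf
  have h1 : f + convOp h (cut b f) = 0 := by
    apply Lp.ext
    filter_upwards [hf, Lp.coeFn_add f (convOp h (cut b f)), ae_vol01_mem,
      coeFn_rowOp (continuous_convRows hh.memLp) (cut b f),
      Lp.coeFn_zero (EuclideanSpace ℂ (Fin r)) 2 vol01] with x h1 h2 hx h3 h4
    rw [h2, Pi.add_apply, convOp, h3, h4, Pi.zero_apply, ← h1]
    congr 1
    rw [← integral_vol01_indicator (fun t => act (H (x - t)) (f t)) hb]
    ext k
    rw [rowFun_apply, convRows, inner_rowClass_left (memLp_conv hh.memLp x)]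
    refine congrArg (fun v : EuclideanSpace ℂ (Fin r) => v k) (integral_congr_ae ?_)
    filter_upwards [ae_translate_eq' hH (Ioo_subset_Icc_self hx), coeFn_cut b f] with t e1 e2
    rw [e2]
    by_cases ht : t ≤ b <;> simp [indicator, ht, e1]
  have h2 : truncOp h b (cut b f) = 0 := by
    have e : truncOp h b (cut b f) = cut b (f + convOp h (cut b f)) := by
      rw [map_add]
      change cut b f + cut b (convOp h (cut b (cut b f))) = _
      rw [cut_apply_cut_apply, min_self]
    rw [e, h1, map_zero]
  have h3 : cut b f = 0 := by
    have := congrArg (fun v => (Ring.inverse (truncOp h b)) v) h2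
    simp only [map_zero] at this
    rwa [ ← mul_apply_eq_comp, Ring.inverse_mul_cancel _ (hh.isUnit_truncOp b)] at this
  rwa [h3, map_zero, add_zero] at h1

end IsKreinKernel

end KreinEquation

/-! ### Exponentials and convolution operators -/

section Exponentials

variable {n : Type} [Fintype n] [DecidableEq n]

theorem memLp_exp_smul (z : ℝ) {f : ℝ → EuclideanSpace ℂ n} (hf : MemLp f 2 vol01) :
    MemLp (fun x : ℝ => Complex.exp (2 * Complex.I * z * x) • f x) 2 vol01 := by
  refine memLp_smul_of_bounded (C := 1) (by fun_prop) (fun x _ => ?_) hf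
  have : 2 * Complex.I * z * x = ((2 * z * x : ℝ) : ℂ) * Complex.I := by push_cast; ring
  rw [this, Complex.norm_exp_ofReal_mul_I]

/-- `c ↦ e^{2izx} c`. -/
def expOp (z : ℝ) : EuclideanSpace ℂ n →L[ℂ] L2v n :=
  LinearMap.toContinuousLinearMap
    { toFun := fun c => l2Class vol01 fun x : ℝ => Complex.exp (2 * Complex.I * z * x) • c
      map_add' := fun c d => by
        rw [← l2Class_add (memLp_exp_smul z (memLp_const c)) (memLp_exp_smul z (memLp_const d))]
        simp only [smul_add]
      map_smul' := fun s c => by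
        rw [RingHom.id_apply, ← l2Class_smul _ (memLp_exp_smul z (memLp_const c))]
        simp only [smul_comm s] }

theorem expOp_apply (z : ℝ) (c : EuclideanSpace ℂ n) :
    expOp z c = l2Class vol01 fun x : ℝ => Complex.exp (2 * Complex.I * z * x) • c := rfl

theorem coeFn_expOp (z : ℝ) (c : EuclideanSpace ℂ n) :
    expOp z c =ᵐ[vol01] fun x : ℝ => Complex.exp (2 * Complex.I * z * x) • c :=
  coeFn_l2Class (memLp_exp_smul z (memLp_const c))

theorem star_exp_two (z t : ℝ) : (starRingEnd ℂ) (Complex.exp (2 * Complex.I * z * t)) =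
    Complex.exp (-(2 * Complex.I * z * t)) := by
  rw [← Complex.exp_conj]; simp [Complex.conj_ofNat]

theorem inner_expOp (z : ℝ) (c : EuclideanSpace ℂ n) (f : L2v n) :
    ⟪expOp z c, f⟫_ℂ =
      ∫ t : ℝ, Complex.exp (-(2 * Complex.I * z * t)) * ⟪c, f t⟫_ℂ ∂vol01 := by
  have := inner_l2Class (memLp_exp_smul z (memLp_const c)) (Lp.memLp f)
  rw [l2Class_coe] at this
  rw [expOp_apply, this]
  simp only [inner_smul_left, star_exp_two]

theorem adjoint_expOp_apply (z : ℝ) (f : L2v n) (k : n) :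
    ContinuousLinearMap.adjoint (expOp z) f k =
      ∫ t : ℝ, Complex.exp (-(2 * Complex.I * z * t)) * f t k ∂vol01 := by
  have h1 : ContinuousLinearMap.adjoint (expOp z) f k =
      ⟪EuclideanSpace.single k (1 : ℂ), ContinuousLinearMap.adjoint (expOp z) f⟫_ℂ := by
    simp [EuclideanSpace.inner_single_left]
  rw [h1, ContinuousLinearMap.adjoint_inner_right, inner_expOp]
  simp [EuclideanSpace.inner_single_left]

/-- `Ψ(z) A Ψ(z)*`, where `Ψ(z) c = e^{2izx} c`. -/
def expTerm (z : ℝ) (A : Mat n) : L2v n →L[ℂ] L2v n :=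
  (expOp z).comp ((act A).comp (ContinuousLinearMap.adjoint (expOp z)))

theorem expTerm_apply (z : ℝ) (A : Mat n) (f : L2v n) :
    expTerm z A f = expOp z (act A (ContinuousLinearMap.adjoint (expOp z) f)) := rfl

theorem inner_expTerm (z : ℝ) (A : Mat n) (f g : L2v n) :
    ⟪expTerm z A f, g⟫_ℂ = ⟪act A (ContinuousLinearMap.adjoint (expOp z) f),
      ContinuousLinearMap.adjoint (expOp z) g⟫_ℂ := by
  rw [expTerm_apply, ContinuousLinearMap.adjoint_inner_right]

theorem adjoint_act (A : Mat n) : ContinuousLinearMap.adjoint (act A) = act Aᴴ := by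
  rw [act, act, ← Matrix.star_eq_conjTranspose, map_star]; rfl

theorem adjoint_expTerm {A : Mat n} (hA : A.IsHermitian) (z : ℝ) :
    ContinuousLinearMap.adjoint (expTerm z A) = expTerm z A := by
  rw [expTerm, ContinuousLinearMap.adjoint_comp, ContinuousLinearMap.adjoint_comp,
    ContinuousLinearMap.adjoint_adjoint, adjoint_act, hA.eq]
  rfl

theorem isCompactOperator_expTerm (z : ℝ) (A : Mat n) : IsCompactOperator (expTerm z A) := by
  have h1 : IsCompactOperator (ContinuousLinearMap.adjoint (expOp z) : L2v n →L[ℂ] _) :=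
    isCompactOperator_of_locallyCompactSpace_dom _
  exact h1.clm_comp ((expOp z).comp (act A))

theorem inner_act_re_nonneg {A : Mat n} (hA : A.PosSemidef) (v : EuclideanSpace ℂ n) :
    0 ≤ (⟪act A v, v⟫_ℂ).re := by
  have h1 : (Matrix.toEuclideanLin A).IsPositive := Matrix.isPositive_toEuclideanLin_iff.2 hA
  exact h1.2 v

theorem expTerm_re_nonneg {A : Mat n} (hA : A.PosSemidef) (z : ℝ) (f : L2v n) :
    0 ≤ (⟪expTerm z A f, f⟫_ℂ).re := by
  rw [inner_expTerm]; exact inner_act_re_nonneg hA _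

/-- A positive operator bounded by `C` satisfies `‖Sf‖² ≤ C ⟪Sf, f⟫`. -/
theorem norm_sq_le_of_nonneg {V : Type*} [NormedAddCommGroup V] [InnerProductSpace ℂ V]
    [CompleteSpace V] {S : V →L[ℂ] V} (hS : ContinuousLinearMap.adjoint S = S)
    (h0 : ∀ f, 0 ≤ (⟪S f, f⟫_ℂ).re) {C : ℝ} (hC : 0 < C)
    (h1 : ∀ f, (⟪S f, f⟫_ℂ).re ≤ C * ‖f‖ ^ 2) (f : V) :
    ‖S f‖ ^ 2 ≤ C * (⟪S f, f⟫_ℂ).re := by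
  -- Positivity at f - C⁻¹Sf reads ⟪Sf,f⟫ - 2C⁻¹‖Sf‖² + C⁻²⟪S(Sf),Sf⟫ ≥ 0, and the last term is at
  -- most C⁻¹‖Sf‖².
  have h2 := h0 (f - ((C⁻¹ : ℝ) : ℂ) • S f)
  have h3 := h1 (S f)
  have e1 : ⟪S (S f), f⟫_ℂ = ⟪S f, S f⟫_ℂ := by
    conv_lhs => rw [← hS]
    rw [ContinuousLinearMap.adjoint_inner_left, hS]
  have e2 : (⟪S f, S f⟫_ℂ).re = ‖S f‖ ^ 2 := inner_self_eq_norm_sq (𝕜 := ℂ) _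
  simp only [map_sub, map_smul, inner_sub_left, inner_sub_right, inner_smul_left, inner_smul_right,
    Complex.conj_ofReal, Complex.sub_re, Complex.re_ofReal_mul, e1, e2] at h2
  have h4 : C⁻¹ * (C⁻¹ * (⟪S (S f), S f⟫_ℂ).re) ≤ C⁻¹ * ‖S f‖ ^ 2 := by
    gcongr
    rw [inv_mul_le_iff₀ hC]; exact h3
  have h5 : 0 ≤ (⟪S f, f⟫_ℂ).re - C⁻¹ * ‖S f‖ ^ 2 := by linarith
  have h6 : C⁻¹ * ‖S f‖ ^ 2 ≤ (⟪S f, f⟫_ℂ).re := by linarith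
  rwa [inv_mul_le_iff₀ hC] at h6

/-! ### Convolution with elements of `L₂(-1,1)` -/

theorem memLp_indicator_sym {E : Type*} [NormedAddCommGroup E] {g : ℝ → E} :
    MemLp ((Ioo (-1 : ℝ) 1).indicator g) 2 volume ↔ MemLp g 2 volSym :=
  memLp_indicator_iff_restrict measurableSet_Ioo

/-- The convolution operator with an element of `L₂(-1,1)`. -/
def convSym (H : Lp (Mat n) 2 volSym) : L2v n →L[ℂ] L2v n :=
  convOp ((Ioo (-1 : ℝ) 1).indicator H)

theorem convRows_congr {g g' : ℝ → Mat n} (h : g =ᵐ[volume] g') (x : ℝ) (k : n) :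
    convRows g x k = convRows g' x k := by
  refine rowClass_congr (ae_restrict_of_ae ?_) k
  have := (quasiMeasurePreserving_affine x (b := -1) (by norm_num)).ae h
  simpa [← sub_eq_add_neg] using this

theorem convOp_congr {g g' : ℝ → Mat n} (h : g =ᵐ[volume] g') : convOp g = convOp g' := by
  have : convRows g = convRows g' := by
    funext x k; exact convRows_congr h x k
  rw [convOp, convOp, this]

theorem indicator_ae_eq {E : Type*} {g g' : ℝ → E} [Zero E] (h : g =ᵐ[volSym] g') :
    (Ioo (-1 : ℝ) 1).indicator g =ᵐ[volume] (Ioo (-1 : ℝ) 1).indicator g' := by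
  have h1 := (ae_restrict_iff' measurableSet_Ioo).1 h
  filter_upwards [h1] with x hx
  by_cases hm : x ∈ Ioo (-1 : ℝ) 1
  · simp only [indicator_of_mem hm]; exact hx hm
  · simp only [indicator_of_notMem hm]

theorem convSym_l2Class {g : ℝ → Mat n} (hg : MemLp g 2 volSym) :
    convSym (l2Class volSym g) = convOp ((Ioo (-1 : ℝ) 1).indicator g) :=
  convOp_congr (indicator_ae_eq (coeFn_l2Class hg))

theorem convOp_sub {g g' : ℝ → Mat n} (hg : MemLp g 2 volume) (hg' : MemLp g' 2 volume) :
    convOp (fun x => g x - g' x) = convOp g - convOp g' := by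
  ext1 f
  have hs : MemLp (fun x => g x - g' x) 2 volume := hg.sub hg'
  apply Lp.ext
  rw [sub_apply]
  filter_upwards [Lp.coeFn_sub (convOp g f) (convOp g' f), coeFn_rowOp (continuous_convRows hg) f,
    coeFn_rowOp (continuous_convRows hg') f, coeFn_rowOp (continuous_convRows hs) f]
    with x h1 h2 h3 h4
  rw [h1, Pi.sub_apply]
  simp only [convOp]
  rw [h2, h3, h4]
  ext k
  simp only [PiLp.sub_apply, rowFun_apply, convRows]
  rw [rowClass_sub (memLp_conv hg x) (memLp_conv hg' x), inner_sub_left]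

theorem convSym_sub (H H' : Lp (Mat n) 2 volSym) :
    convSym (H - H') = convSym H - convSym H' := by
  rw [convSym, convSym, convSym, ← convOp_sub (memLp_indicator_sym.2 (Lp.memLp H))
    (memLp_indicator_sym.2 (Lp.memLp H'))]
  refine convOp_congr ?_
  have := indicator_ae_eq (Lp.coeFn_sub H H')
  filter_upwards [this] with x hx
  rw [hx]
  by_cases hm : x ∈ Ioo (-1 : ℝ) 1 <;> simp [hm]

theorem norm_convOp_le {g : ℝ → Mat n} (hg : MemLp g 2 volume) :
    ‖convOp g‖ ≤ √(Fintype.card n) * (eLpNorm g 2 volume).toReal := by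
  refine norm_rowOp_le (continuous_convRows hg) ENNReal.toReal_nonneg fun x _ k => ?_
  refine (norm_rowClass_le (memLp_conv hg x) k).trans ?_
  rw [norm_l2Class (memLp_conv hg x)]
  refine ENNReal.toReal_mono hg.2.ne ?_
  have e : eLpNorm (fun t => g (x - t)) 2 volume = eLpNorm g 2 volume :=
    eLpNorm_comp_measurePreserving hg.1 (Measure.measurePreserving_sub_left volume x)
  rw [← e]
  exact eLpNorm_mono_measure _ Measure.restrict_le_self

theorem norm_convSym_le (H : Lp (Mat n) 2 volSym) :
    ‖convSym H‖ ≤ √(Fintype.card n) * ‖H‖ := by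
  refine (norm_convOp_le (memLp_indicator_sym.2 (Lp.memLp H))).trans_eq ?_
  rw [eLpNorm_indicator_eq_eLpNorm_restrict measurableSet_Ioo, Lp.norm_def]

/-- `convSym` as an additive map. -/
def convSymHom : Lp (Mat n) 2 volSym →+ (L2v n →L[ℂ] L2v n) :=
  AddMonoidHom.ofMapSub convSym convSym_sub

theorem convSymHom_apply (H : Lp (Mat n) 2 volSym) : convSymHom H = convSym H := rfl

theorem continuous_convSymHom : Continuous (convSymHom (n := n)) :=
  AddMonoidHomClass.continuous_of_bound convSymHom _ norm_convSym_le

theorem memLp_exp_smul_sym (z : ℝ) (A : Mat n) :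
    MemLp (fun x : ℝ => Complex.exp (2 * Complex.I * z * x) • A) 2 volSym := by
  have hc : Continuous fun x : ℝ => Complex.exp (2 * Complex.I * z * x) • A := by fun_prop
  refine MemLp.of_bound hc.aestronglyMeasurable ‖A‖ (Eventually.of_forall fun x => ?_)
  have : 2 * Complex.I * z * x = ((2 * z * x : ℝ) : ℂ) * Complex.I := by push_cast; ring
  rw [norm_smul, this, Complex.norm_exp_ofReal_mul_I, one_mul]

/-- The operator `Ψ(z) A Ψ(z)*` is the convolution with `e^{2izx} A`. -/
theorem convSym_exp (z : ℝ) (A : Mat n) :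
    convSym (l2Class volSym fun x : ℝ => Complex.exp (2 * Complex.I * z * x) • A) =
      expTerm z A := by
  have hm := memLp_exp_smul_sym z A
  rw [convSym_l2Class hm]
  ext1 f
  apply Lp.ext
  have hm' := memLp_indicator_sym.2 hm
  filter_upwards [coeFn_rowOp (continuous_convRows hm') f,
    coeFn_expOp z (act A (ContinuousLinearMap.adjoint (expOp z) f)), ae_vol01_mem] with x h1 h2 hx
  rw [convOp, h1, expTerm_apply, h2]
  ext k
  rw [rowFun_apply, convRows, inner_rowClass_left (memLp_conv hm' x), integral_act_apply
    (integrable_act (memLp_conv hm' x) (Lp.memLp f))]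
  simp only [PiLp.smul_apply, act_apply, adjoint_expOp_apply, smul_eq_mul]
  have hi : ∀ i, Integrable (fun t : ℝ => Complex.exp (-(2 * Complex.I * z * t)) * f t i) vol01 := by
    intro i
    have h3 := memLp_exp_smul (-z) (Lp.memLp f)
    have h4 := (EuclideanSpace.proj i : EuclideanSpace ℂ n →L[ℂ] ℂ).comp_memLp' h3
    refine (h4.integrable one_le_two).congr (Eventually.of_forall fun t => ?_)
    simp
  simp only [← integral_const_mul, Finset.mul_sum]
  rw [← integral_finsetSum]
  · refine integral_congr_ae ?_
    filter_upwards [ae_vol01_mem] with t ht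
    have hmem : x - t ∈ Ioo (-1 : ℝ) 1 := ⟨by linarith [hx.1, ht.2], by linarith [hx.2, ht.1]⟩
    refine Finset.sum_congr rfl fun i _ => ?_
    rw [indicator_of_mem hmem, Matrix.smul_apply, smul_eq_mul]
    have e : Complex.exp (2 * Complex.I * z * ((x - t : ℝ) : ℂ)) =
        Complex.exp (2 * Complex.I * z * x) * Complex.exp (-(2 * Complex.I * z * t)) := by
      rw [← Complex.exp_add]; congr 1; push_cast; ring
    rw [e]; ring
  · intro i _
    exact ((hi i).const_mul _).const_mul _

end Exponentials

/-! ### The Fourier basis -/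

section Fourier

variable {n : Type} [Fintype n] [DecidableEq n]

theorem integral_exp_int (m : ℤ) : ∫ t : ℝ in (0 : ℝ)..1,
    Complex.exp (2 * Real.pi * Complex.I * m * t) = if m = 0 then 1 else 0 := by
  split_ifs with h
  · simp [h]
  · have hc : (2 * Real.pi * Complex.I * m : ℂ) ≠ 0 := by
      simp [h, Real.pi_ne_zero]
    rw [integral_exp_mul_complex hc]
    have : (2 * Real.pi * Complex.I * m * (1 : ℝ) : ℂ) = m * (2 * Real.pi * Complex.I) := by
      push_cast; ring
    rw [this, Complex.exp_int_mul_two_pi_mul_I]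
    simp

theorem orthonormal_expOp : Orthonormal ℂ fun p : ℤ × n =>
    expOp (Real.pi * p.1) (EuclideanSpace.single p.2 (1 : ℂ)) := by
  rw [orthonormal_iff_ite]
  rintro ⟨m, k⟩ ⟨m', k'⟩
  rw [expOp_apply, expOp_apply, inner_l2Class (memLp_exp_smul _ (memLp_const _))
    (memLp_exp_smul _ (memLp_const _))]
  have e : ∀ t : ℝ, ⟪Complex.exp (2 * Complex.I * ((Real.pi * m : ℝ) : ℂ) * t) •
      (EuclideanSpace.single k (1 : ℂ) : EuclideanSpace ℂ n),
      Complex.exp (2 * Complex.I * ((Real.pi * m' : ℝ) : ℂ) * t) •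
      EuclideanSpace.single k' (1 : ℂ)⟫_ℂ =
      Complex.exp (2 * Real.pi * Complex.I * ((m' - m : ℤ) : ℂ) * t) *
        (if k = k' then 1 else 0) := by
    intro t
    rw [inner_smul_left, inner_smul_right, star_exp_two, EuclideanSpace.inner_single_left,
      ← mul_assoc, ← Complex.exp_add]
    congr 1
    · congr 1; push_cast; ring
    · simp
  simp only [e]
  rw [integral_mul_const, integral_vol01_eq, integral_exp_int]
  by_cases h1 : m = m' <;> by_cases h2 : k = k' <;> simp [h1, h2, sub_eq_zero, eq_comm]

theorem eq_zero_of_fourier {f : ℝ → ℂ} (hf : MemLp f 2 vol01)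
    (h : ∀ m : ℤ, ∫ t : ℝ, Complex.exp (-(2 * Complex.I * ((Real.pi * m : ℝ) : ℂ) * t)) * f t ∂vol01
      = 0) : f =ᵐ[vol01] 0 := by
  have hf' : MemLp f 2 (volume.restrict (Ioc (0 : ℝ) 1)) := by
    rwa [← restrict_Ioo_eq_restrict_Ioc]
  have h1 := hasSum_sq_fourierCoeffOn zero_lt_one hf'
  have h2 : ∀ m, fourierCoeffOn zero_lt_one f m = 0 := by
    intro m
    rw [fourierCoeffOn_eq_integral]
    have : ∫ x in (0 : ℝ)..1, fourier (-m) (x : AddCircle ((1 : ℝ) - 0)) • f x = 0 := by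
      rw [← h m, integral_vol01_eq]
      refine intervalIntegral.integral_congr fun t _ => ?_
      simp only [fourier_coe_apply, smul_eq_mul]
      congr 2
      push_cast; ring
    rw [this, smul_zero]
  simp only [h2, norm_zero, ne_eq, OfNat.ofNat_ne_zero, not_false_eq_true, zero_pow] at h1
  have h3 : ∫ t, ‖f t‖ ^ 2 ∂vol01 = 0 := by
    have := h1.unique hasSum_zero
    rw [integral_vol01_eq]
    simpa using this
  rw [integral_eq_zero_iff_of_nonneg (fun t => by positivity) (hf.integrable_norm_pow two_ne_zero)] at h3
  filter_upwards [h3] with t ht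
  simpa using ht

theorem eq_zero_of_inner_expOp {f : L2v n}
    (h : ∀ (m : ℤ) (c : EuclideanSpace ℂ n), ⟪expOp (Real.pi * m) c, f⟫_ℂ = 0) : f = 0 := by
  have h1 : ∀ k, (fun t => f t k) =ᵐ[vol01] 0 := fun k =>
    eq_zero_of_fourier ((EuclideanSpace.proj k : EuclideanSpace ℂ n →L[ℂ] ℂ).comp_memLp'
      (Lp.memLp f)) fun m => by
        have := h m (EuclideanSpace.single k 1)
        rw [inner_expOp] at this
        simpa [EuclideanSpace.inner_single_left] using this
  apply Lp.ext
  filter_upwards [ae_all_iff.2 h1, Lp.coeFn_zero (EuclideanSpace ℂ n) 2 vol01] with t ht h0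
  rw [h0]
  ext k; exact ht k

/-- Expansion in the Fourier basis. -/
theorem hasSum_fourier (f : L2v n) : HasSum (fun m : ℤ => expTerm (Real.pi * m) 1 f) f := by
  have hb : (Submodule.span ℂ (Set.range fun p : ℤ × n =>
      expOp (Real.pi * p.1) (EuclideanSpace.single p.2 (1 : ℂ))))ᗮ = ⊥ := by
    rw [Submodule.eq_bot_iff]
    intro g hg
    refine eq_zero_of_inner_expOp fun m c => ?_
    have hc : c = ∑ k, c k • EuclideanSpace.single k (1 : ℂ) := by
      ext i; simp [Pi.single_apply]
    rw [hc, map_sum, sum_inner]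
    refine Finset.sum_eq_zero fun k _ => ?_
    rw [map_smul, inner_smul_left]
    have := (Submodule.mem_orthogonal _ _).1 hg _ (Submodule.subset_span ⟨(m, k), rfl⟩)
    simp only at this
    rw [this, mul_zero]
  have h1 := (HilbertBasis.mkOfOrthogonalEqBot orthonormal_expOp hb).hasSum_repr f
  simp only [HilbertBasis.repr_apply_apply, HilbertBasis.coe_mkOfOrthogonalEqBot] at h1
  have h2 := h1.prod_fiberwise fun m => hasSum_fintype _
  convert h2 using 2 with m
  rw [expTerm_apply]
  have hc : act (1 : Mat n) (ContinuousLinearMap.adjoint (expOp (Real.pi * m)) f) =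
      ∑ k, ⟪expOp (Real.pi * m) (EuclideanSpace.single k (1 : ℂ)), f⟫_ℂ •
        EuclideanSpace.single k (1 : ℂ) := by
    ext i
    simp [Pi.single_apply, ← ContinuousLinearMap.adjoint_inner_right,
      EuclideanSpace.inner_single_left, Matrix.one_apply]
  rw [hc, map_sum]
  simp only [map_smul]

end Fourier

/-! ### A Parseval estimate for perturbed trigonometric sums -/

section Estimate

theorem integral_exp_int_sym (m : ℤ) : ∫ t : ℝ, Complex.exp (2 * Real.pi * Complex.I * m * t) ∂volSym
    = if m = 0 then 2 else 0 := by
  rw [← integral_Ioc_eq_integral_Ioo, ← intervalIntegral.integral_of_le (by norm_num)]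
  split_ifs with h
  · simp [h]; norm_num
  · have hc : (2 * Real.pi * Complex.I * m : ℂ) ≠ 0 := by
      simp [h, Real.pi_ne_zero]
    rw [integral_exp_mul_complex hc]
    have e1 : (2 * Real.pi * Complex.I * m * (1 : ℝ) : ℂ) = m * (2 * Real.pi * Complex.I) := by
      push_cast; ring
    have e2 : (2 * Real.pi * Complex.I * m * (-1 : ℝ) : ℂ) =
        ((-m : ℤ) : ℂ) * (2 * Real.pi * Complex.I) := by
      push_cast; ring
    rw [e1, e2, Complex.exp_int_mul_two_pi_mul_I, Complex.exp_int_mul_two_pi_mul_I]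
    simp

theorem integrable_volSym_of_continuous {E : Type*} [NormedAddCommGroup E] {f : ℝ → E}
    (hf : Continuous f) : Integrable f volSym :=
  (hf.continuousOn.integrableOn_compact (isCompact_Icc (a := (-1 : ℝ)) (b := 1))).mono_set
    Ioo_subset_Icc_self

/-- The interval (-1,1) consists of two periods of these exponentials, which accounts for the factor
2. -/
theorem parseval_trig (s : Finset ℤ) (c : ℤ → ℂ) :
    ∫ x : ℝ, ‖∑ m ∈ s, Complex.exp (2 * Real.pi * Complex.I * m * x) * c m‖ ^ 2 ∂volSym =
      2 * ∑ m ∈ s, ‖c m‖ ^ 2 := by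
  have e : ∀ x : ℝ, ((‖∑ m ∈ s, Complex.exp (2 * Real.pi * Complex.I * m * x) * c m‖ ^ 2 : ℝ) : ℂ) =
      ∑ m ∈ s, ∑ k ∈ s, Complex.exp (2 * Real.pi * Complex.I * ((m - k : ℤ) : ℂ) * x) *
        (c m * (starRingEnd ℂ) (c k)) := by
    intro x
    rw [Complex.ofReal_pow, ← Complex.mul_conj', map_sum, Finset.sum_mul_sum]
    refine Finset.sum_congr rfl fun m _ => Finset.sum_congr rfl fun k _ => ?_
    have e1 : (starRingEnd ℂ) (Complex.exp (2 * Real.pi * Complex.I * k * x)) =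
        Complex.exp (-(2 * Real.pi * Complex.I * k * x)) := by
      rw [← Complex.exp_conj]; simp [Complex.conj_ofNat]
    have e2 : Complex.exp (2 * Real.pi * Complex.I * ((m - k : ℤ) : ℂ) * x) =
        Complex.exp (2 * Real.pi * Complex.I * m * x) *
          Complex.exp (-(2 * Real.pi * Complex.I * k * x)) := by
      rw [← Complex.exp_add]; congr 1; push_cast; ring
    rw [map_mul, e1, e2]; ring
  have h : ((∫ x : ℝ, ‖∑ m ∈ s, Complex.exp (2 * Real.pi * Complex.I * m * x) * c m‖ ^ 2 ∂volSym : ℝ) : ℂ) =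
      ((2 * ∑ m ∈ s, ‖c m‖ ^ 2 : ℝ) : ℂ) := by
    rw [← integral_complex_ofReal]
    simp only [e]
    rw [integral_finsetSum _ fun m _ => integrable_volSym_of_continuous (by fun_prop)]
    have : ∀ m ∈ s, ∫ x : ℝ, ∑ k ∈ s, Complex.exp (2 * Real.pi * Complex.I * ((m - k : ℤ) : ℂ) * x) *
        (c m * (starRingEnd ℂ) (c k)) ∂volSym = 2 * ((‖c m‖ ^ 2 : ℝ) : ℂ) := by
      intro m hm
      rw [integral_finsetSum _ fun k _ => integrable_volSym_of_continuous (by fun_prop)]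
      simp only [integral_mul_const, integral_exp_int_sym, sub_eq_zero, ite_mul, zero_mul]
      rw [Finset.sum_ite_eq, if_pos hm, Complex.mul_conj', Complex.ofReal_pow]
    rw [Finset.sum_congr rfl this]
    push_cast
    rw [Finset.mul_sum]
  exact_mod_cast h

theorem sq_integral_sym_le {g : ℝ → ℝ} (hg : Continuous g) :
    (∫ y, g y ∂volSym) ^ 2 ≤ 2 * ∫ y, g y ^ 2 ∂volSym := by
  set A := ∫ y, g y ∂volSym with hA
  -- A/2 is the mean of g over an interval of length 2, so the Cauchy–Schwarz inequality appears as
  -- nonnegativity of the variance.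
  have h0 : 0 ≤ ∫ y, (g y - A / 2) ^ 2 ∂volSym := integral_nonneg fun y => sq_nonneg _
  have e : ∫ y, (g y - A / 2) ^ 2 ∂volSym = ∫ y, g y ^ 2 ∂volSym - A * A + A ^ 2 / 2 := by
    have e1 : ∀ y, (g y - A / 2) ^ 2 = g y ^ 2 - A * g y + A ^ 2 / 4 := fun y => by ring
    simp only [e1]
    rw [integral_add, integral_sub, integral_const_mul, integral_const]
    · simp [Measure.real]
      ring_nf
      norm_num
      ring
    all_goals exact integrable_volSym_of_continuous (by fun_prop)
  nlinarith

/-- Writing b_m(x) = b_m(0) + ∫₀ˣ b_m'(y) dy separates the modulation from the frequency: for fixed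
y the coefficients b_m'(y) are constants, so Parseval in x applies, followed by integration over y.
The factor 16 is 4 (from squaring a sum and Cauchy–Schwarz) times 2 (Parseval) times 2 (length of
the y-interval). -/
theorem trig_estimate (s : Finset ℤ) {b b' : ℤ → ℝ → ℂ} (hb : ∀ m x, HasDerivAt (b m) (b' m x) x)
    (hb' : ∀ m, Continuous (b' m)) {B : ℤ → ℝ} (hB : ∀ m x, ‖b' m x‖ ≤ B m) :
    ∫ x : ℝ, ‖∑ m ∈ s, Complex.exp (2 * Real.pi * Complex.I * m * x) * b m x‖ ^ 2 ∂volSym ≤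
      4 * ∑ m ∈ s, ‖b m 0‖ ^ 2 + 16 * ∑ m ∈ s, B m ^ 2 := by
  have hbc : ∀ m, Continuous (b m) := fun m =>
    continuous_iff_continuousAt.2 fun x => (hb m x).continuousAt
  set w : ℝ → ℝ → ℂ := fun x y => ∑ m ∈ s, Complex.exp (2 * Real.pi * Complex.I * m * x) * b' m y
    with hw
  have hwc : Continuous fun p : ℝ × ℝ => w p.1 p.2 := by
    simp only [hw]
    refine continuous_finsetSum _ fun m _ => ?_
    exact (by fun_prop : Continuous fun p : ℝ × ℝ =>
      Complex.exp (2 * Real.pi * Complex.I * m * (p.1 : ℂ))).mul ((hb' m).comp continuous_snd)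
  have hwx : ∀ x, Continuous fun y => w x y := fun x =>
    hwc.comp (by fun_prop : Continuous fun y => (x, y))
  have hwn : Continuous fun p : ℝ × ℝ => ‖w p.1 p.2‖ ^ 2 := hwc.norm.pow 2
  have hprod : Integrable (fun p : ℝ × ℝ => ‖w p.1 p.2‖ ^ 2) (volSym.prod volSym) := by
    rw [Measure.prod_restrict]
    exact (hwn.continuousOn.integrableOn_compact ((isCompact_Icc (a := (-1 : ℝ)) (b := 1)).prod
      (isCompact_Icc (a := (-1 : ℝ)) (b := 1)))).mono_set
        (Set.prod_mono Ioo_subset_Icc_self Ioo_subset_Icc_self)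
  have hpt : ∀ x ∈ Ioo (-1 : ℝ) 1,
      ‖∑ m ∈ s, Complex.exp (2 * Real.pi * Complex.I * m * x) * b m x‖ ^ 2 ≤
      2 * ‖∑ m ∈ s, Complex.exp (2 * Real.pi * Complex.I * m * x) * b m 0‖ ^ 2 +
        4 * ∫ y, ‖w x y‖ ^ 2 ∂volSym := by
    intro x hx
    have e1 : ∑ m ∈ s, Complex.exp (2 * Real.pi * Complex.I * m * x) * b m x =
        (∑ m ∈ s, Complex.exp (2 * Real.pi * Complex.I * m * x) * b m 0) +
          ∫ y in (0 : ℝ)..x, w x y := by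
      simp only [hw]
      rw [intervalIntegral.integral_finsetSum fun m _ =>
        ((hb' m).const_mul _).intervalIntegrable _ _, ← Finset.sum_add_distrib]
      refine Finset.sum_congr rfl fun m _ => ?_
      rw [intervalIntegral.integral_const_mul, intervalIntegral.integral_eq_sub_of_hasDerivAt
        (fun y _ => hb m y) ((hb' m).intervalIntegrable _ _)]
      ring
    have e2 : ‖∫ y in (0 : ℝ)..x, w x y‖ ≤ ∫ y, ‖w x y‖ ∂volSym := by
      refine intervalIntegral.norm_integral_le_integral_norm_uIoc.trans ?_
      refine setIntegral_mono_set (integrable_volSym_of_continuous (hwx x).norm)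
        (Eventually.of_forall fun y => norm_nonneg _) (LE.le.eventuallyLE ?_)
      intro y hy
      rcases le_total 0 x with h | h
      · rw [uIoc_of_le h] at hy
        exact ⟨by linarith [hy.1], by linarith [hy.2, hx.2]⟩
      · rw [uIoc_of_ge h] at hy
        exact ⟨by linarith [hy.1, hx.1], by linarith [hy.2]⟩
    have e3 := sq_integral_sym_le (hwx x).norm
    have e4 : ‖∫ y in (0 : ℝ)..x, w x y‖ ^ 2 ≤ 2 * ∫ y, ‖w x y‖ ^ 2 ∂volSym :=
      (pow_le_pow_left₀ (norm_nonneg _) e2 2).trans e3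
    rw [e1]
    have e5 := norm_add_le (∑ m ∈ s, Complex.exp (2 * Real.pi * Complex.I * m * x) * b m 0)
      (∫ y in (0 : ℝ)..x, w x y)
    have e6 := pow_le_pow_left₀ (norm_nonneg _) e5 2
    have e7 := add_sq_le (a := ‖∑ m ∈ s, Complex.exp (2 * Real.pi * Complex.I * m * x) * b m 0‖)
      (b := ‖∫ y in (0 : ℝ)..x, w x y‖)
    linarith
  have i1 : Integrable (fun x : ℝ =>
      ‖∑ m ∈ s, Complex.exp (2 * Real.pi * Complex.I * m * x) * b m x‖ ^ 2) volSym :=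
    integrable_volSym_of_continuous (by fun_prop)
  have i2 : Integrable (fun x : ℝ =>
      ‖∑ m ∈ s, Complex.exp (2 * Real.pi * Complex.I * m * x) * b m 0‖ ^ 2) volSym :=
    integrable_volSym_of_continuous (by fun_prop)
  have i3 : Integrable (fun x => ∫ y, ‖w x y‖ ^ 2 ∂volSym) volSym := hprod.integral_prod_left
  have h1 : ∫ x : ℝ, ‖∑ m ∈ s, Complex.exp (2 * Real.pi * Complex.I * m * x) * b m x‖ ^ 2 ∂volSym ≤
      ∫ x : ℝ, (2 * ‖∑ m ∈ s, Complex.exp (2 * Real.pi * Complex.I * m * x) * b m 0‖ ^ 2 +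
        4 * ∫ y, ‖w x y‖ ^ 2 ∂volSym) ∂volSym := by
    refine integral_mono_ae i1 ((i2.const_mul 2).add (i3.const_mul 4)) ?_
    filter_upwards [ae_restrict_mem measurableSet_Ioo] with x hx using hpt x hx
  rw [integral_add (i2.const_mul 2) (i3.const_mul 4), integral_const_mul, integral_const_mul,
    parseval_trig, integral_integral_swap (f := fun x y => ‖w x y‖ ^ 2) hprod] at h1
  have h2 : ∫ y, ∫ x, ‖w x y‖ ^ 2 ∂volSym ∂volSym ≤ 4 * ∑ m ∈ s, B m ^ 2 := by
    have e : ∀ y, ∫ x, ‖w x y‖ ^ 2 ∂volSym ≤ 2 * ∑ m ∈ s, B m ^ 2 := by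
      intro y
      rw [parseval_trig s fun m => b' m y]
      gcongr with m _
      exact hB m y
    refine (integral_mono_ae hprod.integral_prod_right (integrable_const _)
      (Eventually.of_forall e)).trans_eq ?_
    rw [integral_const]
    simp [Measure.real]
    ring_nf
  linarith

end Estimate

/-! ### The blocks of a spectral collection -/

namespace SpectralCollection

variable {r : ℕ} (a : SpectralCollection r)

/-- The number of the interval `Δ_m` that contains `x`. -/
def _root_.DiracInverse.deltaIndex (x : ℝ) : ℤ := ⌈x / Real.pi - 1 / 2⌉

theorem _root_.DiracInverse.mem_Delta_iff {x : ℝ} {m : ℤ} : x ∈ Delta m ↔ deltaIndex x = m := by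
  rw [deltaIndex, Int.ceil_eq_iff, Delta, mem_Ioc]
  have hp := Real.pi_pos
  rw [lt_sub_iff_add_lt, sub_le_iff_le_add, lt_div_iff₀ hp, div_le_iff₀ hp]
  constructor <;> rintro ⟨h1, h2⟩ <;> constructor <;> linarith

/-- The left end -π(n - 1/2) is the right end of Δ_{-n}, so the window is the union of the Δ_m with
-n < m ≤ n. -/
theorem _root_.DiracInverse.mem_window_iff {x : ℝ} {n : ℕ} :
    x ∈ Ioc (-(Real.pi * (n - 1 / 2))) (Real.pi * (n + 1 / 2)) ↔
      deltaIndex x ∈ Finset.Ioc (-(n : ℤ)) n := by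
  rw [Finset.mem_Ioc, deltaIndex, Int.lt_ceil, Int.ceil_le, mem_Ioc]
  have hp := Real.pi_pos
  push_cast
  rw [lt_sub_iff_add_lt, sub_le_iff_le_add, lt_div_iff₀ hp, div_le_iff₀ hp]
  constructor <;> rintro ⟨h1, h2⟩ <;> constructor <;> linarith

theorem _root_.DiracInverse.deltaIndex_pi_mul (m : ℤ) : deltaIndex (Real.pi * m) = m := by
  rw [← mem_Delta_iff, Delta, mem_Ioc]
  have hp := Real.pi_pos
  constructor <;> linarith

variable {a}

theorem A1.finite (h1 : a.A1) (m : ℤ) : {j : ℤ | a.lam j ∈ Delta m}.Finite := by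
  obtain ⟨C, hC⟩ := h1.count
  exact Set.finite_of_encard_le_coe (hC m)

/-- The indices of the `λ_j` in `Δ_m`. -/
def A1.block (h1 : a.A1) (m : ℤ) : Finset ℤ := (h1.finite m).toFinset

theorem A1.mem_block (h1 : a.A1) {m j : ℤ} : j ∈ h1.block m ↔ deltaIndex (a.lam j) = m := by
  rw [A1.block, Set.Finite.mem_toFinset, Set.mem_ofPred_eq, mem_Delta_iff]

theorem A1.card_block_le (h1 : a.A1) : ∃ N : ℕ, ∀ m, (h1.block m).card ≤ N := by
  obtain ⟨C, hC⟩ := h1.count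
  refine ⟨C, fun m => ?_⟩
  have := hC m
  rw [(h1.finite m).encard_eq_coe_toFinset_card] at this
  exact_mod_cast this

theorem A1.pairwiseDisjoint_block (h1 : a.A1) (s : Set ℤ) : s.PairwiseDisjoint h1.block := by
  intro m _ k _ hmk
  rw [Function.onFun, Finset.disjoint_left]
  intro j hj hj'
  exact hmk ((h1.mem_block.1 hj).symm.trans (h1.mem_block.1 hj'))

theorem A1.finsum_block (h1 : a.A1) {M : Type*} [AddCommMonoid M] (f : ℤ → M) (m : ℤ) :
    ∑ᶠ (j : ℤ) (_ : a.lam j ∈ Delta m), f j = ∑ j ∈ h1.block m, f j := by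
  rw [← finsum_mem_coe_finset]
  refine finsum_congr fun j => ?_
  rw [Finset.mem_coe, h1.mem_block, mem_Delta_iff]

theorem A1.finsum_window (h1 : a.A1) {M : Type*} [AddCommMonoid M] (f : ℤ → M) (n : ℕ) :
    ∑ᶠ (j : ℤ) (_ : a.lam j ∈ Ioc (-(Real.pi * (n - 1 / 2))) (Real.pi * (n + 1 / 2))), f j =
      ∑ m ∈ Finset.Ioc (-(n : ℤ)) n, ∑ j ∈ h1.block m, f j := by
  rw [← Finset.sum_biUnion (h1.pairwiseDisjoint_block _), ← finsum_mem_coe_finset]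
  refine finsum_congr fun j => ?_
  rw [Finset.mem_coe, Finset.mem_biUnion, mem_window_iff]
  simp only [h1.mem_block, exists_eq_right']

theorem _root_.DiracInverse.finsum_window_pi {M : Type*} [AddCommMonoid M] (f : ℤ → M) (n : ℕ) :
    ∑ᶠ (m : ℤ) (_ : Real.pi * m ∈ Ioc (-(Real.pi * (n - 1 / 2))) (Real.pi * (n + 1 / 2))), f m =
      ∑ m ∈ Finset.Ioc (-(n : ℤ)) n, f m := by
  rw [← finsum_mem_coe_finset]
  refine finsum_congr fun j => ?_
  rw [Finset.mem_coe, mem_window_iff, deltaIndex_pi_mul]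

/-- `∫_{Δ_m} e^{2iλx} d(μ - μ₀)(λ)`. -/
def A1.blockFun (h1 : a.A1) (m : ℤ) (x : ℝ) : Mat (Fin r) :=
  (∑ j ∈ h1.block m, Complex.exp (2 * Complex.I * a.lam j * x) • a.alpha j) -
    Complex.exp (2 * Complex.I * (Real.pi * m : ℝ) * x) • (1 : Mat (Fin r))

theorem A1.truncatedTransform_eq (h1 : a.A1) (n : ℕ) (x : ℝ) :
    a.truncatedTransform n x = ∑ m ∈ Finset.Ioc (-(n : ℤ)) n, h1.blockFun m x := by
  rw [truncatedTransform, h1.finsum_window, finsum_window_pi, ← Finset.sum_sub_distrib]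
  rfl

theorem A1.continuous_blockFun (h1 : a.A1) (m : ℤ) : Continuous (h1.blockFun m) := by
  unfold A1.blockFun
  fun_prop

theorem _root_.DiracInverse.memLp_volSym_of_continuous {E : Type*} [NormedAddCommGroup E]
    {f : ℝ → E} (hf : Continuous f) : MemLp f 2 volSym := by
  obtain ⟨C, hC⟩ := (isCompact_Icc (a := (-1 : ℝ)) (b := 1)).exists_bound_of_continuousOn
    hf.continuousOn
  refine MemLp.of_bound hf.aestronglyMeasurable C ?_
  filter_upwards [ae_restrict_mem measurableSet_Ioo] with x hx using hC x (Ioo_subset_Icc_self hx)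

/-- The class of `blockFun`. -/
def A1.blockClass (h1 : a.A1) (m : ℤ) : L2Sym r := l2Class volSym (h1.blockFun m)

theorem A1.l2Class_truncatedTransform (h1 : a.A1) (n : ℕ) :
    l2Class volSym (a.truncatedTransform n) = ∑ m ∈ Finset.Ioc (-(n : ℤ)) n, h1.blockClass m := by
  have e : a.truncatedTransform n = fun x => ∑ m ∈ Finset.Ioc (-(n : ℤ)) n, h1.blockFun m x :=
    funext fun x => h1.truncatedTransform_eq n x
  rw [e, l2Class_sum _ _ fun m _ => memLp_volSym_of_continuous (h1.continuous_blockFun m)]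
  rfl

open scoped MatrixOrder in
-- The α_j are nonnegative, so each is dominated by the sum over its block, and the block sums stay
-- at bounded distance from the identity.
theorem A1.exists_alpha_le (h1 : a.A1) : ∃ A, 0 ≤ A ∧ ∀ j, ‖a.alpha j‖ ≤ A := by
  have hs := h1.alpha_asymp
  simp only [h1.finsum_block] at hs
  set S := ∑' n : ℤ, ‖(1 : Mat (Fin r)) - ∑ j ∈ h1.block n, a.alpha j‖ ^ 2
  have hS : ∀ m, ‖(1 : Mat (Fin r)) - ∑ j ∈ h1.block m, a.alpha j‖ ≤ √S := fun m =>
    Real.le_sqrt_of_sq_le (hs.le_tsum m fun k _ => sq_nonneg _)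
  refine ⟨‖(1 : Mat (Fin r))‖ + √S, by positivity, fun j => ?_⟩
  set m := deltaIndex (a.lam j)
  have hj : j ∈ h1.block m := h1.mem_block.2 rfl
  have h2 : ‖a.alpha j‖ ≤ ‖∑ j ∈ h1.block m, a.alpha j‖ := by
    refine CStarAlgebra.norm_le_norm_of_nonneg_of_le (a.alpha_nonneg j).nonneg ?_
    exact Finset.single_le_sum (fun i _ => (a.alpha_nonneg i).nonneg) hj
  have h3 : ∑ j ∈ h1.block m, a.alpha j =
      (1 : Mat (Fin r)) - ((1 : Mat (Fin r)) - ∑ j ∈ h1.block m, a.alpha j) := by abel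
  calc ‖a.alpha j‖ ≤ ‖∑ j ∈ h1.block m, a.alpha j‖ := h2
    _ ≤ _ := by rw [h3]; exact (norm_sub_le _ _).trans (add_le_add_right (hS m) _)

theorem _root_.DiracInverse.norm_sq_le_entries (A : Mat (Fin r)) :
    ‖A‖ ^ 2 ≤ r ^ 2 * ∑ k, ∑ i, ‖A k i‖ ^ 2 := by
  have h1 := pow_le_pow_left₀ (norm_nonneg _) (norm_le_sum_entries A) 2
  refine h1.trans ?_
  have h2 := sq_sum_le_card_mul_sum_sq (s := Finset.univ (α := Fin r × Fin r))
    (f := fun p => ‖A p.1 p.2‖)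
  rw [Fintype.sum_prod_type, Fintype.sum_prod_type] at h2
  refine h2.trans_eq ?_
  simp [sq]

/-- Entry by entry, e^{2πimx} is factored out of the m-th block. What remains varies slowly: its
derivative is controlled by the deviations |λ_j - πm| and its value at 0 by the deviation of the
block sum from I, so `trig_estimate` applies. -/
theorem A1.exists_norm_sum_le (h1 : a.A1) : ∃ C : ℝ, 0 ≤ C ∧ ∀ s : Finset ℤ,
    ‖∑ m ∈ s, h1.blockClass m‖ ^ 2 ≤ C * ∑ m ∈ s,
      (‖(1 : Mat (Fin r)) - ∑ j ∈ h1.block m, a.alpha j‖ ^ 2 +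
        ∑ j ∈ h1.block m, |a.lam j - Real.pi * m| ^ 2) := by
  obtain ⟨A, hA0, hA⟩ := h1.exists_alpha_le
  obtain ⟨N, hN⟩ := h1.card_block_le
  set β : ℤ → ℝ := fun m => ‖(1 : Mat (Fin r)) - ∑ j ∈ h1.block m, a.alpha j‖ with hβ
  set γ : ℤ → ℝ := fun m => ∑ j ∈ h1.block m, |a.lam j - Real.pi * m| ^ 2 with hγ
  -- The 4 and 64 = 16·4 come from `trig_estimate` with `hB2`. In the final constant r⁴ D, one
  -- factor r² compares the operator norm with the entries and the other counts the entries.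
  set D : ℝ := 4 + 64 * A ^ 2 * N with hD
  refine ⟨r ^ 4 * D, by positivity, fun s => ?_⟩
  set B : ℤ → ℝ := fun m => ∑ j ∈ h1.block m, 2 * |a.lam j - Real.pi * m| * A with hB
  have hB2 : ∀ m, B m ^ 2 ≤ 4 * A ^ 2 * N * γ m := by
    intro m
    have e : B m = 2 * A * ∑ j ∈ h1.block m, |a.lam j - Real.pi * m| := by
      rw [hB, Finset.mul_sum]; refine Finset.sum_congr rfl fun j _ => by ring
    rw [e, mul_pow]
    have h2 := sq_sum_le_card_mul_sum_sq (s := h1.block m) (f := fun j => |a.lam j - Real.pi * m|)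
    have h3 : ((h1.block m).card : ℝ) ≤ N := by exact_mod_cast hN m
    have h4 : 0 ≤ γ m := Finset.sum_nonneg fun j _ => sq_nonneg _
    calc (2 * A) ^ 2 * (∑ j ∈ h1.block m, |a.lam j - Real.pi * m|) ^ 2
        ≤ (2 * A) ^ 2 * (N * γ m) := by
          gcongr
          exact h2.trans (mul_le_mul_of_nonneg_right h3 h4)
      _ = _ := by ring
  have hent : ∀ k i, ∫ x : ℝ, ‖(∑ m ∈ s, h1.blockFun m x) k i‖ ^ 2 ∂volSym ≤
      D * ∑ m ∈ s, (β m ^ 2 + γ m) := by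
    intro k i
    set b : ℤ → ℝ → ℂ := fun m x => (∑ j ∈ h1.block m,
      Complex.exp (2 * Complex.I * (a.lam j - Real.pi * m : ℝ) * x) * a.alpha j k i) -
        (1 : Mat (Fin r)) k i with hb
    set b' : ℤ → ℝ → ℂ := fun m x => ∑ j ∈ h1.block m,
      Complex.exp (2 * Complex.I * (a.lam j - Real.pi * m : ℝ) * x) *
        (2 * Complex.I * (a.lam j - Real.pi * m : ℝ)) * a.alpha j k i with hb'
    have hder : ∀ m x, HasDerivAt (b m) (b' m x) x := by
      intro m x
      refine HasDerivAt.sub_const _ ?_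
      refine HasDerivAt.fun_sum fun j _ => ?_
      refine HasDerivAt.mul_const ?_ _
      have h2 : HasDerivAt (fun x : ℝ => 2 * Complex.I * (a.lam j - Real.pi * m : ℝ) * (x : ℂ))
          (2 * Complex.I * (a.lam j - Real.pi * m : ℝ)) x := by
        simpa using (Complex.ofRealCLM.hasDerivAt (x := x)).const_mul
          (2 * Complex.I * (a.lam j - Real.pi * m : ℝ))
      exact h2.cexp
    have hbnd : ∀ m x, ‖b' m x‖ ≤ B m := by
      intro m x
      refine (norm_sum_le _ _).trans (Finset.sum_le_sum fun j _ => ?_)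
      have e : 2 * Complex.I * ((a.lam j - Real.pi * m : ℝ) : ℂ) * x =
          ((2 * (a.lam j - Real.pi * m) * x : ℝ) : ℂ) * Complex.I := by push_cast; ring
      rw [norm_mul, norm_mul, e, Complex.norm_exp_ofReal_mul_I, one_mul]
      have e2 : ‖2 * Complex.I * ((a.lam j - Real.pi * m : ℝ) : ℂ)‖ = 2 * |a.lam j - Real.pi * m| := by
        rw [norm_mul, norm_mul, Complex.norm_real]; simp
      rw [e2]
      gcongr
      exact (norm_entry_le _ _ _).trans (hA j)
    have hval : ∀ x : ℝ, (∑ m ∈ s, h1.blockFun m x) k i =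
        ∑ m ∈ s, Complex.exp (2 * Real.pi * Complex.I * m * x) * b m x := by
      intro x
      rw [Matrix.sum_apply]
      refine Finset.sum_congr rfl fun m _ => ?_
      rw [A1.blockFun, Matrix.sub_apply, Matrix.sum_apply, hb]
      simp only [Matrix.smul_apply, smul_eq_mul, mul_sub, Finset.mul_sum]
      congr 1
      · refine Finset.sum_congr rfl fun j _ => ?_
        rw [← mul_assoc, ← Complex.exp_add]
        congr 2
        push_cast; ring
      · congr 2
        push_cast; ring
    have hb0 : ∀ m, ‖b m 0‖ ≤ β m := by
      intro m
      have e : b m 0 = -(((1 : Mat (Fin r)) - ∑ j ∈ h1.block m, a.alpha j) k i) := by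
        rw [hb, Matrix.sub_apply, Matrix.sum_apply]; simp
      rw [e, norm_neg]
      exact norm_entry_le _ _ _
    simp only [hval]
    refine (trig_estimate s hder (fun m => by simp only [hb']; fun_prop) hbnd).trans ?_
    rw [Finset.mul_sum, Finset.mul_sum, Finset.mul_sum, ← Finset.sum_add_distrib]
    refine Finset.sum_le_sum fun m _ => ?_
    have h2 : ‖b m 0‖ ^ 2 ≤ β m ^ 2 := pow_le_pow_left₀ (norm_nonneg _) (hb0 m) 2
    have h3 := hB2 m
    have h4 : 0 ≤ γ m := Finset.sum_nonneg fun j _ => sq_nonneg _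
    have h5 : 0 ≤ A ^ 2 * N * β m ^ 2 := by positivity
    rw [hD]
    nlinarith
  have hm : MemLp (fun x => ∑ m ∈ s, h1.blockFun m x) 2 volSym :=
    memLp_volSym_of_continuous (continuous_finsetSum _ fun m _ => h1.continuous_blockFun m)
  have e : ∑ m ∈ s, h1.blockClass m = l2Class volSym fun x => ∑ m ∈ s, h1.blockFun m x := by
    rw [l2Class_sum _ _ fun m _ => memLp_volSym_of_continuous (h1.continuous_blockFun m)]
    rfl
  rw [e, norm_l2Class_sq hm]
  have hi : ∀ k i, Integrable (fun x => ‖(∑ m ∈ s, h1.blockFun m x) k i‖ ^ 2) volSym :=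
    fun k i => (memLp_entry hm k i).integrable_norm_pow two_ne_zero
  calc ∫ x, ‖∑ m ∈ s, h1.blockFun m x‖ ^ 2 ∂volSym
      ≤ ∫ x, (r : ℝ) ^ 2 * ∑ k, ∑ i, ‖(∑ m ∈ s, h1.blockFun m x) k i‖ ^ 2 ∂volSym := by
        refine integral_mono_ae (hm.integrable_norm_pow two_ne_zero) ?_
          (Eventually.of_forall fun x => norm_sq_le_entries _)
        exact (integrable_finsetSum _ fun k _ => integrable_finsetSum _ fun i _ => hi k i).const_mul _
    _ = (r : ℝ) ^ 2 * ∑ k, ∑ i, ∫ x, ‖(∑ m ∈ s, h1.blockFun m x) k i‖ ^ 2 ∂volSym := by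
        rw [integral_const_mul, integral_finsetSum _ fun k _ =>
          integrable_finsetSum _ fun i _ => hi k i]
        congr 1
        refine Finset.sum_congr rfl fun k _ => ?_
        rw [integral_finsetSum _ fun i _ => hi k i]
    _ ≤ (r : ℝ) ^ 2 * ∑ k : Fin r, ∑ i : Fin r, D * ∑ m ∈ s, (β m ^ 2 + γ m) := by
        gcongr with k _ i _
        exact hent k i
    _ = _ := by
        simp only [Finset.sum_const, Finset.card_univ, Fintype.card_fin, nsmul_eq_mul]
        ring

/-- By (A₁) the majorants are summable, which gives the Cauchy criterion over arbitrary finite sets.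
The summability is thus unconditional although the norms of the single blocks are only
square-summable. -/
theorem A1.summable_blockClass (h1 : a.A1) : Summable h1.blockClass := by
  obtain ⟨C, hC0, hC⟩ := h1.exists_norm_sum_le
  have hs := h1.alpha_asymp.add h1.lam_asymp
  simp only [h1.finsum_block] at hs
  rw [summable_iff_vanishing_norm]
  intro ε hε
  obtain ⟨s, hs⟩ := summable_iff_vanishing_norm.1 hs (ε ^ 2 / (C + 1)) (by positivity)
  refine ⟨s, fun t ht => ?_⟩
  have h2 := (Real.le_norm_self _).trans_lt (hs t ht)
  have h3 := hC t
  refine lt_of_pow_lt_pow_left₀ 2 hε.le ?_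
  rw [lt_div_iff₀ (by positivity)] at h2
  have h4 : 0 ≤ ∑ m ∈ t, (‖(1 : Mat (Fin r)) - ∑ j ∈ h1.block m, a.alpha j‖ ^ 2 +
        ∑ j ∈ h1.block m, |a.lam j - Real.pi * m| ^ 2) := by positivity
  nlinarith

theorem _root_.DiracInverse.tendsto_window :
    Tendsto (fun n : ℕ => Finset.Ioc (-(n : ℤ)) n) atTop atTop := by
  refine tendsto_atTop_finset_of_monotone (fun n m h => ?_) fun x => ⟨x.natAbs + 1, ?_⟩
  · exact Finset.Ioc_subset_Ioc (by omega) (by omega)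
  · rw [Finset.mem_Ioc]; omega

theorem A1.tendsto_tsum (h1 : a.A1) :
    Tendsto (fun n : ℕ => l2Class volSym (a.truncatedTransform n)) atTop
      (𝓝 (∑' m, h1.blockClass m)) := by
  simp only [h1.l2Class_truncatedTransform]
  exact h1.summable_blockClass.hasSum.comp tendsto_window

theorem A1.hmu_eq (h1 : a.A1) : a.Hmu = ∑' m, h1.blockClass m := h1.tendsto_tsum.limUnder_eq

theorem A1.tendsto_hmu (h1 : a.A1) :
    Tendsto (fun n : ℕ => l2Class volSym (a.truncatedTransform n)) atTop (𝓝 a.Hmu) := by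
  rw [h1.hmu_eq]; exact h1.tendsto_tsum

theorem A1.hasSum_hmu (h1 : a.A1) : HasSum h1.blockClass a.Hmu := by
  rw [h1.hmu_eq]; exact h1.summable_blockClass.hasSum

/-- The truncated transforms have the symmetry pointwise because the α_j are Hermitian; it passes to
the limit along a subsequence converging almost everywhere. -/
theorem A1.hmu_symm (h1 : a.A1) : ∀ᵐ x ∂volSym, (a.Hmu x)ᴴ = a.Hmu (-x) := by
  obtain ⟨ns, -, hns⟩ := (tendstoInMeasure_of_tendsto_Lp h1.tendsto_hmu).exists_seq_tendsto_ae
  have hc : ∀ n, Continuous (a.truncatedTransform n) := fun n => by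
    have e : a.truncatedTransform n = fun x => ∑ m ∈ Finset.Ioc (-(n : ℤ)) n, h1.blockFun m x :=
      funext fun x => h1.truncatedTransform_eq n x
    rw [e]
    exact continuous_finsetSum _ fun m _ => h1.continuous_blockFun m
  have hsym : ∀ n x, (a.truncatedTransform n x)ᴴ = a.truncatedTransform n (-x) := by
    have hexp : ∀ z x : ℝ, star (Complex.exp (2 * Complex.I * z * x)) =
        Complex.exp (2 * Complex.I * z * ((-x : ℝ) : ℂ)) := by
      intro z x
      change (starRingEnd ℂ) _ = _
      rw [star_exp_two]; congr 1; push_cast; ring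
    intro n x
    simp only [h1.truncatedTransform_eq, A1.blockFun, Matrix.conjTranspose_sum,
      Matrix.conjTranspose_sub, Matrix.conjTranspose_smul, (a.alpha_nonneg _).isHermitian.eq,
      Matrix.conjTranspose_one, hexp]
  have h2 : ∀ᵐ x ∂volSym, Tendsto (fun i => a.truncatedTransform (ns i) x) atTop (𝓝 (a.Hmu x)) := by
    filter_upwards [hns, ae_all_iff.2 fun i => coeFn_l2Class
      (memLp_volSym_of_continuous (hc (ns i)))] with x hx h3
    simpa only [h3] using hx
  have hneg : Measure.QuasiMeasurePreserving (fun x : ℝ => -x) volSym volSym := by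
    refine ⟨measurable_neg, ?_⟩
    have h3 : volSym.map (fun x : ℝ => -x) = volSym := by
      have h4 := (Measure.measurePreserving_neg (volume : Measure ℝ)).restrict_preimage
        (s := Ioo (-1 : ℝ) 1) measurableSet_Ioo
      have h5 : (Neg.neg ⁻¹' Ioo (-1 : ℝ) 1) = Ioo (-1 : ℝ) 1 := by
        ext x; simp only [mem_preimage, mem_Ioo]; constructor <;> rintro ⟨h, h'⟩ <;>
          constructor <;> linarith
      rw [h5] at h4
      exact h4.map_eq
    rw [h3]
  filter_upwards [h2, hneg.ae h2] with x hx hx'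
  refine tendsto_nhds_unique ((continuous_id.matrix_conjTranspose.tendsto _).comp hx) ?_
  simpa only [Function.comp_def, id, hsym] using hx'

end SpectralCollection

/-! ### The operator `∑_j Ψ(λ_j) α_j Ψ(λ_j)*` -/

namespace SpectralCollection

variable {r : ℕ} {a : SpectralCollection r}

theorem A1.convSym_blockClass (h1 : a.A1) (m : ℤ) : convSym (h1.blockClass m) =
    (∑ j ∈ h1.block m, expTerm (a.lam j) (a.alpha j)) - expTerm (Real.pi * m) 1 := by
  have e : h1.blockClass m = (∑ j ∈ h1.block m,
      l2Class volSym fun x : ℝ => Complex.exp (2 * Complex.I * a.lam j * x) • a.alpha j) -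
      l2Class volSym fun x : ℝ => Complex.exp (2 * Complex.I * (Real.pi * m : ℝ) * x) •
        (1 : Mat (Fin r)) := by
    have hm : MemLp (fun x : ℝ => ∑ j ∈ h1.block m,
        Complex.exp (2 * Complex.I * a.lam j * x) • a.alpha j) 2 volSym :=
      memLp_volSym_of_continuous (by fun_prop)
    rw [← l2Class_sum _ _ fun j _ => memLp_exp_smul_sym _ _,
      ← l2Class_sub hm (memLp_exp_smul_sym _ _)]
    rfl
  rw [e, convSym_sub, convSym_exp, ← convSymHom_apply, map_sum]
  simp only [convSymHom_apply, convSym_exp]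

/-- `1` plus the convolution with `H_μ`. -/
def accOp (a : SpectralCollection r) : L2v (Fin r) →L[ℂ] L2v (Fin r) := 1 + convSym a.Hmu

theorem A1.hasSum_convSym (h1 : a.A1) :
    HasSum (fun m => convSym (h1.blockClass m)) (convSym a.Hmu) := by
  have := h1.hasSum_hmu.map convSymHom continuous_convSymHom
  exact this

/-- Each block equals the m-th Fourier projection plus the convolution with the m-th block of H_μ.
The projections sum to the identity and the convolutions to T. -/
theorem A1.hasSum_blocks (h1 : a.A1) (f : L2v (Fin r)) :
    HasSum (fun m => ∑ j ∈ h1.block m, expTerm (a.lam j) (a.alpha j) f) (accOp a f) := by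
  have h2 := h1.hasSum_convSym.map (ContinuousLinearMap.apply ℂ (L2v (Fin r)) f)
    (ContinuousLinearMap.apply ℂ (L2v (Fin r)) f).continuous
  have h3 := (hasSum_fourier f).add h2
  have e : (fun m : ℤ => ∑ j ∈ h1.block m, expTerm (a.lam j) (a.alpha j) f) =
      fun m : ℤ => expTerm (Real.pi * m) 1 f +
        ((ContinuousLinearMap.apply ℂ (L2v (Fin r)) f) ∘ fun m => convSym (h1.blockClass m)) m := by
    funext m
    rw [Function.comp_apply, ContinuousLinearMap.apply_apply, h1.convSym_blockClass, sub_apply,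
      sum_apply]
    abel
  rw [e]
  exact h3

theorem A1.adjoint_convSym (h1 : a.A1) :
    ContinuousLinearMap.adjoint (convSym a.Hmu) = convSym a.Hmu := by
  have h2 := h1.hasSum_convSym.star
  refine h2.unique ?_
  have e : (fun m => star (convSym (h1.blockClass m))) = fun m => convSym (h1.blockClass m) := by
    funext m
    rw [ContinuousLinearMap.star_eq_adjoint, h1.convSym_blockClass, map_sub, map_sum,
      adjoint_expTerm Matrix.isHermitian_one]
    congr 1
    exact Finset.sum_congr rfl fun j _ => adjoint_expTerm (a.alpha_nonneg j).isHermitian _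
  rw [e]
  exact h1.hasSum_convSym

theorem A1.hasSum_inner_blocks (h1 : a.A1) (f : L2v (Fin r)) :
    HasSum (fun m => ∑ j ∈ h1.block m, (⟪expTerm (a.lam j) (a.alpha j) f, f⟫_ℂ).re)
      (⟪accOp a f, f⟫_ℂ).re := by
  have h2 : Continuous fun g : L2v (Fin r) => (⟪g, f⟫_ℂ).re :=
    Complex.continuous_re.comp (continuous_id.inner continuous_const)
  let φ : L2v (Fin r) →+ ℝ :=
    { toFun := fun g => (⟪g, f⟫_ℂ).re
      map_zero' := by simp
      map_add' := fun g g' => by simp [inner_add_left] }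
  have h3 := (h1.hasSum_blocks f).map φ h2
  have e : (fun m => ∑ j ∈ h1.block m, (⟪expTerm (a.lam j) (a.alpha j) f, f⟫_ℂ).re) =
      φ ∘ fun m => ∑ j ∈ h1.block m, expTerm (a.lam j) (a.alpha j) f := by
    funext m
    rw [Function.comp_apply, map_sum]
    rfl
  rw [e]
  exact h3

/-- All terms are nonnegative, so a finite set of indices may be enlarged to a union of whole
blocks, whose total is bounded by the limit. -/
theorem A1.sum_inner_le (h1 : a.A1) (f : L2v (Fin r)) (s : Finset ℤ) :
    ∑ j ∈ s, (⟪expTerm (a.lam j) (a.alpha j) f, f⟫_ℂ).re ≤ (⟪accOp a f, f⟫_ℂ).re := by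
  set t := s.image fun j => deltaIndex (a.lam j) with ht
  have h2 : ∑ m ∈ t, ∑ j ∈ h1.block m, (⟪expTerm (a.lam j) (a.alpha j) f, f⟫_ℂ).re ≤
      (⟪accOp a f, f⟫_ℂ).re :=
    sum_le_hasSum t (fun m _ => Finset.sum_nonneg fun j _ =>
      expTerm_re_nonneg (a.alpha_nonneg j) _ _) (h1.hasSum_inner_blocks f)
  refine le_trans ?_ h2
  rw [← Finset.sum_biUnion (h1.pairwiseDisjoint_block _)]
  refine Finset.sum_le_sum_of_subset_of_nonneg (fun j hj => ?_) fun j _ _ =>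
    expTerm_re_nonneg (a.alpha_nonneg j) _ _
  exact Finset.mem_biUnion.2 ⟨_, Finset.mem_image_of_mem _ hj, h1.mem_block.2 rfl⟩

theorem re_inner_accOp_le (a : SpectralCollection r) (f : L2v (Fin r)) :
    (⟪accOp a f, f⟫_ℂ).re ≤ (‖accOp a‖ + 1) * ‖f‖ ^ 2 := by
  refine (Complex.re_le_norm _).trans ((norm_inner_le_norm _ _).trans ?_)
  have := (accOp a).le_opNorm f
  nlinarith [norm_nonneg f]

/-- The quadratic forms of the terms are summable. Every finite partial sum S is a positive operator
below `accOp a`, so ‖Sf‖² is at most a constant times ⟪Sf,f⟫, which turns summability of the forms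
into strong summability. -/
theorem A1.summable_terms (h1 : a.A1) (f : L2v (Fin r)) :
    Summable fun j => expTerm (a.lam j) (a.alpha j) f := by
  set C := ‖accOp a‖ + 1 with hC
  have hC0 : 0 < C := by positivity
  have h2 : Summable fun j => (⟪expTerm (a.lam j) (a.alpha j) f, f⟫_ℂ).re :=
    summable_of_sum_le (fun j => expTerm_re_nonneg (a.alpha_nonneg j) _ _) (h1.sum_inner_le f)
  have hsum : ∀ (s : Finset ℤ) (g : L2v (Fin r)),
      (⟪(∑ j ∈ s, expTerm (a.lam j) (a.alpha j)) g, g⟫_ℂ).re =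
        ∑ j ∈ s, (⟪expTerm (a.lam j) (a.alpha j) g, g⟫_ℂ).re := by
    intro s g
    rw [sum_apply, sum_inner, Complex.re_sum]
  rw [summable_iff_vanishing_norm]
  intro ε hε
  obtain ⟨s, hs⟩ := summable_iff_vanishing_norm.1 h2 (ε ^ 2 / C) (by positivity)
  refine ⟨s, fun t ht => ?_⟩
  have h3 := (Real.le_norm_self _).trans_lt (hs t ht)
  have h4 := norm_sq_le_of_nonneg (S := ∑ j ∈ t, expTerm (a.lam j) (a.alpha j))
    (by rw [map_sum]; exact Finset.sum_congr rfl fun j _ =>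
          adjoint_expTerm (a.alpha_nonneg j).isHermitian _)
    (fun g => by
      rw [hsum]; exact Finset.sum_nonneg fun j _ => expTerm_re_nonneg (a.alpha_nonneg j) _ _)
    hC0 (fun g => by rw [hsum]; exact (h1.sum_inner_le g t).trans (re_inner_accOp_le a g)) f
  rw [hsum, sum_apply] at h4
  refine lt_of_pow_lt_pow_left₀ 2 hε.le (h4.trans_lt ?_)
  rwa [lt_div_iff₀' hC0] at h3

/-- Regrouping the unconditionally convergent series into blocks identifies its sum with the one
found in `A1.hasSum_blocks`. -/
theorem A1.hasSum_terms (h1 : a.A1) (f : L2v (Fin r)) :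
    HasSum (fun j => expTerm (a.lam j) (a.alpha j) f) (accOp a f) := by
  have h2 := (h1.summable_terms f).hasSum
  have h3 := ((Equiv.sigmaFiberEquiv fun j => deltaIndex (a.lam j)).hasSum_iff.2 h2).sigma
    (g := fun m => ∑ j ∈ h1.block m, expTerm (a.lam j) (a.alpha j) f) fun m => by
      refine (hasSum_subtype_iff_indicator
        (f := fun j => expTerm (a.lam j) (a.alpha j) f) (s := {j | deltaIndex (a.lam j) = m})).2 ?_
      have h4 : ∑ j ∈ h1.block m, expTerm (a.lam j) (a.alpha j) f = ∑ j ∈ h1.block m,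
          {j | deltaIndex (a.lam j) = m}.indicator (fun j => expTerm (a.lam j) (a.alpha j) f) j :=
        Finset.sum_congr rfl fun j hj => by
          rw [indicator_of_mem]; exact h1.mem_block.1 hj
      rw [h4]
      refine hasSum_sum_of_ne_finset_zero fun j hj => indicator_of_notMem ?_ _
      exact fun h => hj (h1.mem_block.2 h)
  rw [(h1.hasSum_blocks f).unique h3]
  exact h2

theorem accOp_re_nonneg (h1 : a.A1) (f : L2v (Fin r)) : 0 ≤ (⟪accOp a f, f⟫_ℂ).re := by
  simpa using h1.sum_inner_le f ∅

theorem A1.adjoint_accOp (h1 : a.A1) : ContinuousLinearMap.adjoint (accOp a) = accOp a := by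
  rw [accOp, map_add, adjoint_one_eq, h1.adjoint_convSym]

theorem _root_.DiracInverse.act_eq_zero_of_re_inner {n : Type} [Fintype n] [DecidableEq n]
    {A : Mat n} (hA : A.PosSemidef) {v : EuclideanSpace ℂ n} (h : (⟪act A v, v⟫_ℂ).re = 0) :
    act A v = 0 := by
  have h2 := norm_sq_le_of_nonneg (S := act A) (by rw [adjoint_act, hA.isHermitian.eq])
    (inner_act_re_nonneg hA) (C := ‖act A‖ + 1) (by positivity) (fun f => by
      refine (Complex.re_le_norm _).trans ((norm_inner_le_norm _ _).trans ?_)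
      have := (act A).le_opNorm f
      nlinarith [norm_nonneg f]) v
  rw [h, mul_zero] at h2
  have := pow_eq_zero_iff two_ne_zero |>.1 (le_antisymm h2 (sq_nonneg _))
  exact norm_eq_zero.1 this

/-- Completeness of the exponentials, transferred to `(0,1)`. -/
theorem A3.eq_zero (h3 : a.A3) {f : L2v (Fin r)}
    (hf : ∀ j c, ⟪expOp (a.lam j) (act (a.alpha j) c), f⟫_ℂ = 0) : f = 0 := by
  have hmem0 : MemLp ((Ioo (0 : ℝ) 1).indicator f) 2 volume :=
    (memLp_indicator_iff_restrict measurableSet_Ioo).2 (Lp.memLp f)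
  have hmem : MemLp (fun t : ℝ => (Ioo (0 : ℝ) 1).indicator f (1 / 2 + 1 / 2 * t)) 2 volSym :=
    (memLp_comp_affine hmem0 (1 / 2) (b := 1 / 2) (by norm_num)).restrict _
  set F : Lp (EuclideanSpace ℂ (Fin r)) 2 volSym :=
    l2Class volSym fun t : ℝ => (Ioo (0 : ℝ) 1).indicator f (1 / 2 + 1 / 2 * t) with hF
  have hF0 : F = 0 := by
    have h4 : (Submodule.span ℂ {g : Lp (EuclideanSpace ℂ (Fin r)) 2 volSym |
        ∃ (j : ℤ) (c : EuclideanSpace ℂ (Fin r)), g =ᵐ[volSym] fun t : ℝ =>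
          Complex.exp (Complex.I * a.lam j * t) • act (a.alpha j) c})ᗮ = ⊥ := by
      rw [← Submodule.orthogonal_closure, h3, Submodule.top_orthogonal_eq_bot]
    rw [← Submodule.mem_bot ℂ, ← h4, Submodule.mem_orthogonal]
    intro g hg
    induction hg using Submodule.span_induction with
    | mem g hg =>
      obtain ⟨j, c, hg⟩ := hg
      set d := act (a.alpha j) c with hd
      -- Under t = 2x - 1 the exponential e^{iλt} becomes e^{-iλ}e^{2iλx}, so up to a nonzero
      -- constant the pairing on (-1,1) is the one assumed to vanish on (0,1).
      have e1 : ⟪g, F⟫_ℂ = ∫ t : ℝ in (-1 : ℝ)..1,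
          (fun x : ℝ => Complex.exp (-(Complex.I * a.lam j * (2 * x - 1))) *
            ⟪d, (Ioo (0 : ℝ) 1).indicator f x⟫_ℂ) (1 / 2 + 1 / 2 * t) := by
        rw [L2.inner_def, intervalIntegral.integral_of_le (by norm_num),
          integral_Ioc_eq_integral_Ioo]
        refine integral_congr_ae ?_
        filter_upwards [hg, coeFn_l2Class hmem] with t h5 h6
        rw [h5, hF, h6, inner_smul_left, ← Complex.exp_conj]
        congr 2
        simp only [map_mul, Complex.conj_I, Complex.conj_ofReal]
        push_cast; ring
      have hhalf : (1 / 2 : ℝ) ≠ 0 := by norm_num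
      rw [e1, intervalIntegral.integral_comp_add_mul (c := 1 / 2) (fun x : ℝ =>
        Complex.exp (-(Complex.I * a.lam j * (2 * x - 1))) *
          ⟪d, (Ioo (0 : ℝ) 1).indicator f x⟫_ℂ) hhalf]
      have e2 : (1 / 2 + 1 / 2 * (-1) : ℝ) = 0 := by norm_num
      have e3 : (1 / 2 + 1 / 2 * 1 : ℝ) = 1 := by norm_num
      rw [e2, e3, ← integral_vol01_eq]
      have e4 : ∫ x : ℝ, Complex.exp (-(Complex.I * a.lam j * (2 * x - 1))) *
          ⟪d, (Ioo (0 : ℝ) 1).indicator f x⟫_ℂ ∂vol01 =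
          Complex.exp (Complex.I * a.lam j) * ⟪expOp (a.lam j) d, f⟫_ℂ := by
        rw [inner_expOp, ← integral_const_mul]
        refine integral_congr_ae ?_
        filter_upwards [ae_vol01_mem] with x hx
        rw [indicator_of_mem hx, ← mul_assoc, ← Complex.exp_add]
        congr 2
        ring
      rw [e4, hf, mul_zero, smul_zero]
    | zero => simp
    | add g g' _ _ h h' => rw [inner_add_left, h, h', add_zero]
    | smul c g _ h => rw [inner_smul_left, h, mul_zero]
  have h5 : ∀ᵐ t : ℝ, t ∈ Ioo (-1 : ℝ) 1 →
      (Ioo (0 : ℝ) 1).indicator f (1 / 2 + 1 / 2 * t) = 0 := by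
    refine (ae_restrict_iff' measurableSet_Ioo).1 ?_
    filter_upwards [coeFn_l2Class hmem, Lp.coeFn_zero (EuclideanSpace ℂ (Fin r)) 2 volSym]
      with t h6 h7
    rw [← h6, ← hF, hF0, h7, Pi.zero_apply]
  have h6 := (quasiMeasurePreserving_affine (-1) (b := 2) two_ne_zero).ae h5
  apply Lp.ext
  filter_upwards [ae_restrict_of_ae h6, ae_vol01_mem,
    Lp.coeFn_zero (EuclideanSpace ℂ (Fin r)) 2 vol01] with x h7 hx h8
  have e : (1 / 2 + 1 / 2 * (-1 + 2 * x) : ℝ) = x := by ring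
  rw [e, indicator_of_mem hx] at h7
  rw [h7 ⟨by linarith [hx.1], by linarith [hx.2]⟩, h8, Pi.zero_apply]

/-- If the sum annihilates f, every nonnegative term of its quadratic form vanishes, so α_jΨ(λ_j)*f
= 0 for all j. Thus f is orthogonal to a complete system. -/
theorem accOp_injective (h1 : a.A1) (h3 : a.A3) {f : L2v (Fin r)} (hf : accOp a f = 0) : f = 0 := by
  refine A3.eq_zero h3 fun j c => ?_
  have h4 := h1.sum_inner_le f {j}
  rw [hf, inner_zero_left, Complex.zero_re, Finset.sum_singleton] at h4
  have h5 := le_antisymm h4 (expTerm_re_nonneg (a.alpha_nonneg j) _ _)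
  rw [inner_expTerm] at h5
  have h6 := act_eq_zero_of_re_inner (a.alpha_nonneg j) h5
  rw [← ContinuousLinearMap.adjoint_inner_right, ← ContinuousLinearMap.adjoint_inner_right,
    adjoint_act, (a.alpha_nonneg j).isHermitian.eq, h6, inner_zero_right]

/-- T is a norm limit of finite sums of operators that factor through ℂʳ. -/
theorem A1.isCompactOperator_convSym (h1 : a.A1) : IsCompactOperator (convSym a.Hmu) := by
  have hc : ∀ m, IsCompactOperator (convSym (h1.blockClass m)) := by
    intro m
    rw [h1.convSym_blockClass]
    have h2 : ∀ s : Finset ℤ,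
        (∑ j ∈ s, expTerm (a.lam j) (a.alpha j)) ∈ compactOperator (RingHom.id ℂ) _ _ := fun s =>
      Submodule.sum_mem _ fun j _ => isCompactOperator_expTerm _ _
    exact (h2 _ : IsCompactOperator _).sub (isCompactOperator_expTerm _ _)
  refine isCompactOperator_of_tendsto h1.hasSum_convSym (Eventually.of_forall fun s => ?_)
  have h2 : (∑ m ∈ s, convSym (h1.blockClass m)) ∈ compactOperator (RingHom.id ℂ) _ _ :=
    Submodule.sum_mem _ fun m _ => hc m
  exact h2

/-- Injectivity says that -1 is not an eigenvalue of the compact operator T, so by the Fredholm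
alternative 1 + T is bounded below in norm. Positivity upgrades this to a bound on the form: ‖f‖² ≤
K²‖(1+T)f‖² ≤ K²C⟪(1+T)f,f⟫. -/
theorem accOp_coercive (h1 : a.A1) (h3 : a.A3) :
    ∃ c : ℝ, 0 < c ∧ ∀ f, c * ‖f‖ ^ 2 ≤ (⟪accOp a f, f⟫_ℂ).re := by
  have hne : ¬ Module.End.HasEigenvalue
      (convSym a.Hmu : L2v (Fin r) →ₗ[ℂ] L2v (Fin r)) (-1) := by
    intro he
    obtain ⟨v, hv⟩ := he.exists_hasEigenvector
    refine hv.2 (accOp_injective h1 h3 ?_)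
    have := hv.apply_eq_smul
    change v + convSym a.Hmu v = 0
    have e : convSym a.Hmu v = (-1 : ℂ) • v := this
    rw [e, neg_one_smul, add_neg_cancel]
  obtain ⟨K, hK⟩ := IsCompactOperator.antilipschitz_of_not_hasEigenvalue
    h1.isCompactOperator_convSym (neg_ne_zero.2 one_ne_zero) hne
  have e : (convSym a.Hmu - (-1 : ℂ) • 1 : L2v (Fin r) →L[ℂ] L2v (Fin r)) = accOp a := by
    rw [accOp, neg_one_smul, sub_neg_eq_add, add_comm]
  rw [e] at hK
  set C := ‖accOp a‖ + 1 with hC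
  have hC0 : 0 < C := by positivity
  refine ⟨((K : ℝ) ^ 2 * C + 1)⁻¹, by positivity, fun f => ?_⟩
  have h4 := norm_sq_le_of_nonneg h1.adjoint_accOp (accOp_re_nonneg h1) hC0
    (re_inner_accOp_le a) f
  have h5 : ‖f‖ ≤ K * ‖accOp a f‖ := by
    have := hK.le_mul_dist f 0
    simpa using this
  have h6 : ‖f‖ ^ 2 ≤ K ^ 2 * ‖accOp a f‖ ^ 2 := by
    rw [← mul_pow]; exact pow_le_pow_left₀ (norm_nonneg _) h5 2
  have h7 := accOp_re_nonneg h1 f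
  rw [inv_mul_le_iff₀ (by positivity)]
  have h8 : (K : ℝ) ^ 2 * ‖accOp a f‖ ^ 2 ≤ K ^ 2 * (C * (⟪accOp a f, f⟫_ℂ).re) := by gcongr
  nlinarith

/-- A representative of `H_μ` that is Hermitian-symmetric everywhere. -/
def hmuRep (a : SpectralCollection r) (x : ℝ) : Mat (Fin r) :=
  (Ioo (-1 : ℝ) 1).indicator (fun x => (1 / 2 : ℂ) • (a.Hmu x + (a.Hmu (-x))ᴴ)) x

theorem A1.hmu_ae_eq (h1 : a.A1) : a.Hmu =ᵐ[volSym] hmuRep a := by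
  filter_upwards [h1.hmu_symm, ae_restrict_mem measurableSet_Ioo] with x hx hm
  rw [hmuRep, indicator_of_mem hm, ← hx, Matrix.conjTranspose_conjTranspose, ← two_smul ℂ,
    smul_smul]
  norm_num

theorem indicator_hmuRep (a : SpectralCollection r) :
    (Ioo (-1 : ℝ) 1).indicator (hmuRep a) = hmuRep a := by
  funext x
  by_cases hm : x ∈ Ioo (-1 : ℝ) 1
  · rw [indicator_of_mem hm]
  · rw [indicator_of_notMem hm, hmuRep, indicator_of_notMem hm]

theorem A1.convOp_hmuRep (h1 : a.A1) : convOp (hmuRep a) = convSym a.Hmu := by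
  rw [← indicator_hmuRep]
  exact convOp_congr (indicator_ae_eq h1.hmu_ae_eq.symm)

theorem A1.isKreinKernel (h1 : a.A1) (h3 : a.A3) : IsKreinKernel (hmuRep a) := by
  have hconv := h1.convOp_hmuRep
  refine ⟨?_, ?_, fun x => ?_, ?_, ?_⟩
  · have hm := Lp.stronglyMeasurable a.Hmu
    have hc : Continuous fun A : Mat (Fin r) => Aᴴ := continuous_id.matrix_conjTranspose
    have hm' := hc.comp_stronglyMeasurable (hm.comp_measurable measurable_neg)
    exact ((hm.add hm').const_smul (1 / 2 : ℂ)).indicator measurableSet_Ioo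
  · rw [← indicator_hmuRep, memLp_indicator_sym]
    exact (Lp.memLp a.Hmu).ae_eq h1.hmu_ae_eq
  · have hmm : -x ∈ Ioo (-1 : ℝ) 1 ↔ x ∈ Ioo (-1 : ℝ) 1 := by
      simp only [mem_Ioo]; constructor <;> rintro ⟨h, h'⟩ <;> constructor <;> linarith
    by_cases hm : x ∈ Ioo (-1 : ℝ) 1
    · rw [hmuRep, hmuRep, indicator_of_mem hm, indicator_of_mem (hmm.2 hm), neg_neg,
        Matrix.conjTranspose_smul, Matrix.conjTranspose_add, Matrix.conjTranspose_conjTranspose,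
        add_comm]
      simp
    · rw [hmuRep, hmuRep, indicator_of_notMem hm, indicator_of_notMem (fun h => hm (hmm.1 h)),
        Matrix.conjTranspose_zero]
  · rw [hconv]; exact h1.adjoint_convSym
  · rw [hconv]; exact accOp_coercive h1 h3

theorem A1.accOp_eq (h1 : a.A1) : accOp a = 1 + convOp (hmuRep a) := by
  rw [accOp, h1.convOp_hmuRep]

end SpectralCollection

/-! ### Folding the interval -/

section Folding

variable {E : Type*} [NormedAddCommGroup E]

/-- As s runs over (0,x), (x+s)/2 covers the right half of the interval and (x-s)/2 the left half,
each with Jacobian 1/2. -/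
theorem integral_fold_of_integrable [NormedSpace ℝ E] {m : ℝ → E} (hm : Integrable m volume)
    (x : ℝ) : ∫ s in (0 : ℝ)..x, (1 / 2 : ℝ) • (m (x / 2 + 1 / 2 * s) + m (x / 2 + -(1 / 2) * s)) =
      ∫ u in (0 : ℝ)..x, m u := by
  have hi : ∀ b : ℝ, b ≠ 0 → Integrable (fun s => m (x / 2 + b * s)) volume := by
    intro b hb
    exact (hm.comp_add_left (x / 2)).comp_mul_left' hb
  have h1 : (1 / 2 : ℝ) ≠ 0 := by norm_num
  have h2 : (-(1 / 2) : ℝ) ≠ 0 := by norm_num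
  rw [intervalIntegral.integral_smul, intervalIntegral.integral_add
    (hi _ h1).intervalIntegrable (hi _ h2).intervalIntegrable,
    intervalIntegral.integral_comp_add_mul m h1, intervalIntegral.integral_comp_add_mul m h2]
  have e1 : x / 2 + 1 / 2 * x = x := by ring
  have e2 : x / 2 + -(1 / 2) * x = 0 := by ring
  rw [mul_zero, mul_zero, add_zero, e1, e2, intervalIntegral.integral_symm 0 (x / 2),
    ← intervalIntegral.integral_add_adjacent_intervals (a := 0) (b := x / 2) (c := x) hm.intervalIntegrable
      hm.intervalIntegrable]
  module

theorem integral_fold [NormedSpace ℝ E] {m : ℝ → E} (hm : Integrable m vol01) {x : ℝ}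
    (hx : x ∈ Icc (0 : ℝ) 1) :
    ∫ s in (0 : ℝ)..x, (1 / 2 : ℝ) • (m (x / 2 + 1 / 2 * s) + m (x / 2 + -(1 / 2) * s)) =
      ∫ u in (0 : ℝ)..x, m u := by
  have h1 := integral_fold_of_integrable ((integrable_indicator_iff measurableSet_Ioo).2 hm) x
  have e1 : ∫ u in (0 : ℝ)..x, m u = ∫ u in (0 : ℝ)..x, (Ioo (0 : ℝ) 1).indicator m u := by
    refine intervalIntegral_congr_vol01 ?_ hx
    filter_upwards [ae_vol01_mem] with u hu
    rw [indicator_of_mem hu]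
  rw [e1, ← h1]
  rw [intervalIntegral.integral_of_le hx.1, intervalIntegral.integral_of_le hx.1,
    integral_Ioc_eq_integral_Ioo, integral_Ioc_eq_integral_Ioo]
  refine setIntegral_congr_fun measurableSet_Ioo fun s hs => ?_
  have h2 : x / 2 + 1 / 2 * s ∈ Ioo (0 : ℝ) 1 :=
    ⟨by linarith [hs.1, hx.1], by linarith [hs.2, hx.2]⟩
  have h3 : x / 2 + -(1 / 2) * s ∈ Ioo (0 : ℝ) 1 :=
    ⟨by linarith [hs.2], by linarith [hs.1, hx.2]⟩
  simp only [indicator_of_mem h2, indicator_of_mem h3]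

variable {r : ℕ}

/-- The vector `(u, v)`. -/
def pairVec (u v : EuclideanSpace ℂ (Fin r)) : EuclideanSpace ℂ (Two r) :=
  WithLp.toLp 2 (Sum.elim u v)

@[simp] theorem pairVec_inl (u v : EuclideanSpace ℂ (Fin r)) (k : Fin r) :
    pairVec u v (Sum.inl k) = u k := rfl

@[simp] theorem pairVec_inr (u v : EuclideanSpace ℂ (Fin r)) (k : Fin r) :
    pairVec u v (Sum.inr k) = v k := rfl

theorem inner_pairVec (u v u' v' : EuclideanSpace ℂ (Fin r)) :
    ⟪pairVec u v, pairVec u' v'⟫_ℂ = ⟪u, u'⟫_ℂ + ⟪v, v'⟫_ℂ := by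
  simp [PiLp.inner_apply]

theorem continuous_pairVec : Continuous fun p : EuclideanSpace ℂ (Fin r) × EuclideanSpace ℂ (Fin r) =>
    pairVec p.1 p.2 := by
  refine (PiLp.continuous_toLp 2 _).comp (continuous_pi fun i => ?_)
  rcases i with i | i
  · exact (EuclideanSpace.proj i : EuclideanSpace ℂ (Fin r) →L[ℂ] ℂ).continuous.comp continuous_fst
  · exact (EuclideanSpace.proj i : EuclideanSpace ℂ (Fin r) →L[ℂ] ℂ).continuous.comp continuous_snd

theorem norm_pairVec_le (u v : EuclideanSpace ℂ (Fin r)) : ‖pairVec u v‖ ≤ ‖u‖ + ‖v‖ := by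
  refine le_of_sq_le_sq ?_ (by positivity)
  have h : ‖pairVec u v‖ ^ 2 = ‖u‖ ^ 2 + ‖v‖ ^ 2 := by
    simp [EuclideanSpace.norm_sq_eq]
  nlinarith [norm_nonneg u, norm_nonneg v]

theorem memLp_pairVec {μ : Measure ℝ} {u v : ℝ → EuclideanSpace ℂ (Fin r)} (hu : MemLp u 2 μ)
    (hv : MemLp v 2 μ) : MemLp (fun s => pairVec (u s) (v s)) 2 μ := by
  refine MemLp.of_le (hu.norm.add hv.norm)
    (continuous_pairVec.comp_aestronglyMeasurable (hu.1.prodMk hv.1))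
    (Eventually.of_forall fun s => (norm_pairVec_le _ _).trans (Real.le_norm_self _))

/-- The extension of a function on `(0,1)` by zero. -/
def zeroExt (f : ℝ → EuclideanSpace ℂ (Fin r)) : ℝ → EuclideanSpace ℂ (Fin r) :=
  (Ioo (0 : ℝ) 1).indicator f

theorem zeroExt_of_mem {f : ℝ → EuclideanSpace ℂ (Fin r)} {u : ℝ} (hu : u ∈ Ioo (0 : ℝ) 1) :
    zeroExt f u = f u := indicator_of_mem hu f

theorem memLp_zeroExt {f : ℝ → EuclideanSpace ℂ (Fin r)} (hf : MemLp f 2 vol01) :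
    MemLp (zeroExt f) 2 volume :=
  (memLp_indicator_iff_restrict measurableSet_Ioo).2 hf

/-- `s ↦ 1_{s ≤ x} (f((x+s)/2), f((x-s)/2)) / √2`. -/
def foldFun (x : ℝ) (f : ℝ → EuclideanSpace ℂ (Fin r)) : ℝ → EuclideanSpace ℂ (Two r) :=
  (Iic x).indicator fun s => (1 / (Real.sqrt 2 : ℂ)) •
    pairVec (zeroExt f (x / 2 + 1 / 2 * s)) (zeroExt f (x / 2 + -(1 / 2) * s))

theorem memLp_foldFun (x : ℝ) {f : ℝ → EuclideanSpace ℂ (Fin r)} (hf : MemLp f 2 vol01) :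
    MemLp (foldFun x f) 2 vol01 := by
  have h1 := (memLp_comp_affine (memLp_zeroExt hf) (x / 2) (b := 1 / 2)
    (by norm_num)).restrict (Ioo (0 : ℝ) 1)
  have h2 := (memLp_comp_affine (memLp_zeroExt hf) (x / 2) (b := -(1 / 2))
    (by norm_num)).restrict (Ioo (0 : ℝ) 1)
  have h3 := (memLp_pairVec h1 h2).const_smul (1 / (Real.sqrt 2 : ℂ))
  exact h3.indicator measurableSet_Iic

theorem ae_of_ae_vol01_affine {p : ℝ → Prop} (h : ∀ᵐ u ∂vol01, p u) (c : ℝ) {b : ℝ} (hb : b ≠ 0) :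
    ∀ᵐ s : ℝ, c + b * s ∈ Ioo (0 : ℝ) 1 → p (c + b * s) :=
  (quasiMeasurePreserving_affine c hb).ae ((ae_restrict_iff' measurableSet_Ioo).1 h)

theorem ae_zeroExt_eq {f g : ℝ → EuclideanSpace ℂ (Fin r)} (h : f =ᵐ[vol01] g) (c : ℝ) {b : ℝ}
    (hb : b ≠ 0) : ∀ᵐ s : ℝ, zeroExt f (c + b * s) = zeroExt g (c + b * s) := by
  filter_upwards [ae_of_ae_vol01_affine h c hb] with s hs
  by_cases hm : c + b * s ∈ Ioo (0 : ℝ) 1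
  · rw [zeroExt_of_mem hm, zeroExt_of_mem hm, hs hm]
  · rw [zeroExt, zeroExt, indicator_of_notMem hm, indicator_of_notMem hm]

theorem foldFun_congr (x : ℝ) {f g : ℝ → EuclideanSpace ℂ (Fin r)} (h : f =ᵐ[vol01] g) :
    foldFun x f =ᵐ[vol01] foldFun x g := by
  filter_upwards [ae_restrict_of_ae (ae_zeroExt_eq h (x / 2) (b := 1 / 2) (by norm_num)),
    ae_restrict_of_ae (ae_zeroExt_eq h (x / 2) (b := -(1 / 2)) (by norm_num))] with s h1 h2
  by_cases hs : s ≤ x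
  · simp only [foldFun, indicator, mem_Iic, hs, if_true, h1, h2]
  · simp only [foldFun, indicator, mem_Iic, hs, if_false]

theorem foldFun_add (x : ℝ) (f g : ℝ → EuclideanSpace ℂ (Fin r)) (s : ℝ) :
    foldFun x (f + g) s = foldFun x f s + foldFun x g s := by
  have e : ∀ u, zeroExt (f + g) u = zeroExt f u + zeroExt g u := fun u => by
    simp only [zeroExt, indicator_add']; rfl
  by_cases hs : s ≤ x
  · simp only [foldFun, indicator, mem_Iic, hs, if_true, e]
    ext i; rcases i with i | i <;> simp [mul_add]
  · simp only [foldFun, indicator, mem_Iic, hs, if_false, add_zero]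

theorem foldFun_smul (x : ℝ) (c : ℂ) (f : ℝ → EuclideanSpace ℂ (Fin r)) (s : ℝ) :
    foldFun x (c • f) s = c • foldFun x f s := by
  have e : ∀ u, zeroExt (c • f) u = c • zeroExt f u := fun u => by
    by_cases hu : u ∈ Ioo (0 : ℝ) 1
    · simp only [zeroExt_of_mem hu, Pi.smul_apply]
    · simp only [zeroExt, indicator_of_notMem hu, smul_zero]
  by_cases hs : s ≤ x
  · simp only [foldFun, indicator, mem_Iic, hs, if_true, e]
    ext i; rcases i with i | i <;> simp <;> ring
  · simp only [foldFun, indicator, mem_Iic, hs, if_false, smul_zero]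

/-- Folding is isometric on L₂(0,x): the two factors 1/√2 supply the 1/2 of the change of variables,
and values of f beyond x are ignored. -/
theorem inner_l2Class_foldFun {x : ℝ} (hx : x ∈ Icc (0 : ℝ) 1) (f g : L2v (Fin r)) :
    ⟪l2Class vol01 (foldFun x f), l2Class vol01 (foldFun x g)⟫_ℂ = ⟪f, cut x g⟫_ℂ := by
  have hf := Lp.memLp f
  have hg := Lp.memLp g
  have hm : Integrable (fun u => ⟪zeroExt f u, zeroExt g u⟫_ℂ) volume := by
    have h1 := L2.integrable_inner (𝕜 := ℂ) ((memLp_zeroExt hf).toLp _) ((memLp_zeroExt hg).toLp _)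
    refine h1.congr ?_
    filter_upwards [(memLp_zeroExt hf).coeFn_toLp, (memLp_zeroExt hg).coeFn_toLp] with u h2 h3
    rw [h2, h3]
  rw [inner_l2Class (memLp_foldFun x hf) (memLp_foldFun x hg), L2.inner_def]
  have e1 : ∫ s, ⟪foldFun x f s, foldFun x g s⟫_ℂ ∂vol01 = ∫ s, (Iic x).indicator (fun s =>
      (1 / 2 : ℝ) • ((fun u => ⟪zeroExt f u, zeroExt g u⟫_ℂ) (x / 2 + 1 / 2 * s) +
        (fun u => ⟪zeroExt f u, zeroExt g u⟫_ℂ) (x / 2 + -(1 / 2) * s))) s ∂vol01 := by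
    refine integral_congr_ae (Eventually.of_forall fun s => ?_)
    by_cases hs : s ≤ x
    · simp only [foldFun, indicator, mem_Iic, hs, if_true, inner_smul_left, inner_smul_right,
        inner_pairVec]
      rw [← mul_assoc, Complex.real_smul]
      congr 1
      have h2 : (Real.sqrt 2 : ℂ) * (Real.sqrt 2 : ℂ) = 2 := by
        rw [← Complex.ofReal_mul, Real.mul_self_sqrt (by norm_num)]; simp
      simp only [map_div₀, map_one, Complex.conj_ofReal]
      rw [div_mul_div_comm, h2]
      push_cast; norm_num
    · simp only [foldFun, indicator, mem_Iic, hs, if_false, inner_zero_left]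
  rw [e1, integral_vol01_indicator _ hx, integral_fold_of_integrable hm,
    ← integral_vol01_indicator _ hx]
  refine integral_congr_ae ?_
  filter_upwards [coeFn_cut x g, ae_vol01_mem] with s h1 hs
  rw [h1]
  by_cases h : s ≤ x
  · simp only [indicator, mem_Iic, h, if_true, zeroExt_of_mem hs]
  · simp only [indicator, mem_Iic, h, if_false, inner_zero_right]

/-- The operator of `foldFun`. -/
def foldOp {x : ℝ} (hx : x ∈ Icc (0 : ℝ) 1) : L2v (Fin r) →L[ℂ] L2v (Two r) :=
  LinearMap.mkContinuous
    { toFun := fun f => l2Class vol01 (foldFun x f)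
      map_add' := fun f g => by
        rw [← l2Class_add (memLp_foldFun x (Lp.memLp f)) (memLp_foldFun x (Lp.memLp g))]
        refine l2Class_congr ?_
        filter_upwards [foldFun_congr x (Lp.coeFn_add f g)] with s hs
        rw [hs, foldFun_add]
      map_smul' := fun c f => by
        rw [RingHom.id_apply, ← l2Class_smul c (memLp_foldFun x (Lp.memLp f))]
        refine l2Class_congr ?_
        filter_upwards [foldFun_congr x (Lp.coeFn_smul c f)] with s hs
        rw [hs, foldFun_smul] } 1 fun f => by
    rw [one_mul]
    refine le_of_sq_le_sq ?_ (norm_nonneg _)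
    have h1 := inner_l2Class_foldFun hx f f
    have h2 : ‖l2Class vol01 (foldFun x f)‖ ^ 2 = (⟪f, cut x f⟫_ℂ).re := by
      rw [← h1]; exact (inner_self_eq_norm_sq (𝕜 := ℂ) _).symm
    refine h2.trans_le ((Complex.re_le_norm _).trans ((norm_inner_le_norm _ _).trans ?_))
    rw [sq]
    exact mul_le_mul_of_nonneg_left (norm_cut_apply_le x f) (norm_nonneg _)

theorem foldOp_apply {x : ℝ} (hx : x ∈ Icc (0 : ℝ) 1) (f : L2v (Fin r)) :
    foldOp hx f = l2Class vol01 (foldFun x f) := rfl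

theorem foldOp_l2Class {x : ℝ} (hx : x ∈ Icc (0 : ℝ) 1) {f : ℝ → EuclideanSpace ℂ (Fin r)}
    (hf : MemLp f 2 vol01) : foldOp hx (l2Class vol01 f) = l2Class vol01 (foldFun x f) :=
  l2Class_congr (foldFun_congr x (coeFn_l2Class hf))

theorem inner_foldOp {x : ℝ} (hx : x ∈ Icc (0 : ℝ) 1) (f g : L2v (Fin r)) :
    ⟪foldOp hx f, foldOp hx g⟫_ℂ = ⟪f, cut x g⟫_ℂ := inner_l2Class_foldFun hx f g

theorem cut_foldOp {x : ℝ} (hx : x ∈ Icc (0 : ℝ) 1) (f : L2v (Fin r)) :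
    cut x (foldOp hx f) = foldOp hx f := by
  rw [foldOp_apply, cut_l2Class x (memLp_foldFun x (Lp.memLp f))]
  congr 1
  rw [foldFun, indicator_indicator, inter_self]

theorem foldOp_cut {x : ℝ} (hx : x ∈ Icc (0 : ℝ) 1) (f : L2v (Fin r)) :
    foldOp hx (cut x f) = foldOp hx f := by
  have h1 : ∀ g : L2v (Fin r), ⟪foldOp hx g, foldOp hx g⟫_ℂ = 0 → foldOp hx g = 0 := fun g hg =>
    inner_self_eq_zero.1 hg
  rw [← sub_eq_zero, ← map_sub]
  apply h1
  rw [inner_foldOp, map_sub, cut_apply_cut_apply, min_self, sub_self, inner_zero_right]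

theorem one_mem_Icc : (1 : ℝ) ∈ Icc (0 : ℝ) 1 := by simp

/-- The unitary operator `f ↦ (f((1+s)/2), f((1-s)/2)) / √2`. -/
def unfoldOp : L2v (Fin r) →L[ℂ] L2v (Two r) := foldOp one_mem_Icc

theorem inner_unfoldOp (f g : L2v (Fin r)) : ⟪unfoldOp f, unfoldOp g⟫_ℂ = ⟪f, g⟫_ℂ := by
  rw [unfoldOp, inner_foldOp, cut_of_one_le le_rfl]; rfl

/-- The function whose image under `unfoldOp` is `(g₁, g₂)`. -/
def refoldFun (g₁ g₂ : ℝ → EuclideanSpace ℂ (Fin r)) (x : ℝ) : EuclideanSpace ℂ (Fin r) :=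
  (Real.sqrt 2 : ℂ) • (zeroExt g₁ (-1 + 2 * x) + zeroExt g₂ (1 + -2 * x))

theorem memLp_refoldFun {g₁ g₂ : ℝ → EuclideanSpace ℂ (Fin r)} (h₁ : MemLp g₁ 2 vol01)
    (h₂ : MemLp g₂ 2 vol01) : MemLp (refoldFun g₁ g₂) 2 vol01 := by
  have a1 := (memLp_comp_affine (memLp_zeroExt h₁) (-1) (b := 2)
    (by norm_num)).restrict (Ioo (0 : ℝ) 1)
  have a2 := (memLp_comp_affine (memLp_zeroExt h₂) 1 (b := -2)
    (by norm_num)).restrict (Ioo (0 : ℝ) 1)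
  exact (a1.add a2).const_smul (Real.sqrt 2 : ℂ)

theorem foldFun_refoldFun (g₁ g₂ : ℝ → EuclideanSpace ℂ (Fin r)) {s : ℝ}
    (hs : s ∈ Ioo (0 : ℝ) 1) : foldFun 1 (refoldFun g₁ g₂) s = pairVec (g₁ s) (g₂ s) := by
  have a1 : (1 / 2 + 1 / 2 * s : ℝ) ∈ Ioo (0 : ℝ) 1 :=
    ⟨by linarith [hs.1], by linarith [hs.2]⟩
  have a2 : (1 / 2 + -(1 / 2) * s : ℝ) ∈ Ioo (0 : ℝ) 1 :=
    ⟨by linarith [hs.2], by linarith [hs.1]⟩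
  have hn : -s ∉ Ioo (0 : ℝ) 1 := fun h => by linarith [h.1, hs.1]
  have b1 : (-1 + 2 * (1 / 2 + 1 / 2 * s) : ℝ) = s := by ring
  have b2 : (1 + -2 * (1 / 2 + 1 / 2 * s) : ℝ) = -s := by ring
  have b3 : (-1 + 2 * (1 / 2 + -(1 / 2) * s) : ℝ) = -s := by ring
  have b4 : (1 + -2 * (1 / 2 + -(1 / 2) * s) : ℝ) = s := by ring
  have hz : ∀ g : ℝ → EuclideanSpace ℂ (Fin r), zeroExt g (-s) = 0 := fun g =>
    indicator_of_notMem hn g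
  have h2 : (Real.sqrt 2 : ℂ) ≠ 0 := by simp
  rw [foldFun, indicator_of_mem (show s ∈ Iic (1 : ℝ) from hs.2.le), zeroExt_of_mem a1,
    zeroExt_of_mem a2]
  simp only [refoldFun, b1, b2, b3, b4, hz, zeroExt_of_mem hs, add_zero, zero_add]
  ext i
  rcases i with i | i
  · simp
  · simp

/-- The coordinates of a vector along a map of index sets. -/
def coordCLM (e : Fin r → Two r) : EuclideanSpace ℂ (Two r) →L[ℂ] EuclideanSpace ℂ (Fin r) :=
  LinearMap.toContinuousLinearMap
    { toFun := fun v => WithLp.toLp 2 fun k => v (e k)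
      map_add' := fun _ _ => rfl
      map_smul' := fun _ _ => rfl }

theorem unfoldOp_surjective : Function.Surjective (unfoldOp (r := r)) := by
  intro g
  have h1 := (coordCLM (r := r) Sum.inl).comp_memLp' (Lp.memLp g)
  have h2 := (coordCLM (r := r) Sum.inr).comp_memLp' (Lp.memLp g)
  refine ⟨l2Class vol01 (refoldFun (coordCLM Sum.inl ∘ g) (coordCLM Sum.inr ∘ g)), ?_⟩
  rw [unfoldOp, foldOp_l2Class one_mem_Icc (memLp_refoldFun h1 h2)]
  symm
  apply eq_l2Class
  filter_upwards [ae_vol01_mem] with s hs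
  rw [foldFun_refoldFun _ _ hs]
  ext i
  rcases i with i | i <;> rfl

theorem adjoint_unfoldOp_unfoldOp (f : L2v (Fin r)) :
    ContinuousLinearMap.adjoint unfoldOp (unfoldOp f) = f := by
  refine ext_inner_left ℂ fun g => ?_
  rw [ContinuousLinearMap.adjoint_inner_right, inner_unfoldOp]

theorem unfoldOp_adjoint_unfoldOp (g : L2v (Two r)) :
    unfoldOp (ContinuousLinearMap.adjoint (unfoldOp (r := r)) g) = g := by
  obtain ⟨f, rfl⟩ := unfoldOp_surjective g
  rw [adjoint_unfoldOp_unfoldOp]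

end Folding

/-! ### The operators `Φ_q(z)` and the series `U_{a,0}` -/

section Phi

variable {r : ℕ}

/-- `B ↦ B c`. -/
def vecCLM (c : EuclideanSpace ℂ (Fin r)) :
    Matrix (Two r) (Fin r) ℂ →L[ℂ] EuclideanSpace ℂ (Two r) := ∑ k, c k • mcolCLM k

theorem vecCLM_apply (c : EuclideanSpace ℂ (Fin r)) (B : Matrix (Two r) (Fin r) ℂ) :
    vecCLM c B = ∑ k, c k • mcol B k := by
  rw [vecCLM, sum_apply]; rfl

theorem vecCLM_apply_apply (c : EuclideanSpace ℂ (Fin r)) (B : Matrix (Two r) (Fin r) ℂ)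
    (i : Two r) : vecCLM c B i = ∑ k, B i k * c k := by
  rw [vecCLM_apply, WithLp.ofLp_sum, Finset.sum_apply]
  refine Finset.sum_congr rfl fun k _ => ?_
  rw [PiLp.smul_apply, mcol_apply, smul_eq_mul, mul_comm]

theorem act_vecCLM (A : Mat (Two r)) (c : EuclideanSpace ℂ (Fin r))
    (B : Matrix (Two r) (Fin r) ℂ) : act A (vecCLM c B) = vecCLM c (A * B) := by
  rw [vecCLM_apply, vecCLM_apply, map_sum]
  simp only [map_smul, act_mcol]

theorem memLp_mcol_phi (q : Potential r) (z : ℂ) (k : Fin r) :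
    MemLp (fun x => mcol (phi q z x) k) 2 vol01 :=
  memLp_of_continuousOn ((mcolCLM k).continuous.comp_continuousOn (continuousOn_phi q z))

theorem coeFn_opPhi (q : Potential r) (z : ℂ) (c : EuclideanSpace ℂ (Fin r)) :
    opPhi q z c =ᵐ[vol01] fun x => vecCLM c (phi q z x) := by
  have h1 : opPhi q z c = l2Class vol01 fun x => ∑ k, c k • mcol (phi q z x) k := by
    have h0 := l2Class_sum (μ := vol01) Finset.univ (fun k x => c k • mcol (phi q z x) k)
      fun k _ => (memLp_mcol_phi q z k).const_smul (c k)
    rw [h0, opPhi, sum_apply]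
    refine Finset.sum_congr rfl fun k _ => ?_
    have := l2Class_smul (c k) (memLp_mcol_phi q z k)
    rw [this]
    rfl
  have h2 : MemLp (fun x => vecCLM c (phi q z x)) 2 vol01 :=
    memLp_of_continuousOn ((vecCLM c).continuous.comp_continuousOn (continuousOn_phi q z))
  simp only [← vecCLM_apply] at h1
  rw [h1]
  exact coeFn_l2Class h2

theorem unfoldOp_expOp (z : ℝ) (c : EuclideanSpace ℂ (Fin r)) :
    unfoldOp (expOp z c) =ᵐ[vol01] fun s : ℝ => (1 / (Real.sqrt 2 : ℂ)) •
      pairVec (Complex.exp (Complex.I * z * (1 + s)) • c)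
        (Complex.exp (Complex.I * z * (1 - s)) • c) := by
  have h1 : unfoldOp (expOp z c) = l2Class vol01
      (foldFun 1 fun x : ℝ => Complex.exp (2 * Complex.I * z * x) • c) :=
    foldOp_l2Class one_mem_Icc (memLp_exp_smul z (memLp_const c))
  rw [h1]
  filter_upwards [coeFn_l2Class (memLp_foldFun 1 (memLp_exp_smul z (memLp_const c))),
    ae_vol01_mem] with s h2 hs
  have a1 : (1 / 2 + 1 / 2 * s : ℝ) ∈ Ioo (0 : ℝ) 1 :=
    ⟨by linarith [hs.1], by linarith [hs.2]⟩
  have a2 : (1 / 2 + -(1 / 2) * s : ℝ) ∈ Ioo (0 : ℝ) 1 :=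
    ⟨by linarith [hs.2], by linarith [hs.1]⟩
  rw [h2, foldFun, indicator_of_mem (show s ∈ Iic (1 : ℝ) from hs.2.le), zeroExt_of_mem a1,
    zeroExt_of_mem a2]
  have b1 : 2 * Complex.I * z * ((1 / 2 + 1 / 2 * s : ℝ) : ℂ) = Complex.I * z * (1 + s) := by
    push_cast; ring
  have b2 : 2 * Complex.I * z * ((1 / 2 + -(1 / 2) * s : ℝ) : ℂ) = Complex.I * z * (1 - s) := by
    push_cast; ring
  rw [b1, b2]

/-- The components e^{±izs} of φ₀ are the values of e^{2izu} at u = (1±s)/2, up to the common factor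
e^{-iz}. -/
theorem opPhi_zero_eq (z : ℝ) : opPhi (0 : Potential r) z =
    (-Complex.I * Complex.exp (-(Complex.I * z))) • unfoldOp.comp (expOp z) := by
  ext1 c
  apply Lp.ext
  have e : ((-Complex.I * Complex.exp (-(Complex.I * z))) • unfoldOp.comp (expOp z)) c =
      (-Complex.I * Complex.exp (-(Complex.I * z))) • unfoldOp (r := r) (expOp z c) := rfl
  rw [e]
  filter_upwards [coeFn_opPhi (0 : Potential r) z c, unfoldOp_expOp z c,
    Lp.coeFn_smul (-Complex.I * Complex.exp (-(Complex.I * z))) (unfoldOp (expOp z c)),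
    ae_vol01_mem] with s h1 h2 h3 hs
  rw [h1, h3, Pi.smul_apply, h2, phi_zero_eq _ (Ioo_subset_Icc_self hs)]
  have e1 : Complex.exp (Complex.I * z * (1 + s)) =
      Complex.exp (Complex.I * z) * Complex.exp (Complex.I * z * s) := by
    rw [← Complex.exp_add]; congr 1; ring
  have e2 : Complex.exp (Complex.I * z * (1 - s)) =
      Complex.exp (Complex.I * z) * Complex.exp (-(Complex.I * z) * s) := by
    rw [← Complex.exp_add]; congr 1; ring
  have e3 : Complex.exp (-(Complex.I * z)) * Complex.exp (Complex.I * z) = 1 := by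
    rw [← Complex.exp_add]; simp
  rw [e1, e2]
  ext i
  rw [vecCLM_apply_apply]
  rcases i with i | i
  · simp only [Matrix.smul_apply, Matrix.fromRows_apply_inl, PiLp.smul_apply, pairVec_inl,
      smul_eq_mul, Matrix.one_apply, mul_ite, mul_one, mul_zero, ite_mul, zero_mul,
      Finset.sum_ite_eq, Finset.mem_univ, if_true]
    linear_combination (Complex.I / (Real.sqrt 2 : ℂ)) *
      Complex.exp (Complex.I * z * s) * c i * e3
  · simp only [Matrix.smul_apply, Matrix.fromRows_apply_inr, PiLp.smul_apply, pairVec_inr,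
      smul_eq_mul, Matrix.one_apply, mul_ite, mul_one, mul_zero, ite_mul, zero_mul,
      Finset.sum_ite_eq, Finset.mem_univ, if_true]
    linear_combination (Complex.I / (Real.sqrt 2 : ℂ)) *
      Complex.exp (-(Complex.I * z) * s) * c i * e3

/-- For real z the scalar in `opPhi_zero_eq` has modulus 1 and cancels against its conjugate. -/
theorem opPhi_zero_term (z : ℝ) (A : Mat (Fin r)) (f : HSpace r) :
    opPhi (0 : Potential r) z (act A (ContinuousLinearMap.adjoint (opPhi (0 : Potential r) z) f)) =
      unfoldOp (expTerm z A (ContinuousLinearMap.adjoint (unfoldOp (r := r)) f)) := by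
  set u : ℂ := -Complex.I * Complex.exp (-(Complex.I * z)) with hu
  have hun : u * (starRingEnd ℂ) u = 1 := by
    rw [Complex.mul_conj']
    have : -(Complex.I * (z : ℂ)) = ((-z : ℝ) : ℂ) * Complex.I := by push_cast; ring
    rw [hu, norm_mul, this, Complex.norm_exp_ofReal_mul_I]
    simp
  have h1 : ContinuousLinearMap.adjoint (opPhi (0 : Potential r) z) f =
      (starRingEnd ℂ) u • ContinuousLinearMap.adjoint (expOp z)
        (ContinuousLinearMap.adjoint (unfoldOp (r := r)) f) := by
    rw [opPhi_zero_eq, ← hu, map_smulₛₗ, ContinuousLinearMap.adjoint_comp]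
    rfl
  rw [h1, opPhi_zero_eq, ← hu, map_smul, map_smul, expTerm_apply]
  change (starRingEnd ℂ) u • (u • unfoldOp (expOp z _)) = _
  rw [smul_smul, mul_comm, hun, one_smul]

theorem eq_zero_of_inner_opPhi {f : HSpace r} (h : ∀ (m : ℤ) (c : EuclideanSpace ℂ (Fin r)),
    ⟪opPhi (0 : Potential r) ((Real.pi * m : ℝ) : ℂ) c, f⟫_ℂ = 0) : f = 0 := by
  have h1 : ContinuousLinearMap.adjoint (unfoldOp (r := r)) f = 0 := by
    refine eq_zero_of_inner_expOp fun m c => ?_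
    have h2 := h m c
    rw [opPhi_zero_eq, smul_apply, inner_smul_left] at h2
    rw [ContinuousLinearMap.adjoint_inner_right]
    refine (mul_eq_zero.1 h2).resolve_left ?_
    simp [Complex.exp_ne_zero]
  rw [← unfoldOp_adjoint_unfoldOp f, h1, map_zero]

theorem SpectralCollection.A1.isSpectralSum {a : SpectralCollection r} (h1 : a.A1) :
    IsSpectralSum a 0 (unfoldOp.comp ((SpectralCollection.accOp a).comp
      (ContinuousLinearMap.adjoint (unfoldOp (r := r))))) := by
  intro f
  simp only [opPhi_zero_term]
  exact (h1.hasSum_terms (ContinuousLinearMap.adjoint (unfoldOp (r := r)) f)).map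
    (unfoldOp (r := r)) (unfoldOp (r := r)).continuous

end Phi

/-! ### The rows of the transformed convolution operator -/

section Rows

variable {r : ℕ} {h : ℝ → Mat (Fin r)}

/-- The rows of the kernel of the convolution operator transported by `unfoldOp`. -/
def glmRows (h : ℝ → Mat (Fin r)) (x : ℝ) : Two r → L2v (Two r) :=
  Sum.elim (fun k => (1 / (Real.sqrt 2 : ℂ)) • unfoldOp (convRows h (1 / 2 + 1 / 2 * x) k))
    fun k => (1 / (Real.sqrt 2 : ℂ)) • unfoldOp (convRows h (1 / 2 + 1 / 2 * -x) k)

theorem continuous_glmRows (hh : MemLp h 2 volume) : Continuous (glmRows h) := by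
  refine continuous_pi fun i => ?_
  have h1 := fun k => continuous_pi_iff.1 (continuous_convRows hh) k
  rcases i with k | k
  · have h2 := (h1 k).comp (by fun_prop : Continuous fun x : ℝ => 1 / 2 + 1 / 2 * x)
    exact ((unfoldOp (r := r)).continuous.comp h2).const_smul (1 / (Real.sqrt 2 : ℂ))
  · have h2 := (h1 k).comp (by fun_prop : Continuous fun x : ℝ => 1 / 2 + 1 / 2 * -x)
    exact ((unfoldOp (r := r)).continuous.comp h2).const_smul (1 / (Real.sqrt 2 : ℂ))

theorem conj_inv_sqrt_two :
    (starRingEnd ℂ) (1 / (Real.sqrt 2 : ℂ)) = 1 / (Real.sqrt 2 : ℂ) := by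
  simp only [map_div₀, map_one, Complex.conj_ofReal]

/-- A difference kernel does not change when both arguments are shifted by (x-1)/2, and for s ≤ x
the shift carries the points (1±s)/2 to (x±s)/2. Truncating the unfolded kernel at x is therefore
the same as folding on (0,x). -/
theorem cut_unfoldOp_convRows (hh : MemLp h 2 volume) {x : ℝ} (hx : x ∈ Icc (0 : ℝ) 1) (u : ℝ)
    (k : Fin r) : cut x (unfoldOp (convRows h (1 / 2 + 1 / 2 * u) k)) =
      foldOp hx (convRows h (x / 2 + 1 / 2 * u) k) := by
  have hm : ∀ y, MemLp (fun t => conjRow (h (y - t)) k) 2 vol01 := fun y =>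
    memLp_conjRow (memLp_conv hh y) k
  have e1 : unfoldOp (convRows h (1 / 2 + 1 / 2 * u) k) = l2Class vol01
      (foldFun 1 fun t => conjRow (h (1 / 2 + 1 / 2 * u - t)) k) := foldOp_l2Class one_mem_Icc (hm _)
  have e2 : foldOp hx (convRows h (x / 2 + 1 / 2 * u) k) = l2Class vol01
      (foldFun x fun t => conjRow (h (x / 2 + 1 / 2 * u - t)) k) := foldOp_l2Class hx (hm _)
  rw [e1, e2, cut_l2Class x (memLp_foldFun 1 (hm _))]
  refine l2Class_congr ?_
  have hne : ∀ᵐ t ∂vol01, t ≠ x := by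
    refine ae_restrict_of_ae ?_
    simp [ae_iff]
  filter_upwards [ae_vol01_mem, hne] with s hs hsx
  by_cases hle : s ≤ x
  · have hlt : s < x := lt_of_le_of_ne hle hsx
    have a1 : (1 / 2 + 1 / 2 * s : ℝ) ∈ Ioo (0 : ℝ) 1 :=
      ⟨by linarith [hs.1], by linarith [hs.2]⟩
    have a2 : (1 / 2 + -(1 / 2) * s : ℝ) ∈ Ioo (0 : ℝ) 1 :=
      ⟨by linarith [hs.2], by linarith [hs.1]⟩
    have a3 : (x / 2 + 1 / 2 * s : ℝ) ∈ Ioo (0 : ℝ) 1 :=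
      ⟨by linarith [hs.1], by linarith [hs.2, hx.2]⟩
    have a4 : (x / 2 + -(1 / 2) * s : ℝ) ∈ Ioo (0 : ℝ) 1 :=
      ⟨by linarith, by linarith [hs.1, hx.2]⟩
    have b1 : 1 / 2 + 1 / 2 * u - (1 / 2 + 1 / 2 * s) = x / 2 + 1 / 2 * u - (x / 2 + 1 / 2 * s) := by
      ring
    have b2 : 1 / 2 + 1 / 2 * u - (1 / 2 + -(1 / 2) * s) =
        x / 2 + 1 / 2 * u - (x / 2 + -(1 / 2) * s) := by ring
    rw [indicator_of_mem (show s ∈ Iic x from hle), foldFun, foldFun,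
      indicator_of_mem (show s ∈ Iic x from hle),
      indicator_of_mem (show s ∈ Iic (1 : ℝ) from hs.2.le), zeroExt_of_mem a1, zeroExt_of_mem a2,
      zeroExt_of_mem a3, zeroExt_of_mem a4, b1, b2]
  · rw [indicator_of_notMem (show s ∉ Iic x from hle), foldFun,
      indicator_of_notMem (show s ∉ Iic x from hle)]

/-- The transported convolution operator on the ranges of `foldOp`. -/
theorem cut_rowOp_glmRows (hh : MemLp h 2 volume) {x : ℝ} (hx : x ∈ Icc (0 : ℝ) 1)
    (f : L2v (Fin r)) : cut x (rowOp (glmRows h) (foldOp hx f)) =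
      foldOp hx (convOp h (cut x f)) := by
  have hin : ∀ u k, ⟪unfoldOp (convRows h (1 / 2 + 1 / 2 * u) k), foldOp hx f⟫_ℂ =
      ⟪convRows h (x / 2 + 1 / 2 * u) k, cut x f⟫_ℂ := by
    intro u k
    rw [← cut_foldOp hx f, ← inner_cut_left, cut_unfoldOp_convRows hh hx, inner_foldOp]
  have e1 : foldOp hx (convOp h (cut x f)) =
      l2Class vol01 (foldFun x (rowFun (convRows h) (cut x f))) :=
    l2Class_congr (foldFun_congr x (coeFn_rowOp (continuous_convRows hh) _))
  rw [e1]
  apply eq_l2Class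
  have hne : ∀ᵐ t ∂vol01, t ≠ x := by
    refine ae_restrict_of_ae ?_
    simp [ae_iff]
  filter_upwards [ae_vol01_mem, hne, coeFn_cut x (rowOp (glmRows h) (foldOp hx f)),
    coeFn_rowOp (continuous_glmRows hh) (foldOp hx f)] with s hs hsx h1 h2
  rw [h1]
  by_cases hle : s ≤ x
  · have hlt : s < x := lt_of_le_of_ne hle hsx
    have a3 : (x / 2 + 1 / 2 * s : ℝ) ∈ Ioo (0 : ℝ) 1 :=
      ⟨by linarith [hs.1], by linarith [hs.2, hx.2]⟩
    have a4 : (x / 2 + -(1 / 2) * s : ℝ) ∈ Ioo (0 : ℝ) 1 :=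
      ⟨by linarith, by linarith [hs.1, hx.2]⟩
    rw [indicator_of_mem (show s ∈ Iic x from hle), foldFun,
      indicator_of_mem (show s ∈ Iic x from hle), h2, zeroExt_of_mem a3, zeroExt_of_mem a4]
    ext i
    rcases i with k | k
    · simp only [rowFun_apply, glmRows, Sum.elim_inl, inner_smul_left, PiLp.smul_apply, pairVec_inl,
        smul_eq_mul, conj_inv_sqrt_two, hin]
    · simp only [rowFun_apply, glmRows, Sum.elim_inr, inner_smul_left, PiLp.smul_apply, pairVec_inr,
        smul_eq_mul, conj_inv_sqrt_two, hin]
      rw [neg_mul, mul_neg]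
  · rw [indicator_of_notMem (show s ∉ Iic x from hle), foldFun,
      indicator_of_notMem (show s ∉ Iic x from hle)]

theorem rowOp_glmRows_eq (hh : MemLp h 2 volume) : rowOp (glmRows h) =
    unfoldOp.comp ((convOp h).comp (ContinuousLinearMap.adjoint (unfoldOp (r := r)))) := by
  ext1 g
  obtain ⟨f, rfl⟩ := unfoldOp_surjective g
  have h1 := cut_rowOp_glmRows hh one_mem_Icc f
  rw [cut_of_one_le le_rfl, cut_of_one_le le_rfl] at h1
  change _ = unfoldOp (convOp h (ContinuousLinearMap.adjoint unfoldOp (unfoldOp f)))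
  rw [adjoint_unfoldOp_unfoldOp]
  exact h1

theorem adjoint_rowOp_glmRows (hh : IsKreinKernel h) :
    ContinuousLinearMap.adjoint (rowOp (glmRows h)) = rowOp (glmRows h) := by
  rw [rowOp_glmRows_eq hh.memLp, ContinuousLinearMap.adjoint_comp, ContinuousLinearMap.adjoint_comp,
    ContinuousLinearMap.adjoint_adjoint, hh.adjoint_eq]
  rfl

/-! ### The transformation kernel -/

/-- The smooth-boundary part of the transformation kernel. -/
def transFun (h : ℝ → Mat (Fin r)) (x s : ℝ) : Mat (Two r) :=
  (1 / 2 : ℂ) • Matrix.fromBlocks (resFun h x x (x / 2 + 1 / 2 * s))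
    (resFun h x x (x / 2 + -(1 / 2) * s)) (resFun h x 0 (x / 2 + 1 / 2 * s))
    (resFun h x 0 (x / 2 + -(1 / 2) * s))

/-- The transformation kernel, in terms of the resolvent kernels of the accelerant. -/
def transKer (h : ℝ → Mat (Fin r)) (x s : ℝ) : Mat (Two r) := (Iic x).indicator (transFun h x) s

theorem hasL2Sections_fromBlocks {A B C D : ℝ → ℝ → Mat (Fin r)} (hA : HasL2Sections A)
    (hB : HasL2Sections B) (hC : HasL2Sections C) (hD : HasL2Sections D) :
    HasL2Sections fun x s => (1 / 2 : ℂ) •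
      Matrix.fromBlocks (A x s) (B x s) (C x s) (D x s) := by
  let L (i j : Fin 2) : Mat (Fin r) →L[ℂ] Mat (Two r) := LinearMap.toContinuousLinearMap
    { toFun := fun X => (if i = 0 then (if j = 0 then (1 / 2 : ℂ) • Matrix.fromBlocks X 0 0 0
          else (1 / 2 : ℂ) • Matrix.fromBlocks 0 X 0 0)
        else (if j = 0 then (1 / 2 : ℂ) • Matrix.fromBlocks 0 0 X 0
          else (1 / 2 : ℂ) • Matrix.fromBlocks 0 0 0 X))
      map_add' := fun X Y => by
        split_ifs <;> rw [← smul_add, Matrix.fromBlocks_add] <;> simp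
      map_smul' := fun c X => by
        rw [RingHom.id_apply]
        split_ifs <;> ext a b <;> rcases a with a | a <;> rcases b with b | b <;>
          simp [mul_left_comm] }
  have h1 := (((hA.clm (L 0 0)).add (hB.clm (L 0 1))).add (hC.clm (L 1 0))).add (hD.clm (L 1 1))
  have e : ∀ x s, (1 / 2 : ℂ) • Matrix.fromBlocks (A x s) (B x s) (C x s) (D x s) =
      L 0 0 (A x s) + L 0 1 (B x s) + L 1 0 (C x s) + L 1 1 (D x s) := by
    intro x s
    simp only [L, LinearMap.coe_toContinuousLinearMap', LinearMap.coe_mk, AddHom.coe_mk, if_true,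
      one_ne_zero, if_false]
    rw [← smul_add, ← smul_add, ← smul_add, Matrix.fromBlocks_add, Matrix.fromBlocks_add,
      Matrix.fromBlocks_add]
    simp
  simp only [e]
  exact h1

theorem hasL2Sections_transFun (hh : IsKreinKernel h) : HasL2Sections (transFun h) := by
  have hA := hh.hasL2Sections_resFun (e := 1) (c := 1 / 2) (d := 1 / 2) (by norm_num) (by norm_num)
  have hB := hh.hasL2Sections_resFun (e := 1) (c := 1 / 2) (d := -(1 / 2)) (by norm_num)
    (by norm_num)
  have hC := hh.hasL2Sections_resFun (e := 0) (c := 1 / 2) (d := 1 / 2) (by norm_num) (by norm_num)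
  have hD := hh.hasL2Sections_resFun (e := 0) (c := 1 / 2) (d := -(1 / 2)) (by norm_num)
    (by norm_num)
  have e : ∀ x : ℝ, 1 / 2 * x = x / 2 := fun x => by ring
  have h1 := hasL2Sections_fromBlocks hA hB hC hD
  have e2 : transFun h = fun x s => (1 / 2 : ℂ) • Matrix.fromBlocks
      (resFun h x (1 * x) (1 / 2 * x + 1 / 2 * s)) (resFun h x (1 * x) (1 / 2 * x + -(1 / 2) * s))
      (resFun h x (0 * x) (1 / 2 * x + 1 / 2 * s))
      (resFun h x (0 * x) (1 / 2 * x + -(1 / 2) * s)) := by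
    funext x s
    rw [one_mul, zero_mul, e x, transFun]
  rw [e2]
  exact h1

theorem memLp_transKer (hh : IsKreinKernel h) (x : ℝ) : MemLp (transKer h x) 2 vol01 :=
  ((hasL2Sections_transFun hh).memLp_left x).indicator measurableSet_Iic

theorem continuous_rowClass_transKer (hh : IsKreinKernel h) :
    Continuous fun x => rowClass (transKer h x) :=
  continuous_rowClass_of_continuous (memLp_transKer hh)
    (hasL2Sections_transFun hh).continuous_left_indicator

/-- The factor 1/2 in `transFun` is split as (1/√2)²: one factor belongs to the fold and the other
remains in front. -/
theorem rowClass_transKer (hh : IsKreinKernel h) {x : ℝ} (hx : x ∈ Icc (0 : ℝ) 1) (i : Two r) :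
    rowClass (transKer h x) i = (1 / (Real.sqrt 2 : ℂ)) •
      foldOp hx (Sum.elim (resRow h x x) (resRow h x 0) i) := by
  have hm : ∀ y k, MemLp (fun t => conjRow (resKer h x y t) k) 2 vol01 := fun y k =>
    memLp_conjRow (hh.memLp_resKer x y) k
  have e1 : ∀ y k, foldOp hx (resRow h x y k) = l2Class vol01
      (foldFun x fun t => conjRow (resKer h x y t) k) := by
    intro y k
    rw [← hh.rowClass_resKer]
    exact foldOp_l2Class hx (hm y k)
  have hne : ∀ᵐ t ∂vol01, t ≠ x := by
    refine ae_restrict_of_ae ?_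
    simp [ae_iff]
  have h2 : (1 / (Real.sqrt 2 : ℂ)) * (1 / (Real.sqrt 2 : ℂ)) = 1 / 2 := by
    rw [div_mul_div_comm, ← Complex.ofReal_mul, Real.mul_self_sqrt (by norm_num)]; simp
  have h3 : star (1 / 2 : ℂ) = 1 / 2 := by simp
  have key : ∀ y k (i : Two r), (∀ s, conjRow (transFun h x s) i = (1 / 2 : ℂ) •
      pairVec (conjRow (resFun h x y (x / 2 + 1 / 2 * s)) k)
        (conjRow (resFun h x y (x / 2 + -(1 / 2) * s)) k)) →
      rowClass (transKer h x) i = (1 / (Real.sqrt 2 : ℂ)) • foldOp hx (resRow h x y k) := by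
    intro y k i hi
    rw [e1, ← l2Class_smul _ (memLp_foldFun x (hm y k))]
    refine l2Class_congr ?_
    filter_upwards [ae_vol01_mem, hne] with s hs hsx
    by_cases hle : s ≤ x
    · have hlt : s < x := lt_of_le_of_ne hle hsx
      have a3 : (x / 2 + 1 / 2 * s : ℝ) ∈ Ioo (0 : ℝ) 1 :=
        ⟨by linarith [hs.1], by linarith [hs.2, hx.2]⟩
      have a4 : (x / 2 + -(1 / 2) * s : ℝ) ∈ Ioo (0 : ℝ) 1 :=
        ⟨by linarith, by linarith [hs.1, hx.2]⟩
      have c3 : (x / 2 + 1 / 2 * s : ℝ) ∈ Iic x := by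
        simp only [mem_Iic]; linarith
      have c4 : (x / 2 + -(1 / 2) * s : ℝ) ∈ Iic x := by
        simp only [mem_Iic]; linarith [hs.1, hx.1]
      rw [transKer, indicator_of_mem (show s ∈ Iic x from hle), foldFun,
        indicator_of_mem (show s ∈ Iic x from hle), zeroExt_of_mem a3, zeroExt_of_mem a4, resKer,
        resKer, indicator_of_mem c3, indicator_of_mem c4, smul_smul, h2]
      exact hi s
    · rw [transKer, indicator_of_notMem (show s ∉ Iic x from hle), foldFun,
        indicator_of_notMem (show s ∉ Iic x from hle), smul_zero]
      ext j; simp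
  rcases i with k | k
  · refine key x k _ fun s => ?_
    ext j
    rcases j with j | j <;> simp [transFun]
  · refine key 0 k _ fun s => ?_
    ext j
    rcases j with j | j <;> simp [transFun]

/-- The cancellation required by `factorization_of_rows` is the image under the fold on (0,x) of the
resolvent equation: with y = x for the upper block of rows, since (x+x)/2 = x, and with y = 0 for
the lower block, since (x-x)/2 = 0. -/
theorem glm_factorization (hh : IsKreinKernel h) :
    (1 + rowOp fun x => rowClass (transKer h x)) * (1 + rowOp (glmRows h)) *
      (1 + ContinuousLinearMap.adjoint (rowOp fun x => rowClass (transKer h x))) = 1 := by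
  have hcut : ∀ x ∈ Ioo (0 : ℝ) 1, ∀ i,
      cut x (rowClass (transKer h x) i) = rowClass (transKer h x) i := by
    intro x hx i
    rw [rowClass_transKer hh (Ioo_subset_Icc_self hx), map_smul, cut_foldOp]
  refine factorization_of_rows (continuous_rowClass_transKer hh) (continuous_glmRows hh.memLp)
    (adjoint_rowOp_glmRows hh) hcut fun x hx i => ?_
  have hx' := Ioo_subset_Icc_self hx
  have key : ∀ y k, (1 / (Real.sqrt 2 : ℂ)) • foldOp hx' (resRow h x y k) +
      (1 / (Real.sqrt 2 : ℂ)) • foldOp hx' (convRows h y k) +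
      cut x (rowOp (glmRows h) ((1 / (Real.sqrt 2 : ℂ)) • foldOp hx' (resRow h x y k))) = 0 := by
    intro y k
    rw [map_smul, map_smul, cut_rowOp_glmRows hh.memLp, hh.cut_resRow, ← smul_add, ← smul_add,
      ← foldOp_cut hx' (convRows h y k), ← foldOp_cut hx' (convOp h (resRow h x y k)),
      ← map_add, ← map_add, hh.resRow_equation, map_zero, smul_zero]
  have hg1 : ∀ k, cut x (glmRows h x (Sum.inl k)) =
      (1 / (Real.sqrt 2 : ℂ)) • foldOp hx' (convRows h x k) := by
    intro k
    have : x / 2 + 1 / 2 * x = x := by ring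
    rw [glmRows, Sum.elim_inl, map_smul, cut_unfoldOp_convRows hh.memLp hx', this]
  have hg2 : ∀ k, cut x (glmRows h x (Sum.inr k)) =
      (1 / (Real.sqrt 2 : ℂ)) • foldOp hx' (convRows h 0 k) := by
    intro k
    have : x / 2 + 1 / 2 * -x = 0 := by ring
    rw [glmRows, Sum.elim_inr, map_smul, cut_unfoldOp_convRows hh.memLp hx', this]
  rw [rowClass_transKer hh hx']
  rcases i with k | k
  · rw [hg1]; exact key x k
  · rw [hg2]; exact key 0 k

theorem isUnit_one_add_transKer (hh : IsKreinKernel h) :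
    IsUnit (1 + rowOp fun x => rowClass (transKer h x)) :=
  isUnit_one_add_of_isLower (isLower_rowOp (continuous_rowClass_transKer hh) fun x hx i => by
    rw [rowClass_transKer hh (Ioo_subset_Icc_self hx), map_smul, cut_foldOp])
    (rowBdd_rowOp (continuous_rowClass_transKer hh))

end Rows

/-! ### The representation of `φ_q` by the transformation kernel -/

section Representation

variable {r : ℕ} {h : ℝ → Mat (Fin r)}

/-- The rows of a matrix selected by `e`. -/
def rowsCLM (e : Fin r → Two r) : Matrix (Two r) (Fin r) ℂ →L[ℂ] Mat (Fin r) :=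
  LinearMap.toContinuousLinearMap
    { toFun := fun B => B.submatrix e id
      map_add' := fun _ _ => rfl
      map_smul' := fun _ _ => rfl }

theorem eq_of_rowsCLM {B C : Matrix (Two r) (Fin r) ℂ}
    (h₁ : rowsCLM Sum.inl B = rowsCLM Sum.inl C) (h₂ : rowsCLM Sum.inr B = rowsCLM Sum.inr C) :
    B = C := by
  ext i j
  rcases i with i | i
  · exact congrFun (congrFun h₁ i) j
  · exact congrFun (congrFun h₂ i) j

theorem rowsCLM_inl_smul_fromRows (c : ℂ) (A B : Mat (Fin r)) :
    rowsCLM Sum.inl (c • Matrix.fromRows A B) = c • A := rfl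

theorem rowsCLM_inr_smul_fromRows (c : ℂ) (A B : Mat (Fin r)) :
    rowsCLM Sum.inr (c • Matrix.fromRows A B) = c • B := rfl

/-- The Krein system has the exponent 2iz on one component only. The factor e^{-izx} distributes it
evenly as ±iz over the two components, which is the Dirac form. -/
theorem IsKreinKernel.kreinP_integral_eq (hh : IsKreinKernel h) (z : ℂ) {x : ℝ}
    (hx : x ∈ Icc (0 : ℝ) 1) :
    Complex.exp (-(Complex.I * z) * x) • kreinP h z x = 1 + ∫ t in (0 : ℝ)..x,
      ((Complex.I * z) • (Complex.exp (-(Complex.I * z) * t) • kreinP h z t) +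
        resKer h t t 0 * (Complex.exp (-(Complex.I * z) * t) • kreinPs h z t)) := by
  have e0 : ∀ t : ℝ, Complex.exp (Complex.I * z * t) * Complex.exp (-(2 * Complex.I * z * t)) =
      Complex.exp (-(Complex.I * z) * t) := fun t => by
    rw [← Complex.exp_add]; congr 1; ring
  have hγ : Integrable (fun y : ℝ => resKer h y y 0 *
      (Complex.exp (-(2 * Complex.I * z * y)) • kreinPs h z y)) vol01 := by
    refine (memLp_mul_continuousOn hh.memLp_boundary ?_).integrable one_le_two
    exact ContinuousOn.smul (f := fun y : ℝ => Complex.exp (-(2 * Complex.I * z * y)))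
      (by fun_prop) (hh.continuousOn_kreinPs z)
  have h1 := exp_smul_primitive hγ (1 : Mat (Fin r)) (Complex.I * z) hx
  rw [← hh.kreinP_eq hx, smul_smul, e0] at h1
  rw [h1]
  congr 1
  refine intervalIntegral_congr_vol01 ?_ hx
  filter_upwards [ae_vol01_mem] with t ht
  rw [← hh.kreinP_eq (Ioo_subset_Icc_self ht), smul_smul (Complex.exp _) (Complex.exp _), e0,
    ← Matrix.mul_smul, smul_smul (Complex.exp _) (Complex.exp _), e0]

theorem IsKreinKernel.kreinPs_integral_eq (hh : IsKreinKernel h) (z : ℂ) {x : ℝ}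
    (hx : x ∈ Icc (0 : ℝ) 1) :
    Complex.exp (-(Complex.I * z) * x) • kreinPs h z x = 1 + ∫ t in (0 : ℝ)..x,
      (-(Complex.I * z) • (Complex.exp (-(Complex.I * z) * t) • kreinPs h z t) +
        (resKer h t t 0)ᴴ * (Complex.exp (-(Complex.I * z) * t) • kreinP h z t)) := by
  have hγ : Integrable (fun y : ℝ => (resKer h y y 0)ᴴ * kreinP h z y) vol01 :=
    (memLp_mul_continuousOn (memLp_conjTranspose hh.memLp_boundary)
      (hh.continuousOn_kreinP z)).integrable one_le_two
  have h1 := exp_smul_primitive hγ (1 : Mat (Fin r)) (-(Complex.I * z)) hx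
  rw [← hh.kreinPs_eq hx] at h1
  rw [h1]
  congr 1
  refine intervalIntegral_congr_vol01 ?_ hx
  filter_upwards [ae_vol01_mem] with t ht
  rw [← hh.kreinPs_eq (Ioo_subset_Icc_self ht), Matrix.mul_smul]

theorem IsKreinKernel.phi_eq_kreinP (hh : IsKreinKernel h) {q : Potential r}
    (hq : q =ᵐ[vol01] fun x => Complex.I • resKer h x x 0) (z : ℂ) {x : ℝ}
    (hx : x ∈ Icc (0 : ℝ) 1) : phi q z x = (-Complex.I / (Real.sqrt 2 : ℂ)) •
      Matrix.fromRows (Complex.exp (-(Complex.I * z) * x) • kreinP h z x)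
        (Complex.exp (-(Complex.I * z) * x) • kreinPs h z x) :=
  phi_eq_of_system q z hq hh.memLp_boundary
    (ContinuousOn.smul (f := fun y : ℝ => Complex.exp (-(Complex.I * z) * y)) (by fun_prop)
      (hh.continuousOn_kreinP z))
    (ContinuousOn.smul (f := fun y : ℝ => Complex.exp (-(Complex.I * z) * y)) (by fun_prop)
      (hh.continuousOn_kreinPs z))
    (fun _ hx => hh.kreinP_integral_eq z hx) (fun _ hx => hh.kreinPs_integral_eq z hx) x hx

/-- The integrals of one row of blocks of the transformation kernel against `φ₀`. -/
theorem IsKreinKernel.integral_fold_resKer (hh : IsKreinKernel h) (z : ℂ) {x : ℝ}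
    (hx : x ∈ Icc (0 : ℝ) 1) (y : ℝ) :
    ∫ s in (0 : ℝ)..x, (1 / 2 : ℝ) •
      (Complex.exp (Complex.I * z * s) • resKer h x y (x / 2 + 1 / 2 * s) +
        Complex.exp (-(Complex.I * z) * s) • resKer h x y (x / 2 + -(1 / 2) * s)) =
      Complex.exp (-(Complex.I * z) * x) •
        ∫ s in (0 : ℝ)..x, Complex.exp (2 * Complex.I * z * s) • resKer h x y s := by
  have hm := (hh.integrable_exp_smul_resKer x y z).smul (Complex.exp (-(Complex.I * z) * x))
  rw [← intervalIntegral.integral_smul]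
  refine Eq.trans ?_ (integral_fold hm hx)
  refine intervalIntegral.integral_congr fun s _ => ?_
  have e1 : Complex.exp (-(Complex.I * z) * x) *
      Complex.exp (2 * Complex.I * z * ((x / 2 + 1 / 2 * s : ℝ) : ℂ)) =
        Complex.exp (Complex.I * z * s) := by
    rw [← Complex.exp_add]; congr 1; push_cast; ring
  have e2 : Complex.exp (-(Complex.I * z) * x) *
      Complex.exp (2 * Complex.I * z * ((x / 2 + -(1 / 2) * s : ℝ) : ℂ)) =
        Complex.exp (-(Complex.I * z) * s) := by
    rw [← Complex.exp_add]; congr 1; push_cast; ring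
  simp only [Pi.smul_apply, smul_smul (Complex.exp _) (Complex.exp _), e1, e2]

theorem transKer_mul_phi_zero (z : ℂ) {x s : ℝ} (hx : x ∈ Icc (0 : ℝ) 1) (hs : s ∈ Ioc (0 : ℝ) x) :
    transKer h x s * phi (0 : Potential r) z s = (-Complex.I / (Real.sqrt 2 : ℂ)) •
      Matrix.fromRows
        ((1 / 2 : ℝ) • (Complex.exp (Complex.I * z * s) • resKer h x x (x / 2 + 1 / 2 * s) +
          Complex.exp (-(Complex.I * z) * s) • resKer h x x (x / 2 + -(1 / 2) * s)))
        ((1 / 2 : ℝ) • (Complex.exp (Complex.I * z * s) • resKer h x 0 (x / 2 + 1 / 2 * s) +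
          Complex.exp (-(Complex.I * z) * s) • resKer h x 0 (x / 2 + -(1 / 2) * s))) := by
  have c3 : (x / 2 + 1 / 2 * s : ℝ) ∈ Iic x := by
    simp only [mem_Iic]; linarith [hs.2]
  have c4 : (x / 2 + -(1 / 2) * s : ℝ) ∈ Iic x := by
    simp only [mem_Iic]; linarith [hs.1, hx.1]
  have hr : ∀ A : Mat (Fin r), (1 / 2 : ℝ) • A = (1 / 2 : ℂ) • A := fun A => by
    ext i j; simp [Matrix.smul_apply]
  rw [phi_zero_eq z ⟨hs.1.le, hs.2.trans hx.2⟩, transKer, indicator_of_mem (show s ∈ Iic x from hs.2),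
    transFun, Matrix.mul_smul, Matrix.smul_mul, Matrix.fromBlocks_mul_fromRows, hr, hr, resKer, resKer,
    indicator_of_mem c3, indicator_of_mem c4, resKer, resKer, indicator_of_mem c3,
    indicator_of_mem c4]
  simp only [Matrix.mul_smul, Matrix.mul_one]
  congr 1
  ext i j
  rcases i with i | i <;> rfl

/-- Applied to φ₀, the blocks of the kernel pair e^{±izs} with the resolvent kernel at (x±s)/2, and
folding collects them into e^{-izx}∫₀ˣ e^{2izu}Γ(u) du. These are the integral parts of e^{-izx}P
and e^{-izx}P_*, whose free parts e^{±izx} make up φ₀. -/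
theorem IsKreinKernel.phi_eq_add_integral (hh : IsKreinKernel h) {q : Potential r}
    (hq : q =ᵐ[vol01] fun x => Complex.I • resKer h x x 0) (z : ℂ) {x : ℝ}
    (hx : x ∈ Icc (0 : ℝ) 1) :
    phi q z x = phi 0 z x + ∫ s in (0 : ℝ)..x, transKer h x s * phi (0 : Potential r) z s := by
  have hI : IntervalIntegrable (fun s => transKer h x s * phi (0 : Potential r) z s) volume 0 x :=
    intervalIntegrable_of_integrable_vol01 ((memLp_mul_continuousOn (memLp_transKer hh x)
      (continuousOn_phi 0 z)).integrable one_le_two) ⟨le_rfl, zero_le_one⟩ hx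
  have hc : ∀ e : Fin r → Two r,
      rowsCLM e (∫ s in (0 : ℝ)..x, transKer h x s * phi (0 : Potential r) z s) =
        ∫ s in (0 : ℝ)..x, rowsCLM e (transKer h x s * phi (0 : Potential r) z s) := fun e =>
    ((rowsCLM e).intervalIntegral_comp_comm hI).symm
  have e0 : Complex.exp (-(Complex.I * z) * x) * Complex.exp (2 * Complex.I * z * x) =
      Complex.exp (Complex.I * z * x) := by
    rw [← Complex.exp_add]; congr 1; ring
  have key : ∀ (e : Fin r → Two r) (y : ℝ), (∀ s ∈ Ioc 0 x,
      rowsCLM e (transKer h x s * phi (0 : Potential r) z s) = (-Complex.I / (Real.sqrt 2 : ℂ)) •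
        ((1 / 2 : ℝ) • (Complex.exp (Complex.I * z * s) • resKer h x y (x / 2 + 1 / 2 * s) +
        Complex.exp (-(Complex.I * z) * s) • resKer h x y (x / 2 + -(1 / 2) * s)))) →
      rowsCLM e (∫ s in (0 : ℝ)..x, transKer h x s * phi (0 : Potential r) z s) =
        (-Complex.I / (Real.sqrt 2 : ℂ)) • (Complex.exp (-(Complex.I * z) * x) •
          ∫ s in (0 : ℝ)..x, Complex.exp (2 * Complex.I * z * s) • resKer h x y s) := by
    intro e y he
    rw [hc, ← hh.integral_fold_resKer z hx, ← intervalIntegral.integral_smul]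
    refine intervalIntegral.integral_congr_ae (ae_of_all _ fun s hs => ?_)
    rw [uIoc_of_le hx.1] at hs
    exact he s hs
  rw [hh.phi_eq_kreinP hq z hx, phi_zero_eq z hx]
  refine eq_of_rowsCLM ?_ ?_
  · rw [map_add, key Sum.inl x fun s hs => by
      rw [transKer_mul_phi_zero z hx hs, rowsCLM_inl_smul_fromRows]]
    rw [rowsCLM_inl_smul_fromRows, rowsCLM_inl_smul_fromRows, kreinP, ← smul_add, smul_add,
      smul_smul, e0]
  · rw [map_add, key Sum.inr 0 fun s hs => by
      rw [transKer_mul_phi_zero z hx hs, rowsCLM_inr_smul_fromRows]]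
    rw [rowsCLM_inr_smul_fromRows, rowsCLM_inr_smul_fromRows, kreinPs, ← smul_add, smul_add]

theorem IsKreinKernel.isTransformationKernel (hh : IsKreinKernel h) {q : Potential r}
    (hq : q =ᵐ[vol01] fun x => Complex.I • resKer h x x 0) :
    IsTransformationKernel q (transKer h) where
  isG2Plus := (hasL2Sections_transFun hh).isG2Plus
  representation := fun z _ hx => hh.phi_eq_add_integral hq z hx

end Representation

/-! ### The integral operator with a transformation kernel -/

section IntegralOperator

variable {r : ℕ} {q : Potential r} {K K' : ℝ → ℝ → Mat (Two r)}
  {T T' : HSpace r →L[ℂ] HSpace r}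

theorem isIntegralOperator_rowOp {κ : ℝ → ℝ → Mat (Two r)} (hκ : ∀ x, MemLp (κ x) 2 vol01)
    (hc : Continuous fun x => rowClass (κ x)) (he : ∀ x ∈ Ioo (0 : ℝ) 1, κ x = K x) :
    IsIntegralOperator K (rowOp fun x => rowClass (κ x)) := by
  intro f
  filter_upwards [coeFn_rowOp hc f, ae_vol01_mem] with x h1 hx
  rw [h1, ← integral_vol01_eq]
  ext k
  rw [rowFun_apply, inner_rowClass_left (hκ x), he x hx]

theorem IsG2.exists_isIntegralOperator (hK : IsG2 K) : ∃ T, IsIntegralOperator K T := by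
  -- `rowOp` needs rows continuous on the whole line, whereas a G₂ kernel is controlled only for x
  -- in [0,1]; clamping x to [0,1] changes nothing there.
  have h1 : ∀ x : ℝ, MemLp (K (projIcc (0 : ℝ) 1 zero_le_one x)) 2 vol01 := fun x =>
    hK.memLp_left _ (projIcc (0 : ℝ) 1 zero_le_one x).2
  have h2 : Continuous fun x : ℝ => l2Class vol01 (K (projIcc (0 : ℝ) 1 zero_le_one x)) :=
    hK.continuous_left.comp_continuous (continuous_subtype_val.comp continuous_projIcc)
      fun x => (projIcc (0 : ℝ) 1 zero_le_one x).2
  refine ⟨_, isIntegralOperator_rowOp h1 (continuous_rowClass_of_continuous h1 h2)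
    fun x hx => ?_⟩
  rw [projIcc_of_mem zero_le_one (Ioo_subset_Icc_self hx)]

/-- Since K vanishes almost everywhere above the diagonal, the integral over (0,1) is the one over
(0,x) in the representation of φ_q. The action of T on these functions thus depends on q alone. -/
theorem IsTransformationKernel.integralOperator_opPhi (hK : IsTransformationKernel q K)
    (hT : IsIntegralOperator K T) (z : ℂ) (c : EuclideanSpace ℂ (Fin r)) :
    T (opPhi 0 z c) =ᵐ[vol01] fun x => vecCLM c (phi q z x - phi 0 z x) := by
  have hle : ∀ᵐ p : ℝ × ℝ ∂(vol01.prod vol01), p ∈ OmegaMinus → K p.1 p.2 = 0 := by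
    rw [Measure.prod_restrict]
    exact ae_restrict_of_ae ((ae_restrict_iff' measurableSet_omegaMinus).1 hK.isG2Plus.lower)
  filter_upwards [hT (opPhi 0 z c), Measure.ae_ae_of_ae_prod hle, ae_vol01_mem] with x h1 h2 hx
  have hx' := Ioo_subset_Icc_self hx
  have hI : IntervalIntegrable (fun s => K x s * phi (0 : Potential r) z s) volume 0 x :=
    intervalIntegrable_of_integrable_vol01 ((memLp_mul_continuousOn
      (hK.isG2Plus.memLp_left x hx') (continuousOn_phi 0 z)).integrable one_le_two)
      ⟨le_rfl, zero_le_one⟩ hx'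
  have e : phi q z x - phi 0 z x = ∫ s in (0 : ℝ)..x, K x s * phi (0 : Potential r) z s := by
    rw [hK.representation z x hx', add_sub_cancel_left]
    rfl
  rw [h1, e, ← (vecCLM c).intervalIntegral_comp_comm hI, ← integral_vol01_eq,
    ← integral_vol01_indicator _ hx']
  refine integral_congr_ae ?_
  filter_upwards [h2, coeFn_opPhi (0 : Potential r) z c, ae_vol01_mem] with s h3 h4 hs
  rw [h4, act_vecCLM]
  by_cases hsx : s ≤ x
  · rw [indicator_of_mem (show s ∈ Iic x from hsx)]
  · rw [indicator_of_notMem (show s ∉ Iic x from hsx),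
      h3 ⟨hx.1.le, not_le.1 hsx, hs.2.le⟩, Matrix.zero_mul, map_zero]

/-- The integral operators of all transformation kernels of a potential coincide. -/
theorem IsTransformationKernel.integralOperator_unique (hK : IsTransformationKernel q K)
    (hK' : IsTransformationKernel q K') (hT : IsIntegralOperator K T)
    (hT' : IsIntegralOperator K' T') : T = T' := by
  -- T - T' vanishes on all Φ₀(πm)c, so the range of its adjoint is orthogonal to this complete
  -- system.
  have h0 : ContinuousLinearMap.adjoint (T - T') = 0 := by
    ext1 g
    refine eq_zero_of_inner_opPhi fun m c => ?_
    have h1 : (T - T') (opPhi 0 ((Real.pi * m : ℝ) : ℂ) c) = 0 := by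
      rw [sub_apply, sub_eq_zero]
      exact Lp.ext ((hK.integralOperator_opPhi hT _ c).trans
        (hK'.integralOperator_opPhi hT' _ c).symm)
    rw [ContinuousLinearMap.adjoint_inner_right, h1, inner_zero_left]
  have h2 := congrArg ContinuousLinearMap.adjoint h0
  rw [ContinuousLinearMap.adjoint_adjoint, map_zero] at h2
  exact sub_eq_zero.1 h2

theorem isTransformationKernel_transformationKernel (hK : IsTransformationKernel q K) :
    IsTransformationKernel q (transformationKernel q) :=
  Classical.epsilon_spec (p := IsTransformationKernel q) ⟨K, hK⟩

theorem isIntegralOperator_opK (hK : IsTransformationKernel q (transformationKernel q)) :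
    IsIntegralOperator (transformationKernel q) (opK q) :=
  Classical.epsilon_spec (p := IsIntegralOperator (transformationKernel q))
    hK.isG2Plus.toIsG2.exists_isIntegralOperator

/-- The kernel picked by choice need not be `transKer h` itself, but both are transformation kernels
of q, so their integral operators coincide. -/
theorem IsKreinKernel.opK_eq {h : ℝ → Mat (Fin r)} (hh : IsKreinKernel h)
    (hq : q =ᵐ[vol01] fun x => Complex.I • resKer h x x 0) :
    opK q = rowOp fun x => rowClass (transKer h x) := by
  have hK := isTransformationKernel_transformationKernel (hh.isTransformationKernel hq)
  exact hK.integralOperator_unique (hh.isTransformationKernel hq) (isIntegralOperator_opK hK)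
    (isIntegralOperator_rowOp (memLp_transKer hh) (continuous_rowClass_transKer hh) fun _ _ => rfl)

end IntegralOperator

/-! ### The operator `U_{a,0}` -/

section SpectralSum

variable {r : ℕ} {a : SpectralCollection r}

theorem SpectralCollection.A1.isSpectralSum_opU (h1 : a.A1) : IsSpectralSum a 0 (opU a 0) :=
  Classical.epsilon_spec (p := IsSpectralSum a 0) ⟨_, h1.isSpectralSum⟩

theorem SpectralCollection.A1.opU_eq (h1 : a.A1) (h3 : a.A3) :
    opU a 0 = 1 + rowOp (glmRows (SpectralCollection.hmuRep a)) := by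
  have e : opU a 0 = unfoldOp.comp ((SpectralCollection.accOp a).comp
      (ContinuousLinearMap.adjoint (unfoldOp (r := r)))) := by
    ext1 f
    exact (h1.isSpectralSum_opU f).unique (h1.isSpectralSum f)
  rw [e, rowOp_glmRows_eq (h1.isKreinKernel h3).memLp, h1.accOp_eq]
  ext1 f
  change unfoldOp (ContinuousLinearMap.adjoint unfoldOp f +
    convOp _ (ContinuousLinearMap.adjoint unfoldOp f)) = f + unfoldOp (convOp _ _)
  rw [map_add, unfoldOp_adjoint_unfoldOp]
  rfl

end SpectralSum

end DiracInverse

end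

/-- The first eight clauses say that the objects in the factorization exist; each of them is
determined by its defining property. The last three clauses are the factorization. -/
theorem theorem8 (r : ℕ) (a : DiracInverse.SpectralCollection r) (h1 : a.A1) (h3 : a.A3)
    (q : DiracInverse.Potential r) (hq : q = DiracInverse.Theta a.Hmu) :
    Tendsto (fun n : ℕ => DiracInverse.l2Class DiracInverse.volSym (a.truncatedTransform n))
        atTop (𝓝 a.Hmu) ∧
    a.Hmu ∈ DiracInverse.symAccelerants r ∧
    DiracInverse.IsKreinSolution a.Hmu (DiracInverse.kreinSolution a.Hmu) ∧
    (∀ z : ℂ, DiracInverse.IsCauchySolution 0 z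
      (DiracInverse.cauchyU (0 : DiracInverse.Potential r) z)) ∧
    (∀ z : ℂ, DiracInverse.IsCauchySolution q z (DiracInverse.cauchyU q z)) ∧
    DiracInverse.IsTransformationKernel q (DiracInverse.transformationKernel q) ∧
    DiracInverse.IsIntegralOperator (DiracInverse.transformationKernel q)
      (DiracInverse.opK q) ∧
    DiracInverse.IsSpectralSum a 0 (DiracInverse.opU a 0) ∧
    IsUnit (1 + DiracInverse.opK q) ∧
    IsUnit (1 + ContinuousLinearMap.adjoint (DiracInverse.opK q)) ∧
    DiracInverse.opU a 0 =
      Ring.inverse (1 + DiracInverse.opK q) *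
        Ring.inverse (1 + ContinuousLinearMap.adjoint (DiracInverse.opK q)) := by
  have hh := h1.isKreinKernel h3
  have hH := h1.hmu_ae_eq
  have hq' : q =ᵐ[DiracInverse.vol01]
      fun x => Complex.I • DiracInverse.resKer (DiracInverse.SpectralCollection.hmuRep a) x x 0 := by
    rw [hq]; exact hh.coeFn_Theta hH
  have hK := DiracInverse.isTransformationKernel_transformationKernel (hh.isTransformationKernel hq')
  have hu : IsUnit (1 + DiracInverse.opK q) := by
    rw [hh.opK_eq hq']; exact DiracInverse.isUnit_one_add_transKer hh
  have hu' : IsUnit (1 + ContinuousLinearMap.adjoint (DiracInverse.opK q)) := by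
    have := hu.star
    rwa [star_add, star_one] at this
  refine ⟨h1.tendsto_hmu, ⟨hh.isAccelerant hH, h1.hmu_symm⟩, hh.isKreinSolution_kreinSolution hH,
    fun z => DiracInverse.isCauchySolution_cauchyU 0 z,
    fun z => DiracInverse.isCauchySolution_cauchyU q z, hK, DiracInverse.isIntegralOperator_opK hK,
    h1.isSpectralSum_opU, hu, hu', ?_⟩
  have hf := DiracInverse.glm_factorization hh
  rw [← hh.opK_eq hq', ← h1.opU_eq h3] at hf
  -- The invertible factors 1 + K and 1 + K* are inserted with their inverses, so that the middle
  -- product is the factorization and equals 1.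
  calc DiracInverse.opU a 0 = Ring.inverse (1 + DiracInverse.opK q) *
        ((1 + DiracInverse.opK q) * DiracInverse.opU a 0 *
          (1 + ContinuousLinearMap.adjoint (DiracInverse.opK q))) *
        Ring.inverse (1 + ContinuousLinearMap.adjoint (DiracInverse.opK q)) := by
        rw [mul_assoc, mul_assoc ((1 + DiracInverse.opK q) * _), Ring.mul_inverse_cancel _ hu',
          mul_one, ← mul_assoc, Ring.inverse_mul_cancel _ hu, one_mul]
    _ = _ := by rw [hf, mul_one]
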